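/- Model. Fix $p\in(0,1/2]$, $\lambda>1$. For every $d>0$ let $a,b,c$ (depending on $d$) satisfy $pa+(1-p)b=pb+(1-p)c=1$ and $d(1-b)^2=\lambda$. For $d$ large and then $n$ large, the stochastic block model $G$ on the vertices $1,\dots,n$ is defined as follows: the labels $X_i\in\{1,2\}$ are independent with $\mathbb P(X_i=1)=p$, and given the labels each pair $\{i,j\}$ is independently an edge with probability $M_{X_i,X_j}$, where $M=\frac dn\begin{pmatrix}a&b\\ b&c\end{pmatrix}$. For $q\in[0,1]$, each label is moreover revealed with probability $q$, independently of everything else. A test $T(G,q)=(T_1,\dots,T_n)\in\{1,2\}^n$ is a function of the graph $G$ and of the revealed labels; it is $t$-local if each $T_i$ is a function of the subgraph of $G$ induced by the vertices at distance at most $t$ from $i$ and of the revealed labels of these vertices. Its rescaled success probability is $$P_{succ}(T)=\frac1n\sum_{i=1}^n\big(\mathbb P(T_i=1\mid X_i=1)+\mathbb P(T_i=2\mid X_i=2)-1\big).$$ Let $T^{opt}(G)$ be the optimal test without revealed labels: $T_i^{opt}=1$ if $\mathbb P(X_i=1\mid G)/\mathbb P(X_i=2\mid G)\ge p/(1-p)$,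 and $T_i^{opt}=2$ otherwise. For $\mu\ge0$ let $$\mathsf G(\mu)=\frac{\lambda}{(1-p)^2}\,\mathbb E\Big[\frac1{p+(1-p)\exp(\sqrt\mu Z-\mu/2)}-1\Big],\qquad Z\sim\mathcal N(0,1).$$ Proposition. The function $\mathsf G$ has a least positive fixed point $\alpha$ (if $\mathsf G$ has only one positive fixed point, then $\alpha$ is that one). For every $0<q\le1$ there are an integer $t$ and $t$-local tests $T=T^{(d,n)}$ (with $t$ independent of $d$ and $n$) such that the limit $\lim_{d\to\infty}\lim_{n\to\infty}P_{succ}(T(G,q))$ exists and $$\lim_{d\to\infty}\lim_{n\to\infty}P_{succ}(T(G,q))\ \ge\ 2\,\mathbb P\big(\mathcal N(\alpha/2,\alpha)>0\big)-1 .$$ If moreover $\alpha$ is the only positive fixed point of $\mathsf G$, then $$\limsup_{d\to\infty}\limsup_{n\to\infty}P_{succ}(T^{opt}(G))\ \le\ 2\,\mathbb P\big(\mathcal N(\alpha/2,\alpha)>0\big)-1,$$ so that, however small $q>0$ is, local tests perform in the limit at least as well as the optimal test without side information. -/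

import Mathlib

open Set Filter Topology MeasureTheory ProbabilityTheory

noncomputable section

namespace SBM

/-- The two communities: `0 : Fin 2` is community `1`, and `1 : Fin 2` is community `2`. -/
abbrev Label : Type := Fin 2

/-- An outcome of the stochastic block model on `n` vertices with revealed labels: the labels `X` of
all the vertices, the graph `G`, and the set `E` of the vertices whose label is revealed. -/
abbrev Outcome (n : ℕ) : Type := (Fin n → Label) × SimpleGraph (Fin n) × Finset (Fin n)

/-- The labels of an outcome. -/
def labels {n : ℕ} (ω : Outcome n) : Fin n → Label := ω.1

/-- The graph of an outcome. -/
def graph {n : ℕ} (ω : Outcome n) : SimpleGraph (Fin n) := ω.2.1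

open Classical in
/-- The observed labels of an outcome: `some (X v)` when `v` is revealed, `none` otherwise. -/
def observed {n : ℕ} (ω : Outcome n) : Fin n → Option Label :=
  fun v => if v ∈ ω.2.2 then some (ω.1 v) else none

/-- The law of one label: community `1` with probability `p`, community `2` with probability
`1 - p`. -/
def labelWeight (p : ℝ) (x : Label) : ℝ := if x = 0 then p else 1 - p

open Classical in
/-- The joint probability of the labels `X` and the graph `G` in the stochastic block model with
parameters `(M, n, p)`: the labels are independent, and given the labels each pair `{i, j}` is an
edge with probability `M (X i) (X j)`, independently of the other pairs. (This is a probability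
when `p` and the entries of `M` are in `[0, 1]`.) -/
def sbmWeight {n : ℕ} (M : Matrix Label Label ℝ) (p : ℝ) (X : Fin n → Label)
    (G : SimpleGraph (Fin n)) : ℝ :=
  (∏ i, labelWeight p (X i)) *
    ∏ e : Fin n × Fin n with e.1 < e.2,
      if G.Adj e.1 e.2 then M (X e.1) (X e.2) else 1 - M (X e.1) (X e.2)

open Classical in
/-- The probability of an outcome when moreover each vertex is revealed with probability `q`,
independently of everything else. -/
def weight {n : ℕ} (M : Matrix Label Label ℝ) (p q : ℝ) (ω : Outcome n) : ℝ :=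
  sbmWeight M p ω.1 ω.2.1 * ∏ v, if v ∈ ω.2.2 then q else 1 - q

open Classical in
/-- The probability of an event. -/
def prob {n : ℕ} (M : Matrix Label Label ℝ) (p q : ℝ) (A : Set (Outcome n)) : ℝ :=
  ∑ ω : Outcome n with ω ∈ A, weight M p q ω

/-- The conditional probability of `A` given `B`. -/
def condProb {n : ℕ} (M : Matrix Label Label ℝ) (p q : ℝ) (A B : Set (Outcome n)) : ℝ :=
  prob M p q (A ∩ B) / prob M p q B

/-- A test with side information: it guesses the label of every vertex from the graph and the
observed labels. -/
abbrev Test (n : ℕ) : Type := SimpleGraph (Fin n) → (Fin n → Option Label) → Fin n → Label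

/-- The rescaled average success probability of a test,
`1/n * ∑ i, (P(T_i = 1 | X_i = 1) + P(T_i = 2 | X_i = 2) - 1)`. -/
def successProb {n : ℕ} (M : Matrix Label Label ℝ) (p q : ℝ) (T : Test n) : ℝ :=
  (1 / (n : ℝ)) * ∑ i : Fin n,
    (condProb M p q {ω | T (graph ω) (observed ω) i = 0} {ω | labels ω i = 0}
      + condProb M p q {ω | T (graph ω) (observed ω) i = 1} {ω | labels ω i = 1} - 1)

/-- The vertices at distance at most `t` from `i`. -/
def ball {n : ℕ} (G : SimpleGraph (Fin n)) (i : Fin n) (t : ℕ) : Set (Fin n) :=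
  {j | G.edist i j ≤ (t : ℕ∞)}

/-- The test `T` is `t`-local: its guess at `i` is a function of the graph induced by the vertices
at distance at most `t` from `i`, together with the observed labels of these vertices. -/
def IsLocal {n : ℕ} (t : ℕ) (T : Test n) : Prop :=
  ∀ (i : Fin n) (G G' : SimpleGraph (Fin n)) (Y Y' : Fin n → Option Label),
    ball G i t = ball G' i t →
    (∀ j ∈ ball G i t, ∀ k ∈ ball G i t, (G.Adj j k ↔ G'.Adj j k)) →
    (∀ j ∈ ball G i t, Y j = Y' j) →
    T G Y i = T G' Y' i

open Classical in
/-- The optimal test without side information: it guesses community `1` at `i` exactly when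
`P(X_i = 1 | G) / P(X_i = 2 | G) ≥ p / (1 - p)` (written without quotients). The observed labels
are ignored. -/
def optTest {n : ℕ} (M : Matrix Label Label ℝ) (p : ℝ) : Test n := fun H _ i =>
  if p * condProb M p 0 {ω | labels ω i = 1} {ω | graph ω = H}
      ≤ (1 - p) * condProb M p 0 {ω | labels ω i = 0} {ω | graph ω = H} then 0 else 1

/-- The connectivity matrix `(d / n) * [[a, b], [b, c]]`. -/
def connectivity (a b c d : ℝ) (n : ℕ) : Matrix Label Label ℝ :=
  (d / (n : ℝ)) • !![a, b; b, c]

/-- The function `G(μ) = λ / (1 - p)² * E[1 / (p + (1 - p) exp(√μ Z - μ / 2)) - 1]`, with `Z` a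
standard Gaussian. -/
def gaussMap (p lam μ : ℝ) : ℝ :=
  lam / (1 - p) ^ 2 *
    ∫ z, (1 / (p + (1 - p) * Real.exp (Real.sqrt μ * z - μ / 2)) - 1) ∂(gaussianReal 0 1)

/-- The quantity `2 P(N(α / 2, α) > 0) - 1`. -/
def gaussSuccess (α : ℝ) : ℝ :=
  2 * (gaussianReal (α / 2) α.toNNReal).real (Ioi 0) - 1

end SBM

end

/-! Around a vertex the sparse graph is close to a random tree, and on a tree the likelihoods of the
two root labels are computed recursively. The local test is belief propagation, `bpTest`: it
compares these likelihoods on the nonbacktracking unfolding of depth t. Its success probability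
approaches the tree quantity `treeValue`, since the laws of the unfolding and of the tree are close
in total variation (`abs_graph_sub_tree_le`). Conversely, a test that sees the whole graph but no
labels does no better than the tree test that is told all labels at the bottom level: given these
labels, the rest of the graph says nothing more about the root (`graph_le_tree`). This bounds every
test of the graph; the optimality of `optTest` plays no role.

To compare weights term by term, trees carry vertex names from `Fin n`. On trees with distinct names
and bounded size, the edge factors of the graph and of the tree coincide. The nonedge factors are
both close to exp(-k d), with k the number of vertices of positive height, once the label counts are
typical. Repeated names have probability O(1/n), and large trees are excluded by Markov's
inequality.

On the tree the log-likelihood ratio of the root is a sum over slots that are independent and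
identically distributed given the root label. As n tends to infinity its law becomes compound
Poisson (`exists_treeLimit`). As d then tends to infinity with d ε² = λ it becomes N(± μ/2, μ)
(`tendsto_gaussLaw`), where μ follows the recursion `evo`: a revealed child contributes λ / (p (1 -
p)) and a hidden one G(μ), because G is λ times the second moment of the posterior discrepancy
(`gaussMap_eq_integral_disc`). The limiting success probability is `gaussGain` of μ, which equals 2
P(N(μ/2, μ) > 0) - 1 and is monotone in μ.

It remains to study G on the half-line. It is continuous and monotone by Jensen, vanishes at 0, lies
above the diagonal near 0 because λ > 1, and stays below λ / (p (1 - p)); hence it has a least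
positive fixed point α. If q > 0, each step below α gains at least a fixed amount, so α is reached
at a finite depth (`exists_le_evo`). If exactly the bottom labels are known, μ starts above all
values of G and decreases to a fixed point (`exists_tendsto_evo`), which is at most α when α is the
only positive one. -/

noncomputable section

namespace SBM

/-! ### Expectations over independent coordinates, as finite sums. -/

section ProductExpectation

variable {ι α : Type*} [Fintype ι] [Fintype α]

/-- The expectation of `φ` when the coordinates are independent with weights `w`. -/
def prodExp (w : α → ℝ) (φ : (ι → α) → ℝ) : ℝ := by
  classical exact ∑ ξ : ι → α, (∏ i, w (ξ i)) * φ ξ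

theorem prodExp_eq [DecidableEq ι] (w : α → ℝ) (φ : (ι → α) → ℝ) :
    prodExp w φ = ∑ ξ : ι → α, (∏ i, w (ξ i)) * φ ξ := by
  unfold prodExp
  congr!

theorem prodExp_prod (w : α → ℝ) (f : ι → α → ℝ) :
    prodExp w (fun ξ => ∏ i, f i (ξ i)) = ∏ i, ∑ m, w m * f i m := by
  classical
  rw [prodExp_eq, Finset.prod_univ_sum, Fintype.piFinset_univ]
  exact Finset.sum_congr rfl fun ξ _ => by rw [Finset.prod_mul_distrib]

theorem prodExp_one {w : α → ℝ} (hw : ∑ m, w m = 1) :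
    prodExp w (fun _ : ι → α => 1) = 1 := by
  have := prodExp_prod (ι := ι) w (fun _ _ => 1)
  simpa [hw] using this

theorem prodExp_mul_left (w : α → ℝ) (c : ℝ) (φ : (ι → α) → ℝ) :
    prodExp w (fun ξ => c * φ ξ) = c * prodExp w φ := by
  classical
  simp only [prodExp_eq, Finset.mul_sum]
  exact Finset.sum_congr rfl fun ξ _ => by ring

theorem prodExp_const {w : α → ℝ} (hw : ∑ m, w m = 1) (c : ℝ) :
    prodExp w (fun _ : ι → α => c) = c := by
  have := prodExp_mul_left (ι := ι) w c (fun _ => 1)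
  simpa [prodExp_one hw] using this

theorem prodExp_add (w : α → ℝ) (φ ψ : (ι → α) → ℝ) :
    prodExp w (fun ξ => φ ξ + ψ ξ) = prodExp w φ + prodExp w ψ := by
  classical
  simp only [prodExp_eq, ← Finset.sum_add_distrib, mul_add]

theorem prodExp_sub (w : α → ℝ) (φ ψ : (ι → α) → ℝ) :
    prodExp w (fun ξ => φ ξ - ψ ξ) = prodExp w φ - prodExp w ψ := by
  classical
  simp only [prodExp_eq, ← Finset.sum_sub_distrib, mul_sub]

theorem prodExp_sum {κ : Type*} (s : Finset κ) (w : α → ℝ) (φ : κ → (ι → α) → ℝ) :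
    prodExp w (fun ξ => ∑ k ∈ s, φ k ξ) = ∑ k ∈ s, prodExp w (φ k) := by
  classical
  simp only [prodExp_eq, Finset.mul_sum]
  exact Finset.sum_comm

theorem prodExp_mono {w : α → ℝ} (hw : ∀ m, 0 ≤ w m) {φ ψ : (ι → α) → ℝ} (h : ∀ ξ, φ ξ ≤ ψ ξ) :
    prodExp w φ ≤ prodExp w ψ := by
  classical
  simp only [prodExp_eq]
  exact Finset.sum_le_sum fun ξ _ =>
    mul_le_mul_of_nonneg_left (h ξ) (Finset.prod_nonneg fun i _ => hw _)

theorem prodExp_nonneg {w : α → ℝ} (hw : ∀ m, 0 ≤ w m) {φ : (ι → α) → ℝ} (h : ∀ ξ, 0 ≤ φ ξ) :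
    0 ≤ prodExp w φ := by
  classical
  rw [prodExp_eq]
  exact Finset.sum_nonneg fun ξ _ => mul_nonneg (Finset.prod_nonneg fun i _ => hw _) (h ξ)

theorem abs_prodExp_le {w : α → ℝ} (hw : ∀ m, 0 ≤ w m) (φ : (ι → α) → ℝ) :
    |prodExp w φ| ≤ prodExp w (fun ξ => |φ ξ|) := by
  classical
  simp only [prodExp_eq]
  refine (Finset.abs_sum_le_sum_abs _ _).trans (Finset.sum_le_sum fun ξ _ => ?_)
  rw [abs_mul, abs_of_nonneg (Finset.prod_nonneg fun i _ => hw _)]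

/-- The expectation of a product is a double sum; exchanging the coordinates in `S` between the two
samples does not change it. -/
theorem prodExp_mul_prodExp_swap (w : α → ℝ) (S : Finset ι) [DecidableEq ι]
    {φ ψ φ' ψ' : (ι → α) → ℝ}
    (h : ∀ ξ ξ' : ι → α, φ ξ * ψ ξ' = φ' (S.piecewise ξ ξ') * ψ' (S.piecewise ξ' ξ)) :
    prodExp w φ * prodExp w ψ = prodExp w φ' * prodExp w ψ' := by
  have key : ∀ f g : (ι → α) → ℝ, prodExp w f * prodExp w g
      = ∑ z : (ι → α) × (ι → α), (∏ i, w (z.1 i) * w (z.2 i)) * (f z.1 * g z.2) := by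
    intro f g
    rw [prodExp_eq, prodExp_eq, Finset.sum_mul_sum, ← Finset.univ_product_univ,
      Finset.sum_product]
    refine Finset.sum_congr rfl fun ξ _ => Finset.sum_congr rfl fun ξ' _ => ?_
    rw [Finset.prod_mul_distrib]; ring
  have hinv : ∀ ξ ξ' : ι → α,
      S.piecewise (S.piecewise ξ ξ') (S.piecewise ξ' ξ) = ξ := by
    intro ξ ξ'; ext i; by_cases hi : i ∈ S <;> simp [hi]
  let e : (ι → α) × (ι → α) ≃ (ι → α) × (ι → α) :=
    { toFun := fun z => (S.piecewise z.1 z.2, S.piecewise z.2 z.1)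
      invFun := fun z => (S.piecewise z.1 z.2, S.piecewise z.2 z.1)
      left_inv := fun z => by simp only [hinv]
      right_inv := fun z => by simp only [hinv] }
  rw [key, key]
  refine Fintype.sum_equiv e _ _ fun z => ?_
  simp only [e, Equiv.coe_fn_mk]
  rw [h]
  congr 1
  refine Finset.prod_congr rfl fun i _ => ?_
  by_cases hi : i ∈ S <;> simp [hi, mul_comm]

/-- Take two independent samples, one for each factor, and glue them along S: each factor still sees
its own sample, so the double sum is that of the product against the constant 1. -/
theorem prodExp_mul_of_dependsOn {w : α → ℝ} (hw : ∑ m, w m = 1) {φ ψ : (ι → α) → ℝ} {S T : Set ι}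
    (hφ : DependsOn φ S) (hψ : DependsOn ψ T) (hST : Disjoint S T) :
    prodExp w (fun ξ => φ ξ * ψ ξ) = prodExp w φ * prodExp w ψ := by
  classical
  have h := prodExp_mul_prodExp_swap (ι := ι) w (Set.toFinset S) (φ := φ) (ψ := ψ)
    (φ' := fun ξ => φ ξ * ψ ξ) (ψ' := fun _ => 1) ?_
  · rw [h, prodExp_one hw, mul_one]
  · intro ξ ξ'
    rw [mul_one]
    congr 1
    · exact hφ fun i hi => by simp [hi]
    · refine hψ fun i hi => ?_
      have : i ∉ S := fun h => Set.disjoint_left.1 hST h hi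
      simp [this]

theorem prodExp_apply {w : α → ℝ} (hw : ∑ m, w m = 1) (i : ι) (f : α → ℝ) :
    prodExp w (fun ξ => f (ξ i)) = ∑ m, w m * f m := by
  classical
  have h := prodExp_prod (ι := ι) w (fun j m => if j = i then f m else 1)
  simp only [Finset.prod_ite_eq', Finset.mem_univ, if_true] at h
  rw [h, Finset.prod_eq_single i]
  · simp
  · intro j _ hj; simp [hj, hw]
  · simp

theorem prodExp_apply₂ {w : α → ℝ} (hw : ∑ m, w m = 1) {i j : ι} (hij : i ≠ j) (f g : α → ℝ) :
    prodExp w (fun ξ => f (ξ i) * g (ξ j)) = (∑ m, w m * f m) * ∑ m, w m * g m := by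
  rw [prodExp_mul_of_dependsOn hw (S := {i}) (T := {j}), prodExp_apply hw, prodExp_apply hw]
  · intro x y h; simp only; rw [h i rfl]
  · intro x y h; simp only; rw [h j rfl]
  · simpa using hij

omit [Fintype ι] [Fintype α] in
theorem dependsOn_finset_prod {κ : Type*} (s : Finset κ) {φ : κ → (ι → α) → ℝ}
    {S : κ → Set ι} (h : ∀ k ∈ s, DependsOn (φ k) (S k)) :
    DependsOn (fun ξ => ∏ k ∈ s, φ k ξ) (⋃ k ∈ s, S k) := by
  intro x y hxy
  refine Finset.prod_congr rfl fun k hk => h k hk fun i hi => hxy i ?_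
  simp only [Set.mem_iUnion]
  exact ⟨k, hk, hi⟩

theorem prodExp_prod_of_dependsOn {κ : Type*} {w : α → ℝ} (hw : ∑ m, w m = 1) (s : Finset κ)
    {φ : κ → (ι → α) → ℝ} {S : κ → Set ι} (h : ∀ k, DependsOn (φ k) (S k))
    (hS : Pairwise fun k l => Disjoint (S k) (S l)) :
    prodExp w (fun ξ => ∏ k ∈ s, φ k ξ) = ∏ k ∈ s, prodExp w (φ k) := by
  classical
  induction s using Finset.induction_on with
  | empty => simpa using prodExp_one hw
  | insert k s hk ih =>
    simp only [Finset.prod_insert hk]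
    rw [prodExp_mul_of_dependsOn hw (h k) (dependsOn_finset_prod s fun l _ => h l), ih]
    simp only [Set.disjoint_iUnion_right]
    intro l hl
    exact hS fun h => hk (h ▸ hl)

/-- The cross terms vanish by independence and centering. This is the variance in the Chebyshev
bound `prodExp_not_typical_le`. -/
theorem prodExp_sq_sum {w : α → ℝ} (hw : ∑ m, w m = 1) {f : α → ℝ} (hf : ∑ m, w m * f m = 0) :
    prodExp w (fun ξ : ι → α => (∑ i, f (ξ i)) ^ 2) = Fintype.card ι * ∑ m, w m * f m ^ 2 := by
  classical
  have h : ∀ ξ : ι → α, (∑ i, f (ξ i)) ^ 2 = ∑ i, ∑ j, f (ξ i) * f (ξ j) := by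
    intro ξ; rw [sq, Finset.sum_mul_sum]
  simp only [h]
  rw [prodExp_sum]
  have h2 : ∀ i : ι, prodExp w (fun ξ => ∑ j, f (ξ i) * f (ξ j)) = ∑ m, w m * f m ^ 2 := by
    intro i
    rw [prodExp_sum, Finset.sum_eq_single i]
    · rw [← prodExp_apply hw i]; simp only [sq]
    · intro j _ hj
      rw [prodExp_apply₂ hw hj.symm, hf, zero_mul]
    · simp
  simp [h2]

end ProductExpectation


/-! ### Observed trees with named children; the label of the root is not observed. -/

/-- Observations on a rooted tree of height `t` whose children are indexed by subsets of `Fin n`: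
every child carries an observed label. -/
@[reducible]
def Tree (n : ℕ) : ℕ → Type
  | 0 => Unit
  | t + 1 => Fin n → Option (Option Label × Tree n t)

instance Tree.instFintype (n : ℕ) : ∀ t, Fintype (Tree n t)
  | 0 => inferInstanceAs (Fintype Unit)
  | t + 1 =>
    have := Tree.instFintype n t
    inferInstanceAs (Fintype (Fin n → Option (Option Label × Tree n t)))

instance Tree.instDecidableEq (n : ℕ) : ∀ t, DecidableEq (Tree n t)
  | 0 => inferInstanceAs (DecidableEq Unit)
  | t + 1 =>
    have := Tree.instDecidableEq n t
    inferInstanceAs (DecidableEq (Fin n → Option (Option Label × Tree n t)))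

/-- The law of the observation of a label that is revealed with probability `q`. -/
def revealWeight (q : ℝ) (y : Label) : Option Label → ℝ
  | none => 1 - q
  | some z => if z = y then q else 0

theorem revealWeight_nonneg {q : ℝ} (h0 : 0 ≤ q) (h1 : q ≤ 1) (y : Label) (o : Option Label) :
    0 ≤ revealWeight q y o := by
  rcases o with _ | z
  · simpa [revealWeight] using h1
  · simp only [revealWeight]; split_ifs <;> simp [h0]

theorem sum_revealWeight (q : ℝ) (y : Label) : ∑ o, revealWeight q y o = 1 := by
  rw [Fintype.sum_option]
  simp [revealWeight]

theorem labelWeight_nonneg {p : ℝ} (h0 : 0 ≤ p) (h1 : p ≤ 1) (y : Label) : 0 ≤ labelWeight p y := by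
  unfold labelWeight; split_ifs <;> linarith

theorem sum_labelWeight (p : ℝ) : ∑ y, labelWeight p y = 1 := by
  simp [labelWeight]

/-! ### Likelihood of a tree observation; heights count from the leaves, so `q 0` concerns the
bottom level. -/

section Likelihood

variable {n : ℕ} (M : Matrix Label Label ℝ) (η p : ℝ) (q : ℕ → ℝ)

/-- The weight of a child slot below a vertex with label `x`, when `L` is the likelihood of the
subtree observation. -/
def slotWeight {β : Type} (L : β → Label → ℝ) (r : ℝ) (x : Label)
    (s : Option (Option Label × β)) : ℝ :=
  s.elim (1 - η) fun z => ∑ y, labelWeight p y * M x y * revealWeight r y z.1 * L z.2 y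

/-- The likelihood of a tree observation given the label of the root: every potential child is
present with label `y` with probability `labelWeight p y * M x y`, and at height `t` labels are
revealed with probability `q t`. -/
def lik : ∀ t, Tree n t → Label → ℝ
  | 0, _, _ => 1
  | t + 1, ω, x => ∏ u, slotWeight M η p (lik t) (q t) x (ω u)

variable {M η p q}

theorem sum_slotWeight {β : Type} [Fintype β] (L : β → Label → ℝ) (r : ℝ) (x : Label)
    (φ : Option (Option Label × β) → ℝ) :
    ∑ s, slotWeight M η p L r x s * φ s = (1 - η) * φ none
      + ∑ y, labelWeight p y * M x y * ∑ o, revealWeight r y o * ∑ b, L b y * φ (some (o, b)) := by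
  rw [Fintype.sum_option]
  congr 1
  simp only [slotWeight, Option.elim]
  rw [Fintype.sum_prod_type]
  simp only [Finset.sum_mul, Finset.mul_sum]
  rw [Finset.sum_comm' (t' := Finset.univ) (s' := fun _ => Finset.univ) (by simp)]
  simp only [Finset.sum_comm (s := (Finset.univ : Finset (Option Label))) (t := (Finset.univ : Finset Label))]
  rw [Finset.sum_comm]
  refine Finset.sum_congr rfl fun y _ => ?_
  rw [Finset.sum_comm]
  refine Finset.sum_congr rfl fun o _ => Finset.sum_congr rfl fun b _ => ?_
  ring

theorem sum_lik_succ {t : ℕ} (x : Label) (φ : Tree n (t + 1) → ℝ) :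
    ∑ ω, lik M η p q (t + 1) ω x * φ ω
      = prodExp (ι := Fin n) (slotWeight M η p (lik (n := n) M η p q t) (q t) x) φ := by
  rw [prodExp_eq]; rfl

/-- By `hM` a slot is occupied with probability η whatever the label above it, so its weights sum to
one, and the slots are independent. -/
theorem sum_lik (hM : ∀ x, ∑ y, labelWeight p y * M x y = η) (t : ℕ) (x : Label) :
    ∑ ω : Tree n t, lik M η p q t ω x = 1 := by
  induction t generalizing x with
  | zero => simp [lik]
  | succ t ih =>
    have h := sum_lik_succ (M := M) (η := η) (p := p) (q := q) (n := n) (t := t) x (fun _ => 1)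
    simp only [mul_one] at h
    rw [h]
    refine prodExp_one ?_
    have := sum_slotWeight (M := M) (η := η) (p := p) (lik (n := n) M η p q t) (q t) x (fun _ => 1)
    simp only [mul_one, ih, sum_revealWeight, hM] at this
    rw [this]; ring

theorem sum_slotWeight_lik (hM : ∀ x, ∑ y, labelWeight p y * M x y = η) (t : ℕ) (x : Label) :
    ∑ s, slotWeight M η p (lik (n := n) M η p q t) (q t) x s = 1 := by
  have := sum_slotWeight (M := M) (η := η) (p := p) (lik (n := n) M η p q t) (q t) x (fun _ => 1)
  simp only [mul_one, sum_lik hM, sum_revealWeight, hM] at this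
  rw [this]; ring

theorem slotWeight_nonneg {β : Type} {L : β → Label → ℝ} {r : ℝ} (hp : 0 ≤ p) (hp' : p ≤ 1)
    (hM : ∀ x y, 0 ≤ M x y) (hη : η ≤ 1) (hr : 0 ≤ r) (hr' : r ≤ 1) (hL : ∀ b y, 0 ≤ L b y)
    (x : Label) (s : Option (Option Label × β)) : 0 ≤ slotWeight M η p L r x s := by
  rcases s with _ | z
  · simpa [slotWeight] using hη
  · simp only [slotWeight, Option.elim]
    exact Finset.sum_nonneg fun y _ => mul_nonneg (mul_nonneg (mul_nonneg
      (labelWeight_nonneg hp hp' y) (hM x y)) (revealWeight_nonneg hr hr' _ _)) (hL _ _)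

theorem lik_nonneg (hp : 0 ≤ p) (hp' : p ≤ 1) (hM : ∀ x y, 0 ≤ M x y) (hη : η ≤ 1)
    (hq : ∀ t, 0 ≤ q t) (hq' : ∀ t, q t ≤ 1) (t : ℕ) (ω : Tree n t) (x : Label) :
    0 ≤ lik M η p q t ω x := by
  induction t generalizing x with
  | zero => exact zero_le_one
  | succ t ih =>
    exact Finset.prod_nonneg fun u _ =>
      slotWeight_nonneg hp hp' hM hη (hq t) (hq' t) (fun b y => ih b y) x _

end Likelihood

/-! ### Names, edges and vertices of positive height of a tree. -/

section Shape

variable {n : ℕ}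

/-- The vertices of a tree, other than its root. -/
def names : ∀ t, Tree n t → Finset (Fin n)
  | 0, _ => ∅
  | t + 1, ω => Finset.univ.biUnion fun u => (ω u).elim ∅ fun z => insert u (names t z.2)

/-- The vertices of a tree of positive height. -/
def interior : ∀ t, Tree n t → Fin n → Finset (Fin n)
  | 0, _, _ => ∅
  | t + 1, ω, r => insert r (Finset.univ.biUnion fun u => (ω u).elim ∅ fun z => interior t z.2 u)

/-- The edges of a tree. -/
def treeEdges : ∀ t, Tree n t → Fin n → Finset (Sym2 (Fin n))
  | 0, _, _ => ∅
  | t + 1, ω, r =>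
    Finset.univ.biUnion fun u => (ω u).elim ∅ fun z => insert s(r, u) (treeEdges t z.2 u)

/-- The number of absent children of the vertices of positive height. -/
def absences : ∀ t, Tree n t → ℕ
  | 0, _ => 0
  | t + 1, ω => ∑ u, (ω u).elim 1 fun z => absences t z.2

/-- The vertices of the tree are distinct. -/
def Inj : ∀ t, Tree n t → Fin n → Prop
  | 0, _, _ => True
  | t + 1, ω, r =>
    (∀ u z, ω u = some z → u ≠ r ∧ u ∉ names t z.2 ∧ r ∉ names t z.2 ∧ Inj t z.2 u) ∧
    ∀ u z u' z', ω u = some z → ω u' = some z' → u ≠ u' →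
      Disjoint (insert u (names t z.2)) (insert u' (names t z'.2))

/-- The labels observed on a tree are those given by `obs`. -/
def Matches (obs : ℕ → Fin n → Option Label) : ∀ t, Tree n t → Prop
  | 0, _ => True
  | t + 1, ω => ∀ u z, ω u = some z → obs t u = z.1 ∧ Matches obs t z.2

theorem mem_names_succ {t : ℕ} {ω : Tree n (t + 1)} {v : Fin n} :
    v ∈ names (t + 1) ω ↔ ∃ u z, ω u = some z ∧ v ∈ insert u (names t z.2) := by
  simp only [names, Finset.mem_biUnion, Finset.mem_univ, true_and]
  refine exists_congr fun u => ?_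
  rcases ω u with _ | z <;> simp

theorem mem_interior_succ {t : ℕ} {ω : Tree n (t + 1)} {r v : Fin n} :
    v ∈ interior (t + 1) ω r ↔ v = r ∨ ∃ u z, ω u = some z ∧ v ∈ interior t z.2 u := by
  simp only [interior, Finset.mem_insert, Finset.mem_biUnion, Finset.mem_univ, true_and]
  refine or_congr_right (exists_congr fun u => ?_)
  rcases ω u with _ | z <;> simp

theorem mem_treeEdges_succ {t : ℕ} {ω : Tree n (t + 1)} {r : Fin n} {e : Sym2 (Fin n)} :
    e ∈ treeEdges (t + 1) ω r ↔
      ∃ u z, ω u = some z ∧ (e = s(r, u) ∨ e ∈ treeEdges t z.2 u) := by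
  simp only [treeEdges, Finset.mem_biUnion, Finset.mem_univ, true_and]
  refine exists_congr fun u => ?_
  rcases ω u with _ | z <;> simp

theorem interior_subset {t : ℕ} (ω : Tree n t) (r : Fin n) :
    interior t ω r ⊆ insert r (names t ω) := by
  induction t generalizing r with
  | zero => simp [interior]
  | succ t ih =>
    intro v hv
    rcases mem_interior_succ.1 hv with rfl | ⟨u, z, hu, hv⟩
    · simp
    · exact Finset.mem_insert_of_mem (mem_names_succ.2 ⟨u, z, hu, ih _ _ hv⟩)

theorem mem_of_mem_treeEdges {t : ℕ} {ω : Tree n t} {r : Fin n} {e : Sym2 (Fin n)}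
    (he : e ∈ treeEdges t ω r) {v : Fin n} (hv : v ∈ e) : v ∈ insert r (names t ω) := by
  induction t generalizing r with
  | zero => simp [treeEdges] at he
  | succ t ih =>
    obtain ⟨u, z, hu, h⟩ := mem_treeEdges_succ.1 he
    rcases h with rfl | h
    · rcases Sym2.mem_iff.1 hv with rfl | rfl
      · simp
      · exact Finset.mem_insert_of_mem (mem_names_succ.2 ⟨v, z, hu, by simp⟩)
    · exact Finset.mem_insert_of_mem (mem_names_succ.2 ⟨u, z, hu, ih h⟩)

theorem exists_mem_interior {t : ℕ} {ω : Tree n t} {r : Fin n} {e : Sym2 (Fin n)}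
    (he : e ∈ treeEdges t ω r) : ∃ v ∈ e, v ∈ interior t ω r := by
  induction t generalizing r with
  | zero => simp [treeEdges] at he
  | succ t ih =>
    obtain ⟨u, z, hu, h⟩ := mem_treeEdges_succ.1 he
    rcases h with rfl | h
    · exact ⟨r, by simp, mem_interior_succ.2 (Or.inl rfl)⟩
    · obtain ⟨v, hv, hv'⟩ := ih h
      exact ⟨v, hv, mem_interior_succ.2 (Or.inr ⟨u, z, hu, hv'⟩)⟩

theorem not_isDiag_of_mem_treeEdges {t : ℕ} {ω : Tree n t} {r : Fin n} (hω : Inj t ω r)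
    {e : Sym2 (Fin n)} (he : e ∈ treeEdges t ω r) : ¬ e.IsDiag := by
  induction t generalizing r with
  | zero => simp [treeEdges] at he
  | succ t ih =>
    obtain ⟨u, z, hu, h⟩ := mem_treeEdges_succ.1 he
    obtain ⟨h1, -, -, h4⟩ := hω.1 u z hu
    rcases h with rfl | h
    · simpa using h1.symm
    · exact ih h4 h

theorem Inj.root_notMem {t : ℕ} {ω : Tree n t} {r : Fin n} (hω : Inj t ω r) : r ∉ names t ω := by
  cases t with
  | zero => simp [names]
  | succ t =>
    intro h
    obtain ⟨u, z, hu, h⟩ := mem_names_succ.1 h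
    obtain ⟨h1, -, h3, -⟩ := hω.1 u z hu
    rcases Finset.mem_insert.1 h with rfl | h
    · exact h1 rfl
    · exact h3 h

/-- Each absent or present child of the vertices of positive height is counted once. -/
theorem absences_add_card_names {t : ℕ} {ω : Tree n t} {r : Fin n} (hω : Inj t ω r) :
    absences t ω + (names t ω).card = n * (interior t ω r).card := by
  induction t generalizing r with
  | zero => simp [absences, names, interior]
  | succ t ih =>
    have hr : r ∉ Finset.univ.biUnion fun u => (ω u).elim ∅ fun z => interior t z.2 u := by
      simp only [Finset.mem_biUnion, Finset.mem_univ, true_and, not_exists]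
      intro u h
      rcases hu : ω u with _ | z
      · simp [hu] at h
      · simp only [hu, Option.elim] at h
        obtain ⟨h1, -, h3, -⟩ := hω.1 u z hu
        rcases Finset.mem_insert.1 (interior_subset _ _ h) with rfl | h
        · exact h1 rfl
        · exact h3 h
    have h1 : (names (t + 1) ω).card = ∑ u, (ω u).elim 0 fun z => ((names t z.2).card + 1) := by
      rw [names, Finset.card_biUnion]
      · refine Finset.sum_congr rfl fun u _ => ?_
        rcases hu : ω u with _ | z
        · simp
        · simp only [Option.elim]
          rw [Finset.card_insert_of_notMem (hω.1 u z hu).2.1]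
      · intro u _ u' _ huu
        simp only [Function.onFun]
        rcases hu : ω u with _ | z
        · simp
        rcases hu' : ω u' with _ | z'
        · simp
        simpa only [Option.elim] using hω.2 u z u' z' hu hu' huu
    have h2 : (interior (t + 1) ω r).card
        = (∑ u, (ω u).elim 0 fun z => (interior t z.2 u).card) + 1 := by
      rw [interior, Finset.card_insert_of_notMem hr, Finset.card_biUnion]
      · congr 1
        refine Finset.sum_congr rfl fun u _ => ?_
        rcases hu : ω u with _ | z <;> simp
      · intro u _ u' _ huu
        simp only [Function.onFun]
        rcases hu : ω u with _ | z
        · simp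
        rcases hu' : ω u' with _ | z'
        · simp
        simp only [Option.elim]
        exact (hω.2 u z u' z' hu hu' huu).mono (interior_subset _ _) (interior_subset _ _)
    rw [h1, h2, absences, mul_add, mul_one, Finset.mul_sum, ← Finset.sum_add_distrib]
    -- Every slot of the root, absent or occupied, counts for one beyond its subtree; summed over
    -- the n slots this accounts for the root as a new vertex of positive height.
    have h3 : ∀ u, ((ω u).elim 1 fun z => absences t z.2)
        + ((ω u).elim 0 fun z => ((names t z.2).card + 1))
        = (n * (ω u).elim 0 fun z => (interior t z.2 u).card) + 1 := by
      intro u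
      rcases hu : ω u with _ | z
      · simp
      · simp only [Option.elim]
        rw [← ih (hω.1 u z hu).2.2.2]; ring
    simp only [h3, Finset.sum_add_distrib]
    simp

end Shape


/-! ### Marks: labels with their revelation bits. -/

/-- Edge probabilities `M` between vertices with independent labels such that the probability `η`
of an edge at a vertex does not depend on the label of this vertex. -/
structure Admissible (M : Matrix Label Label ℝ) (η p : ℝ) : Prop where
  p_nonneg : 0 ≤ p
  p_le_one : p ≤ 1
  nonneg : ∀ x y, 0 ≤ M x y
  symm : ∀ x y, M x y = M y x
  sum_eq : ∀ x, ∑ y, labelWeight p y * M x y = η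
  le_one : η ≤ 1

theorem Admissible.density_nonneg {M : Matrix Label Label ℝ} {η p : ℝ} (h : Admissible M η p) :
    0 ≤ η := by
  rw [← h.sum_eq 0]
  exact Finset.sum_nonneg fun y _ =>
    mul_nonneg (labelWeight_nonneg h.p_nonneg h.p_le_one y) (h.nonneg _ _)

/-- A label together with the bit that tells whether it is revealed. -/
abbrev Mark : Type := Label × Bool

/-- The law of the bit that tells whether a label is revealed. -/
def boolWeight (q : ℝ) (b : Bool) : ℝ := if b then q else 1 - q

/-- The law of a mark. -/
def markWeight (p q : ℝ) (m : Mark) : ℝ := labelWeight p m.1 * boolWeight q m.2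

theorem sum_boolWeight (q : ℝ) : ∑ b, boolWeight q b = 1 := by
  simp [boolWeight]

theorem sum_markWeight_mul (p q : ℝ) (f : Mark → ℝ) :
    ∑ m, markWeight p q m * f m = ∑ y, labelWeight p y * ∑ b, boolWeight q b * f (y, b) := by
  rw [Fintype.sum_prod_type]
  simp only [markWeight, Finset.mul_sum, mul_assoc]

theorem sum_markWeight (p q : ℝ) : ∑ m, markWeight p q m = 1 := by
  have := sum_markWeight_mul p q (fun _ => 1)
  simpa only [mul_one, sum_boolWeight, sum_labelWeight] using this

theorem markWeight_nonneg {p q : ℝ} (hp : 0 ≤ p) (hp' : p ≤ 1) (hq : 0 ≤ q) (hq' : q ≤ 1)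
    (m : Mark) : 0 ≤ markWeight p q m := by
  refine mul_nonneg (labelWeight_nonneg hp hp' _) ?_
  unfold boolWeight; split_ifs <;> linarith

/-- The observations `σ t` at height `t` have the law of a label revealed with probability `q t`. -/
def ObservesWith (q₀ : ℝ) (σ : ℕ → Mark → Option Label) (q : ℕ → ℝ) : Prop :=
  ∀ t y o, ∑ b, boolWeight q₀ b * (if σ t (y, b) = o then 1 else 0) = revealWeight (q t) y o

/-! ### Weight of a named tree when the marks of the vertices are given. -/

section TreeWeight

variable {n : ℕ} (M : Matrix Label Label ℝ) (η : ℝ) (σ : ℕ → Mark → Option Label)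

/-- The conditional weight of a tree observation when the vertices `u` have marks `ξ u`. -/
def treeWeight : ∀ t, Tree n t → (Fin n → Mark) → Fin n → ℝ
  | 0, _, _, _ => 1
  | t + 1, ω, ξ, r => ∏ u, (ω u).elim (1 - η) fun z =>
      M (ξ r).1 (ξ u).1 * (if σ t (ξ u) = z.1 then 1 else 0) * treeWeight t z.2 ξ u

variable {M η σ}

theorem treeWeight_nonneg (hM : ∀ x y, 0 ≤ M x y) (hη : η ≤ 1) {t : ℕ} (ω : Tree n t)
    (ξ : Fin n → Mark) (r : Fin n) : 0 ≤ treeWeight M η σ t ω ξ r := by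
  induction t generalizing r with
  | zero => exact zero_le_one
  | succ t ih =>
    refine Finset.prod_nonneg fun u _ => ?_
    rcases ω u with _ | z
    · simpa using hη
    · simp only [Option.elim]
      refine mul_nonneg (mul_nonneg (hM _ _) ?_) (ih _ _)
      split_ifs <;> norm_num

theorem treeWeight_dependsOn {t : ℕ} (ω : Tree n t) (r : Fin n) :
    DependsOn (fun ξ => treeWeight M η σ t ω ξ r) (insert r (names t ω) : Finset (Fin n)) := by
  induction t generalizing r with
  | zero => intro _ _ _; rfl
  | succ t ih =>
    intro ξ ξ' h
    refine Finset.prod_congr rfl fun u _ => ?_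
    rcases hu : ω u with _ | z
    · rfl
    · simp only [Option.elim]
      have hsub : ∀ v ∈ insert u (names t z.2), ξ v = ξ' v := fun v hv =>
        h v (Finset.mem_coe.2 (Finset.mem_insert_of_mem (mem_names_succ.2 ⟨u, z, hu, hv⟩)))
      have h2 := ih z.2 u (fun v hv => hsub v hv)
      simp only at h2
      rw [h2, h r (by simp), hsub u (by simp)]

/-- The mean of the weight of a tree with distinct vertices is its likelihood. -/
theorem prodExp_treeWeight_of_mark {p q₀ : ℝ} {q : ℕ → ℝ} (hσ : ObservesWith q₀ σ q)
    {t : ℕ} {ω : Tree n t} {r : Fin n} (hω : Inj t ω r) (m : Mark) :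
    prodExp (markWeight p q₀) (fun ξ => (if ξ r = m then 1 else 0) * treeWeight M η σ t ω ξ r)
      = markWeight p q₀ m * lik M η p q t ω m.1 := by
  have hw := sum_markWeight p q₀
  induction t generalizing r m with
  | zero =>
    simp only [treeWeight, lik, mul_one]
    rw [prodExp_apply hw r (fun m' => if m' = m then (1 : ℝ) else 0)]
    simp
  | succ t ih =>
    -- With the mark of r frozen to m, the factors of the slots involve the marks of disjoint
    -- branches that avoid r, hence are independent. This is where distinct names are needed.
    let G : Fin n → (Fin n → Mark) → ℝ := fun u ξ => (ω u).elim (1 - η) fun z =>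
      M m.1 (ξ u).1 * (if σ t (ξ u) = z.1 then 1 else 0) * treeWeight M η σ t z.2 ξ u
    let S : Fin n → Set (Fin n) := fun u =>
      ((ω u).elim ∅ fun z => insert u (names t z.2) : Finset (Fin n))
    have hG : ∀ u, DependsOn (G u) (S u) := by
      intro u ξ ξ' h
      simp only [G]
      rcases hu : ω u with _ | z
      · rfl
      · simp only [S, hu, Option.elim] at h ⊢
        have h2 := treeWeight_dependsOn (M := M) (η := η) (σ := σ) z.2 u h
        simp only at h2
        rw [h2, h u (by simp)]
    have hS : Pairwise fun u v => Disjoint (S u) (S v) := by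
      intro u v huv
      simp only [S]
      rcases hu : ω u with _ | z
      · simp
      rcases hv : ω v with _ | z'
      · simp
      simp only [Option.elim, Finset.disjoint_coe]
      exact hω.2 u z v z' hu hv huv
    have h1 : (fun ξ : Fin n → Mark =>
        (if ξ r = m then (1 : ℝ) else 0) * treeWeight M η σ (t + 1) ω ξ r)
        = fun ξ => (if ξ r = m then 1 else 0) * ∏ u ∈ Finset.univ, G u ξ := by
      ext ξ
      by_cases h : ξ r = m
      · simp only [h, treeWeight, G]
      · simp [h]
    have hr : ∀ u, r ∉ S u := by
      intro u
      simp only [S]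
      rcases hu : ω u with _ | z
      · simp
      · simp only [Option.elim, Finset.mem_coe, Finset.mem_insert, not_or]
        exact ⟨(hω.1 u z hu).1.symm, (hω.1 u z hu).2.2.1⟩
    rw [h1, prodExp_mul_of_dependsOn hw (S := {r}) (T := ⋃ u ∈ (Finset.univ : Finset (Fin n)), S u)
      (fun x y h => by rw [h r rfl]) (dependsOn_finset_prod _ fun u _ => hG u)
      (by simpa using hr), prodExp_apply hw r (fun m' => if m' = m then (1 : ℝ) else 0),
      prodExp_prod_of_dependsOn hw _ hG hS]
    congr 1
    · simp
    · refine Finset.prod_congr rfl fun u _ => ?_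
      simp only [G]
      rcases hu : ω u with _ | z
      · simpa [slotWeight] using prodExp_const hw _
      · simp only [Option.elim, slotWeight]
        -- Split according to the mark of u, the form that the induction hypothesis handles.
        have h2 : ∀ ξ : Fin n → Mark,
            M m.1 (ξ u).1 * (if σ t (ξ u) = z.1 then 1 else 0) * treeWeight M η σ t z.2 ξ u
            = ∑ m', M m.1 m'.1 * (if σ t m' = z.1 then 1 else 0) *
                ((if ξ u = m' then 1 else 0) * treeWeight M η σ t z.2 ξ u) := by
          intro ξ
          rw [Finset.sum_eq_single (ξ u)]
          · simp
          · intro m' _ hm'; simp [hm'.symm]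
          · simp
        simp only [h2]
        rw [prodExp_sum]
        simp only [prodExp_mul_left, ih (hω.1 u z hu).2.2.2]
        have h3 := sum_markWeight_mul p q₀ (fun m' => M m.1 m'.1 * (if σ t m' = z.1 then 1 else 0)
          * lik M η p q t z.2 m'.1)
        calc _ = ∑ m', markWeight p q₀ m' * (M m.1 m'.1 * (if σ t m' = z.1 then 1 else 0)
              * lik M η p q t z.2 m'.1) := Finset.sum_congr rfl fun m' _ => by ring
          _ = _ := by
            rw [h3]
            refine Finset.sum_congr rfl fun y _ => ?_
            rw [← hσ t y z.1]
            simp only [Finset.mul_sum, Finset.sum_mul]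
            exact Finset.sum_congr rfl fun b _ => by ring

theorem prodExp_mul_treeWeight {p q₀ : ℝ} {q : ℕ → ℝ} (hσ : ObservesWith q₀ σ q)
    {t : ℕ} {ω : Tree n t} {r : Fin n} (hω : Inj t ω r) (f : Label → ℝ) :
    prodExp (markWeight p q₀) (fun ξ => f (ξ r).1 * treeWeight M η σ t ω ξ r)
      = ∑ y, labelWeight p y * f y * lik M η p q t ω y := by
  have h : ∀ ξ : Fin n → Mark, f (ξ r).1 * treeWeight M η σ t ω ξ r
      = ∑ m, f m.1 * ((if ξ r = m then 1 else 0) * treeWeight M η σ t ω ξ r) := by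
    intro ξ
    rw [Finset.sum_eq_single (ξ r)]
    · simp
    · intro m' _ hm'; simp [hm'.symm]
    · simp
  simp only [h]
  rw [prodExp_sum]
  simp only [prodExp_mul_left, prodExp_treeWeight_of_mark hσ hω]
  have h3 := sum_markWeight_mul p q₀ (fun m => f m.1 * lik M η p q t ω m.1)
  simp only [← Finset.sum_mul, sum_boolWeight, one_mul] at h3
  calc _ = ∑ m, markWeight p q₀ m * (f m.1 * lik M η p q t ω m.1) :=
        Finset.sum_congr rfl fun m' _ => by ring
    _ = _ := by
      rw [h3]
      exact Finset.sum_congr rfl fun y _ => by ring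

/-- An iterated exponential. -/
def growth (K : ℝ) : ℕ → ℝ
  | 0 => 1
  | t + 1 => Real.exp (K * growth K t)

theorem growth_nonneg (K : ℝ) (t : ℕ) : 0 ≤ growth K t := by
  cases t
  · exact zero_le_one
  · exact (Real.exp_pos _).le

/-- A crude bound valid for all marks: the sum over the contents of one slot is at most 1 + D ·
growth ≤ exp(D · growth). It serves for atypical marks, where the total weight may exceed one; with
D of order 1/n it is uniform in n. -/
theorem sum_treeWeight_le {D K : ℝ} (hM : ∀ x y, 0 ≤ M x y) (hMD : ∀ x y, M x y ≤ D)
    (hη : 0 ≤ η) (hη1 : η ≤ 1) (hK : n * D ≤ K) (t : ℕ) (ξ : Fin n → Mark) (r : Fin n) :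
    ∑ ω, treeWeight M η σ t ω ξ r ≤ growth K t := by
  induction t generalizing r with
  | zero => simp [treeWeight, growth]
  | succ t ih =>
    have hD : 0 ≤ D := (hM 0 0).trans (hMD 0 0)
    have hg := growth_nonneg K t
    let f : Fin n → Option (Option Label × Tree n t) → ℝ := fun u s => s.elim (1 - η) fun z =>
      M (ξ r).1 (ξ u).1 * (if σ t (ξ u) = z.1 then 1 else 0) * treeWeight M η σ t z.2 ξ u
    have h1 : ∑ ω, treeWeight M η σ (t + 1) ω ξ r = ∏ u, ∑ s, f u s := by
      rw [Finset.prod_univ_sum, Fintype.piFinset_univ]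
      rfl
    have h2 : ∀ u, ∑ s, f u s
        = (1 - η) + M (ξ r).1 (ξ u).1 * ∑ b, treeWeight M η σ t b ξ u := by
      intro u
      rw [Fintype.sum_option]
      simp only [f, Option.elim]
      rw [Fintype.sum_prod_type, Finset.sum_eq_single (σ t (ξ u))]
      · simp [Finset.mul_sum]
      · intro o _ ho; simp [ho.symm]
      · simp
    have hs : ∀ u, 0 ≤ ∑ b, treeWeight M η σ t b ξ u :=
      fun u => Finset.sum_nonneg fun b _ => treeWeight_nonneg hM hη1 _ _ _
    rw [h1]
    calc ∏ u, ∑ s, f u s ≤ ∏ _u : Fin n, Real.exp (D * growth K t) := by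
          refine Finset.prod_le_prod (fun u _ => ?_) fun u _ => ?_
          · rw [h2]
            exact add_nonneg (by linarith) (mul_nonneg (hM _ _) (hs u))
          · rw [h2]
            have : M (ξ r).1 (ξ u).1 * ∑ b, treeWeight M η σ t b ξ u ≤ D * growth K t :=
              mul_le_mul (hMD _ _) (ih u) (hs u) hD
            linarith [Real.add_one_le_exp (D * growth K t)]
      _ = Real.exp (n * D * growth K t) := by
          rw [Finset.prod_const, Finset.card_univ, Fintype.card_fin, ← Real.exp_nat_mul, mul_assoc]
      _ ≤ _ := by
          rw [growth]
          exact Real.exp_le_exp.2 (mul_le_mul_of_nonneg_right hK hg)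

/-- The weight of a tree with distinct vertices, in terms of its edges. -/
theorem treeWeight_eq (hM : ∀ x y, M x y = M y x) {t : ℕ} {ω : Tree n t} {r : Fin n}
    (hω : Inj t ω r) (ξ : Fin n → Mark) [Decidable (Matches (fun t u => σ t (ξ u)) t ω)] :
    treeWeight M η σ t ω ξ r = (if Matches (fun t u => σ t (ξ u)) t ω then 1 else 0) *
      ((1 - η) ^ absences t ω *
        ∏ e ∈ treeEdges t ω r, Sym2.lift ⟨fun a b => M (ξ a).1 (ξ b).1, fun _ _ => hM _ _⟩ e) := by
  classical
  induction t generalizing r with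
  | zero => simp [treeWeight, Matches, absences, treeEdges]
  | succ t ih =>
    set g : Sym2 (Fin n) → ℝ := Sym2.lift ⟨fun a b => M (ξ a).1 (ξ b).1, fun _ _ => hM _ _⟩ with hg
    have hE : ∏ e ∈ treeEdges (t + 1) ω r, g e
        = ∏ u, (ω u).elim 1 fun z => M (ξ r).1 (ξ u).1 * ∏ e ∈ treeEdges t z.2 u, g e := by
      rw [treeEdges, Finset.prod_biUnion]
      · refine Finset.prod_congr rfl fun u _ => ?_
        rcases hu : ω u with _ | z
        · simp
        · simp only [Option.elim]
          rw [Finset.prod_insert]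
          · simp [hg]
          · intro h
            have := mem_of_mem_treeEdges h (v := r) (by simp)
            rcases Finset.mem_insert.1 this with rfl | h'
            · exact (hω.1 r z hu).1 rfl
            · exact (hω.1 u z hu).2.2.1 h'
      · intro u _ v _ huv
        simp only [Function.onFun]
        rcases hu : ω u with _ | z
        · simp
        rcases hv : ω v with _ | z'
        · simp
        simp only [Option.elim]
        have hd := hω.2 u z v z' hu hv huv
        -- An edge of the branch at w has an endpoint in that branch and, apart from r, none outside
        -- it; so two branches share no edge and the product splits.
        have hmem : ∀ w y, ω w = some y → ∀ e ∈ insert s(r, w) (treeEdges t y.2 w),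
            ∃ a ∈ e, a ∈ insert w (names t y.2) := by
          intro w y _ e he
          rcases Finset.mem_insert.1 he with rfl | he
          · exact ⟨w, by simp, by simp⟩
          · obtain ⟨a, ha, _⟩ := exists_mem_interior he
            exact ⟨a, ha, mem_of_mem_treeEdges he ha⟩
        have hmem' : ∀ w y, ω w = some y → ∀ e ∈ insert s(r, w) (treeEdges t y.2 w),
            ∀ a ∈ e, a = r ∨ a ∈ insert w (names t y.2) := by
          intro w y _ e he a ha
          rcases Finset.mem_insert.1 he with rfl | he
          · rcases Sym2.mem_iff.1 ha with rfl | rfl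
            · exact Or.inl rfl
            · exact Or.inr (by simp)
          · exact Or.inr (mem_of_mem_treeEdges he ha)
        rw [Finset.disjoint_left]
        intro e he he'
        obtain ⟨a, ha, ha'⟩ := hmem u z hu e he
        rcases hmem' v z' hv e he' a ha with rfl | h
        · rcases Finset.mem_insert.1 ha' with rfl | h'
          · exact (hω.1 _ z hu).1 rfl
          · exact (hω.1 u z hu).2.2.1 h'
        · exact Finset.disjoint_left.1 hd ha' h
    have hA : (1 - η) ^ absences (t + 1) ω
        = ∏ u, (ω u).elim (1 - η) fun z => (1 - η) ^ absences t z.2 := by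
      rw [absences, ← Finset.prod_pow_eq_pow_sum]
      refine Finset.prod_congr rfl fun u _ => ?_
      rcases ω u with _ | z <;> simp
    have hMt : (if Matches (fun t u => σ t (ξ u)) (t + 1) ω then (1 : ℝ) else 0)
        = ∏ u, (ω u).elim 1 fun z => (if σ t (ξ u) = z.1 then 1 else 0) *
            (if Matches (fun t u => σ t (ξ u)) t z.2 then 1 else 0) := by
      by_cases h : Matches (fun t u => σ t (ξ u)) (t + 1) ω
      · rw [if_pos h, Finset.prod_eq_one]
        intro u _
        rcases hu : ω u with _ | z
        · rfl
        · have := h u z hu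
          simp [this.1, this.2]
      · rw [if_neg h]
        simp only [Matches, not_forall] at h
        obtain ⟨u, z, hu, h⟩ := h
        symm
        apply Finset.prod_eq_zero (Finset.mem_univ u)
        simp only [hu, Option.elim, mul_eq_zero, ite_eq_right_iff, one_ne_zero, imp_false]
        tauto
    rw [hE, hA, hMt, treeWeight, ← Finset.prod_mul_distrib, ← Finset.prod_mul_distrib]
    refine Finset.prod_congr rfl fun u _ => ?_
    rcases hu : ω u with _ | z
    · simp
    · simp only [Option.elim]
      rw [ih (hω.1 u z hu).2.2.2]
      ring

end TreeWeight


/-! ### The named tree is rarely large and its names rarely collide. -/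

section TreeProbabilities

variable {n : ℕ} {M : Matrix Label Label ℝ} {η p : ℝ} {q : ℕ → ℝ}

/-- A slot is occupied with probability η, and given the label of the child its subtree contributes
at most c on average. All union bounds below rest on this. -/
theorem sum_slotWeight_elim_le (h : Admissible M η p) (t : ℕ) (x : Label) {ψ : Tree n t → ℝ} {c : ℝ}
    (hψ : ∀ y, ∑ b, lik M η p q t b y * ψ b ≤ c) :
    ∑ s, slotWeight M η p (lik (n := n) M η p q t) (q t) x s * (s.elim 0 fun z => ψ z.2)
      ≤ η * c := by
  rw [sum_slotWeight]
  simp only [Option.elim, mul_zero, zero_add, ← Finset.sum_mul, sum_revealWeight, one_mul]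
  have hc : η * c = ∑ y, labelWeight p y * M x y * c := by rw [← Finset.sum_mul, h.sum_eq]
  rw [hc]
  exact Finset.sum_le_sum fun y _ => mul_le_mul_of_nonneg_left (hψ y)
    (mul_nonneg (labelWeight_nonneg h.p_nonneg h.p_le_one _) (h.nonneg _ _))

/-- A bound for the mean size of the tree. -/
def sizeBound (d : ℝ) : ℕ → ℝ
  | 0 => 0
  | t + 1 => d + d * sizeBound d t

/-- A bound for `n` times the probability that two vertices of the tree coincide. -/
def collisionBound (d : ℝ) : ℕ → ℝ
  | 0 => 0
  | t + 1 => d + d * (2 * sizeBound d t + collisionBound d t) + d ^ 2 * (1 + sizeBound d t) ^ 2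

theorem sizeBound_nonneg {d : ℝ} (hd : 0 ≤ d) (t : ℕ) : 0 ≤ sizeBound d t := by
  induction t with
  | zero => exact le_rfl
  | succ t ih => exact add_nonneg hd (mul_nonneg hd ih)

theorem collisionBound_nonneg {d : ℝ} (hd : 0 ≤ d) (t : ℕ) : 0 ≤ collisionBound d t := by
  induction t with
  | zero => exact le_rfl
  | succ t ih =>
    have := sizeBound_nonneg hd t
    unfold collisionBound
    positivity

variable {d : ℝ}

/-- Union bound over the slots: v is the name of a single slot, which contributes η, and the n
possible subtrees contain v with probability at most η · sizeBound / n each. -/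
theorem sum_lik_mem_names_le (h : Admissible M η p) (hd : n * η = d)
    (hq : ∀ t, 0 ≤ q t) (hq' : ∀ t, q t ≤ 1) (t : ℕ) (x : Label) (v : Fin n) :
    ∑ ω : Tree n t, lik M η p q t ω x * (if v ∈ names t ω then 1 else 0) ≤ sizeBound d t / n := by
  have hn : (0 : ℝ) < n := by exact_mod_cast v.pos
  have hd0 : 0 ≤ d := hd ▸ mul_nonneg hn.le h.density_nonneg
  induction t generalizing x v with
  | zero => simp [names, sizeBound]
  | succ t ih =>
    have hL : ∀ b y, 0 ≤ lik (n := n) M η p q t b y := fun b y =>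
      lik_nonneg h.p_nonneg h.p_le_one h.nonneg h.le_one hq hq' t b y
    rw [sum_lik_succ]
    set w := slotWeight M η p (lik (n := n) M η p q t) (q t) x with hwdef
    have hw : ∑ s, w s = 1 := sum_slotWeight_lik h.sum_eq t x
    have hw0 : ∀ s, 0 ≤ w s := fun s =>
      slotWeight_nonneg h.p_nonneg h.p_le_one h.nonneg h.le_one (hq t) (hq' t) hL x s
    have hle : ∀ ω : Fin n → Option (Option Label × Tree n t),
        (if v ∈ names (t + 1) ω then (1 : ℝ) else 0)
        ≤ ∑ u, (ω u).elim 0 fun z => (if v = u then 1 else 0) +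
            (if v ∈ names t z.2 then 1 else 0) := by
      intro ω
      have hnn : ∀ u, 0 ≤ (ω u).elim (0 : ℝ) fun z => (if v = u then 1 else 0) +
            (if v ∈ names t z.2 then 1 else 0) := by
        intro u
        rcases ω u with _ | z
        · simp
        · simp only [Option.elim]; split_ifs <;> norm_num
      split_ifs with hv
      · obtain ⟨u, z, hu, hv⟩ := mem_names_succ.1 hv
        refine le_trans ?_ (Finset.single_le_sum (fun u _ => hnn u) (Finset.mem_univ u))
        simp only [hu, Option.elim]
        rcases Finset.mem_insert.1 hv with rfl | hv
        · simp only [if_true]; split_ifs <;> norm_num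
        · simp only [hv, if_true]; split_ifs <;> norm_num
      · exact Finset.sum_nonneg fun u _ => hnn u
    refine (prodExp_mono hw0 hle).trans ?_
    rw [prodExp_sum]
    have hb : ∀ u : Fin n, prodExp w (fun ω : Fin n → Option (Option Label × Tree n t) =>
        (ω u).elim 0 fun z => (if v = u then (1 : ℝ) else 0) +
            (if v ∈ names t z.2 then 1 else 0))
        ≤ η * ((if v = u then 1 else 0) + sizeBound d t / n) := by
      intro u
      rw [prodExp_apply hw u (fun s : Option (Option Label × Tree n t) =>
        s.elim 0 fun z => (if v = u then (1 : ℝ) else 0) + (if v ∈ names t z.2 then 1 else 0))]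
      refine sum_slotWeight_elim_le h t x
        (ψ := fun b => (if v = u then (1 : ℝ) else 0) + (if v ∈ names t b then 1 else 0)) fun y => ?_
      simp only [mul_add, Finset.sum_add_distrib]
      refine add_le_add ?_ (ih y v)
      rw [← Finset.sum_mul, sum_lik h.sum_eq, one_mul]
    refine (Finset.sum_le_sum fun u _ => hb u).trans ?_
    rw [← Finset.mul_sum, Finset.sum_add_distrib]
    simp only [Finset.sum_ite_eq, Finset.mem_univ, if_true, Finset.sum_const, Finset.card_univ,
      Fintype.card_fin, nsmul_eq_mul]
    have : η = d / n := by field_simp; linarith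
    rw [this, sizeBound]
    apply le_of_eq
    field_simp

theorem sum_lik_card_names_le (h : Admissible M η p) (hd : n * η = d) (hd0 : 0 ≤ d)
    (hq : ∀ t, 0 ≤ q t) (hq' : ∀ t, q t ≤ 1) (t : ℕ) (x : Label) :
    ∑ ω : Tree n t, lik M η p q t ω x * (names t ω).card ≤ sizeBound d t := by
  have h1 : ∀ ω : Tree n t, ((names t ω).card : ℝ) = ∑ v, if v ∈ names t ω then 1 else 0 := by
    intro ω; simp
  simp only [h1, Finset.mul_sum]
  rw [Finset.sum_comm]
  refine (Finset.sum_le_sum fun v _ => sum_lik_mem_names_le h hd hq hq' t x v).trans ?_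
  rw [Finset.sum_const, Finset.card_univ, Fintype.card_fin, nsmul_eq_mul]
  rcases Nat.eq_zero_or_pos n with rfl | hn
  · simpa using sizeBound_nonneg hd0 t
  · have : (0 : ℝ) < n := by exact_mod_cast hn
    apply le_of_eq
    field_simp

-- Union bound. The sum of `F` covers collisions involving the root or inside one branch. The terms
-- `H v u * H v u'` cover a name v common to two branches; these are independent, so each factor
-- brings its own 1/n, and the sum over v still leaves 1/n.
open Classical in
theorem sum_lik_not_inj_le (h : Admissible M η p) (hd : n * η = d)
    (hq : ∀ t, 0 ≤ q t) (hq' : ∀ t, q t ≤ 1) (t : ℕ) (x : Label) (r : Fin n) :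
    ∑ ω : Tree n t, lik M η p q t ω x * (if Inj t ω r then 0 else 1)
      ≤ collisionBound d t / n := by
  have hn : (0 : ℝ) < n := by exact_mod_cast r.pos
  have hd0 : 0 ≤ d := hd ▸ mul_nonneg hn.le h.density_nonneg
  have hη : η = d / n := by field_simp; linarith
  induction t generalizing x r with
  | zero => simp [Inj, collisionBound]
  | succ t ih =>
    have hA := sizeBound_nonneg hd0 t
    have hL : ∀ b y, 0 ≤ lik (n := n) M η p q t b y := fun b y =>
      lik_nonneg h.p_nonneg h.p_le_one h.nonneg h.le_one hq hq' t b y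
    rw [sum_lik_succ]
    set w := slotWeight M η p (lik (n := n) M η p q t) (q t) x with hwdef
    have hw : ∑ s, w s = 1 := sum_slotWeight_lik h.sum_eq t x
    have hw0 : ∀ s, 0 ≤ w s := fun s =>
      slotWeight_nonneg h.p_nonneg h.p_le_one h.nonneg h.le_one (hq t) (hq' t) hL x s
    let f : Fin n → Tree n t → ℝ := fun u b => (if u = r then 1 else 0) +
      (if u ∈ names t b then 1 else 0) + (if r ∈ names t b then 1 else 0) +
      (if Inj t b u then 0 else 1)
    let g : Fin n → Fin n → Tree n t → ℝ := fun v u b =>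
      (if v = u then 1 else 0) + (if v ∈ names t b then 1 else 0)
    let F : Fin n → Option (Option Label × Tree n t) → ℝ := fun u s => s.elim 0 fun z => f u z.2
    let H : Fin n → Fin n → Option (Option Label × Tree n t) → ℝ :=
      fun v u s => s.elim 0 fun z => g v u z.2
    have hf0 : ∀ u b, 0 ≤ f u b := by
      intro u b; simp only [f]; split_ifs <;> norm_num
    have hg0 : ∀ v u b, 0 ≤ g v u b := by
      intro v u b; simp only [g]; split_ifs <;> norm_num
    have hF0 : ∀ u s, 0 ≤ F u s := by
      intro u s; rcases s with _ | z
      · simp [F]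
      · exact hf0 u _
    have hH0 : ∀ v u s, 0 ≤ H v u s := by
      intro v u s; rcases s with _ | z
      · simp [H]
      · exact hg0 v u _
    have hle : ∀ ω : Fin n → Option (Option Label × Tree n t),
        (if Inj (t + 1) ω r then (0 : ℝ) else 1)
        ≤ (∑ u, F u (ω u)) + ∑ u, ∑ u', ∑ v,
            (if u = u' then 0 else H v u (ω u) * H v u' (ω u')) := by
      intro ω
      have hb0 : ∀ u u' v, 0 ≤ (if u = u' then 0 else H v u (ω u) * H v u' (ω u')) := by
        intro u u' v; split_ifs
        · exact le_rfl
        · exact mul_nonneg (hH0 _ _ _) (hH0 _ _ _)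
      have ha := Finset.sum_nonneg fun u (_ : u ∈ Finset.univ) => hF0 u (ω u)
      have hb : 0 ≤ ∑ u, ∑ u', ∑ v, (if u = u' then 0 else H v u (ω u) * H v u' (ω u')) :=
        Finset.sum_nonneg fun u _ => Finset.sum_nonneg fun u' _ =>
          Finset.sum_nonneg fun v _ => hb0 u u' v
      split_ifs with hI
      · linarith
      · simp only [Inj, not_and_or, not_forall] at hI
        rcases hI with ⟨u, z, hu, hI⟩ | ⟨u, z, u', z', hu, hu', huu, hI⟩
        · have h1 : 1 ≤ F u (ω u) := by
            simp only [F, hu, Option.elim, f]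
            by_cases h1 : u = r
            · simp only [h1, if_true]; split_ifs <;> norm_num
            by_cases h2 : u ∈ names t z.2
            · simp only [h2, if_true]; split_ifs <;> norm_num
            by_cases h3 : r ∈ names t z.2
            · simp only [h3, if_true]; split_ifs <;> norm_num
            have h4 : ¬ Inj t z.2 u := fun h4 => by tauto
            simp only [h4, if_false]; split_ifs; norm_num
          have := Finset.single_le_sum (fun u _ => hF0 u (ω u)) (Finset.mem_univ u)
          linarith
        · obtain ⟨v, hv, hv'⟩ := Finset.not_disjoint_iff.1 hI
          have hone : ∀ w y, ω w = some y → v ∈ insert w (names t y.2) → 1 ≤ H v w (ω w) := by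
            intro w y hw hv
            simp only [H, hw, Option.elim, g]
            rcases Finset.mem_insert.1 hv with rfl | hv
            · simp only [if_true]; split_ifs <;> norm_num
            · simp only [hv, if_true]; split_ifs <;> norm_num
          have h1 : 1 ≤ (if u = u' then 0 else H v u (ω u) * H v u' (ω u')) := by
            rw [if_neg huu]
            exact one_le_mul_of_one_le_of_one_le (hone u z hu hv) (hone u' z' hu' hv')
          have h2 := Finset.single_le_sum (fun v _ => hb0 u u' v) (Finset.mem_univ v)
          have h3 := Finset.single_le_sum (f := fun u' => ∑ v,
            (if u = u' then 0 else H v u (ω u) * H v u' (ω u')))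
            (fun u' _ => Finset.sum_nonneg fun v _ => hb0 u u' v) (Finset.mem_univ u')
          have h4 := Finset.single_le_sum (f := fun u => ∑ u', ∑ v,
            (if u = u' then 0 else H v u (ω u) * H v u' (ω u')))
            (fun u _ => Finset.sum_nonneg fun u' _ => Finset.sum_nonneg fun v _ => hb0 u u' v)
            (Finset.mem_univ u)
          linarith
    refine (prodExp_mono hw0 hle).trans ?_
    rw [prodExp_add, prodExp_sum]
    simp only [prodExp_sum]
    have hFb : ∀ u : Fin n, prodExp w (fun ω : Fin n → Option (Option Label × Tree n t) => F u (ω u))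
        ≤ η * ((if u = r then 1 else 0) + sizeBound d t / n + sizeBound d t / n
            + collisionBound d t / n) := by
      intro u
      rw [prodExp_apply hw u (F u)]
      refine sum_slotWeight_elim_le h t x (ψ := f u) fun y => ?_
      simp only [f, mul_add, Finset.sum_add_distrib]
      refine add_le_add (add_le_add (add_le_add ?_ (sum_lik_mem_names_le h hd hq hq' t y u))
        (sum_lik_mem_names_le h hd hq hq' t y r)) (ih y u)
      rw [← Finset.sum_mul, sum_lik h.sum_eq, one_mul]
    have hHb : ∀ v u : Fin n, ∑ s, w s * H v u s ≤ η * ((if v = u then 1 else 0) + sizeBound d t / n) := by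
      intro v u
      refine sum_slotWeight_elim_le h t x (ψ := g v u) fun y => ?_
      simp only [g, mul_add, Finset.sum_add_distrib]
      refine add_le_add ?_ (sum_lik_mem_names_le h hd hq hq' t y v)
      rw [← Finset.sum_mul, sum_lik h.sum_eq, one_mul]
    have hHn : ∀ v u : Fin n, 0 ≤ ∑ s, w s * H v u s := fun v u =>
      Finset.sum_nonneg fun s _ => mul_nonneg (hw0 s) (hH0 _ _ _)
    have hbd0 : ∀ v u : Fin n, 0 ≤ η * ((if v = u then 1 else 0) + sizeBound d t / n) := fun v u =>
      (hHn v u).trans (hHb v u)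
    have hpair : ∀ u u' v : Fin n,
        prodExp w (fun ω : Fin n → Option (Option Label × Tree n t) =>
          (if u = u' then 0 else H v u (ω u) * H v u' (ω u')))
        ≤ (η * ((if v = u then 1 else 0) + sizeBound d t / n)) *
          (η * ((if v = u' then 1 else 0) + sizeBound d t / n)) := by
      intro u u' v
      by_cases huu : u = u'
      · simp only [huu, if_true]
        rw [prodExp_const hw]
        exact mul_nonneg (hbd0 v u') (hbd0 v u')
      · simp only [huu, if_false]
        rw [prodExp_apply₂ hw huu]
        exact mul_le_mul (hHb v u) (hHb v u') (hHn v u') (hbd0 v u)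
    have hfin1 := Finset.sum_le_sum fun u (_ : u ∈ Finset.univ) => hFb u
    have hfin2 : ∑ u, ∑ u', ∑ v, prodExp w (fun ω : Fin n → Option (Option Label × Tree n t) =>
          (if u = u' then 0 else H v u (ω u) * H v u' (ω u')))
        ≤ ∑ u, ∑ u', ∑ v, (η * ((if v = u then 1 else 0) + sizeBound d t / n)) *
          (η * ((if v = u' then 1 else 0) + sizeBound d t / n)) :=
      Finset.sum_le_sum fun u _ => Finset.sum_le_sum fun u' _ =>
        Finset.sum_le_sum fun v _ => hpair u u' v
    refine (add_le_add hfin1 hfin2).trans (le_of_eq ?_)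
    have e1 : ∑ u : Fin n, ∑ u' : Fin n, ∑ v : Fin n,
          (η * ((if v = u then 1 else 0) + sizeBound d t / n)) *
          (η * ((if v = u' then 1 else 0) + sizeBound d t / n))
        = n * (η * (1 + sizeBound d t)) ^ 2 := by
      have e2 : ∀ v : Fin n, ∑ u : Fin n, η * ((if v = u then 1 else 0) + sizeBound d t / n)
          = η * (1 + sizeBound d t) := by
        intro v
        rw [← Finset.mul_sum, Finset.sum_add_distrib]
        simp only [Finset.sum_ite_eq, Finset.mem_univ, if_true, Finset.sum_const, Finset.card_univ,
          Fintype.card_fin, nsmul_eq_mul]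
        field_simp
      calc _ = ∑ v : Fin n, ∑ u : Fin n, ∑ u' : Fin n,
            (η * ((if v = u then 1 else 0) + sizeBound d t / n)) *
            (η * ((if v = u' then 1 else 0) + sizeBound d t / n)) := by
              rw [Finset.sum_congr rfl fun u _ => Finset.sum_comm, Finset.sum_comm]
        _ = ∑ v : Fin n, (η * (1 + sizeBound d t)) ^ 2 := by
              refine Finset.sum_congr rfl fun v _ => ?_
              rw [← Finset.sum_mul_sum, e2, sq]
        _ = _ := by simp
    rw [e1, ← Finset.mul_sum]
    simp only [Finset.sum_add_distrib, Finset.sum_ite_eq', Finset.mem_univ, if_true,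
      Finset.sum_const, Finset.card_univ, Fintype.card_fin, nsmul_eq_mul]
    rw [hη, collisionBound]
    field_simp
    ring

end TreeProbabilities


/-! ### Unfolding the graph along nonbacktracking walks. -/

section Unfolding

variable {n : ℕ}

open Classical in
/-- The observations along the nonbacktracking walks of length `t` in `G` that start at `v` and do
not step first to `w`. -/
def unfolding (G : SimpleGraph (Fin n)) (obs : ℕ → Fin n → Option Label) :
    ∀ t, Fin n → Fin n → Tree n t
  | 0, _, _ => ()
  | t + 1, v, w => fun u =>
    if G.Adj v u ∧ u ≠ w then some (obs t u, unfolding G obs t u v) else none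

/-- The pairs of distinct vertices. -/
def pairs (n : ℕ) : Finset (Sym2 (Fin n)) := Finset.univ.filter fun e => ¬ e.IsDiag

open Classical in
/-- The pairs of distinct vertices of which one has positive height in the tree. -/
def touching (t : ℕ) (ω : Tree n t) (r : Fin n) : Finset (Sym2 (Fin n)) :=
  (pairs n).filter fun e => ∃ v ∈ e, v ∈ interior t ω r

/-- The edges of `G` at the vertices of positive height of the tree are those of the tree. -/
def Agrees (G : SimpleGraph (Fin n)) (t : ℕ) (ω : Tree n t) (r : Fin n) : Prop :=
  ∀ e ∈ touching t ω r, e ∈ G.edgeSet ↔ e ∈ treeEdges t ω r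

/-- In the induction w is the parent of v. The pair (v, w) is exempted in `hG` because it is an edge
of the graph that does not belong to the subtree below v; the nonbacktracking rule removes it from
the unfolding. -/
theorem unfolding_eq_of_forall {G : SimpleGraph (Fin n)} {obs : ℕ → Fin n → Option Label} {t : ℕ}
    {ω : Tree n t} {v w : Fin n} (hω : Inj t ω v) (hw : w ∉ names t ω)
    (hG : ∀ x ∈ interior t ω v, ∀ y, ¬ (x = v ∧ y = w) → (G.Adj x y ↔ s(x, y) ∈ treeEdges t ω v))
    (hm : Matches obs t ω) : unfolding G obs t v w = ω := by
  induction t generalizing v w with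
  | zero => rfl
  | succ t ih =>
    funext u
    have hv : v ∈ interior (t + 1) ω v := mem_interior_succ.2 (Or.inl rfl)
    have hvN := hω.root_notMem
    rcases hu : ω u with _ | z
    · simp only [unfolding, ite_eq_right_iff, reduceCtorEq, imp_false, not_and, not_not]
      intro hadj
      by_contra huw
      obtain ⟨u', z', hu', h⟩ := mem_treeEdges_succ.1 ((hG v hv u (by simp [huw])).1 hadj)
      rcases h with h | h
      · have : u = u' := by
          rcases Sym2.eq_iff.1 h with ⟨_, h⟩ | ⟨h1, h2⟩
          · exact h
          · exact h2.trans h1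
        rw [← this, hu] at hu'
        cases hu'
      · exact hvN (mem_names_succ.2 ⟨u', z', hu', mem_of_mem_treeEdges h (by simp)⟩)
    · have huN : u ∈ names (t + 1) ω := mem_names_succ.2 ⟨u, z, hu, by simp⟩
      have huw : u ≠ w := fun h => hw (h ▸ huN)
      have hadj : G.Adj v u :=
        (hG v hv u (by simp [huw])).2 (mem_treeEdges_succ.2 ⟨u, z, hu, Or.inl rfl⟩)
      simp only [unfolding, hadj, huw, ne_eq, not_false_eq_true, and_self, if_true]
      rw [(hm u z hu).1, ih (hω.1 u z hu).2.2.2 (hω.1 u z hu).2.2.1 ?_ (hm u z hu).2]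
      intro x hx y hxy
      have hxI : x ∈ insert u (names t z.2) := interior_subset _ _ hx
      have hxv : x ≠ v := by
        rintro rfl
        exact hvN (mem_names_succ.2 ⟨u, z, hu, hxI⟩)
      rw [hG x (mem_interior_succ.2 (Or.inr ⟨u, z, hu, hx⟩)) y (by simp [hxv])]
      constructor
      · intro h
        obtain ⟨u', z', hu', h⟩ := mem_treeEdges_succ.1 h
        have huu : x ∈ insert u' (names t z'.2) → u = u' := by
          intro hx'
          by_contra hne
          exact Finset.disjoint_left.1 (hω.2 u z u' z' hu hu' hne) hxI hx'
        rcases h with h | h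
        · rcases Sym2.eq_iff.1 h with ⟨h1, _⟩ | ⟨h1, h2⟩
          · exact absurd h1 hxv
          · have := huu (by simp [h1])
            exact absurd ⟨h1.trans this.symm, h2⟩ hxy
        · have := huu (mem_of_mem_treeEdges h (by simp))
          subst this
          rw [hu] at hu'
          cases hu'
          exact h
      · intro h
        exact mem_treeEdges_succ.2 ⟨u, z, hu, Or.inr h⟩

theorem treeEdges_subset_touching {t : ℕ} {ω : Tree n t} {r : Fin n} (hω : Inj t ω r) :
    treeEdges t ω r ⊆ touching t ω r := by
  intro e he
  simp only [touching, pairs, Finset.mem_filter, Finset.mem_univ, true_and]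
  exact ⟨not_isDiag_of_mem_treeEdges hω he, exists_mem_interior he⟩

/-- A tree with distinct vertices is recovered by unfolding the graphs that agree with it. -/
theorem Agrees.unfolding_eq {G : SimpleGraph (Fin n)} {obs : ℕ → Fin n → Option Label} {t : ℕ}
    {ω : Tree n t} {r : Fin n} (hG : Agrees G t ω r) (hω : Inj t ω r) (hm : Matches obs t ω) :
    unfolding G obs t r r = ω := by
  -- The root has no parent: with w = r the nonbacktracking rule is vacuous, as G has no loops.
  refine unfolding_eq_of_forall hω hω.root_notMem (fun x hx y hxy => ?_) hm
  by_cases h : x = y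
  · subst h
    refine ⟨fun h => absurd h (G.loopless.irrefl x), fun h => ?_⟩
    exact absurd (by simp) (not_isDiag_of_mem_treeEdges hω h)
  · rw [← SimpleGraph.mem_edgeSet]
    refine hG _ ?_
    simp only [touching, pairs, Finset.mem_filter, Finset.mem_univ, true_and]
    exact ⟨by simpa using h, x, by simp, hx⟩

/-- The unfolding at `i` is a function of the ball around `i`. -/
theorem unfolding_congr {G G' : SimpleGraph (Fin n)} {Y Y' : Fin n → Option Label} {i : Fin n}
    {T : ℕ} (hball : ball G i T = ball G' i T)
    (hadj : ∀ j ∈ ball G i T, ∀ k ∈ ball G i T, (G.Adj j k ↔ G'.Adj j k))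
    (hY : ∀ j ∈ ball G i T, Y j = Y' j) (t : ℕ) (v w : Fin n) (hv : G.edist i v + t ≤ T)
    (hv' : G'.edist i v + t ≤ T) :
    unfolding G (fun _ => Y) t v w = unfolding G' (fun _ => Y') t v w := by
  induction t generalizing v w with
  | zero => rfl
  | succ t ih =>
    have hstep : ∀ (H : SimpleGraph (Fin n)) (u : Fin n), H.edist i v + (t + 1 : ℕ) ≤ T →
        H.Adj v u → H.edist i u + t ≤ T := by
      intro H u h hadj
      refine le_trans ?_ h
      have h1 : H.edist i u ≤ H.edist i v + 1 := by
        refine (SimpleGraph.edist_triangle (v := v)).trans ?_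
        rw [SimpleGraph.edist_eq_one_iff_adj.2 hadj]
      calc H.edist i u + t ≤ (H.edist i v + 1) + t := by gcongr
        _ = H.edist i v + (t + 1 : ℕ) := by push_cast; rw [add_assoc, add_comm (1 : ℕ∞)]
    have hvb : v ∈ ball G i T := le_trans (by simp) hv
    have hiff : ∀ u, G.Adj v u ↔ G'.Adj v u := by
      intro u
      constructor
      · intro h
        exact (hadj v hvb u (le_trans (by simp) (hstep G u hv h))).1 h
      · intro h
        have : u ∈ ball G i T := by
          rw [hball]
          exact le_trans (by simp) (hstep G' u hv' h)
        exact (hadj v hvb u this).2 h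
    funext u
    simp only [unfolding]
    by_cases h : G'.Adj v u ∧ u ≠ w
    · rw [if_pos h, if_pos ⟨(hiff u).2 h.1, h.2⟩, ih u v (hstep G u hv ((hiff u).2 h.1)) (hstep G' u hv' h.1),
        hY u (le_trans (by simp) (hstep G u hv ((hiff u).2 h.1)))]
    · rw [if_neg h, if_neg fun h' => h ⟨(hiff u).1 h'.1, h'.2⟩]

end Unfolding

/-! ### Factorization of the graph weight around a given tree. -/

section GraphWeight

variable {n : ℕ} {M : Matrix Label Label ℝ}

/-- The probability of the edge `e` given the marks. -/
def edgeProb (hM : ∀ x y, M x y = M y x) (ξ : Fin n → Mark) : Sym2 (Fin n) → ℝ :=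
  Sym2.lift ⟨fun a b => M (ξ a).1 (ξ b).1, fun _ _ => hM _ _⟩

open Classical in
/-- The probability of the graph given the marks. -/
def graphWeight (hM : ∀ x y, M x y = M y x) (ξ : Fin n → Mark) (G : SimpleGraph (Fin n)) : ℝ :=
  ∏ e ∈ pairs n, if e ∈ G.edgeSet then edgeProb hM ξ e else 1 - edgeProb hM ξ e

open Classical in
theorem graphWeight_eq (hM : ∀ x y, M x y = M y x) (ξ : Fin n → Mark) (G : SimpleGraph (Fin n)) :
    graphWeight hM ξ G = ∏ e : Fin n × Fin n with e.1 < e.2,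
      if G.Adj e.1 e.2 then M (ξ e.1).1 (ξ e.2).1 else 1 - M (ξ e.1).1 (ξ e.2).1 := by
  symm
  refine Finset.prod_bij (fun e _ => s(e.1, e.2)) ?_ ?_ ?_ ?_
  · intro e he
    simp only [Finset.mem_filter, Finset.mem_univ, true_and] at he
    simp [pairs, he.ne]
  · rintro ⟨a, b⟩ he ⟨a', b'⟩ he' h
    simp only [Finset.mem_filter, Finset.mem_univ, true_and] at he he'
    rcases Sym2.eq_iff.1 h with ⟨h1, h2⟩ | ⟨h1, h2⟩
    · simp only at h1 h2; rw [h1, h2]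
    · simp only at h1 h2
      subst h1 h2
      exact absurd he (lt_asymm he')
  · intro e he
    induction e using Sym2.ind with
    | _ a b =>
      simp only [pairs, Finset.mem_filter, Finset.mem_univ, true_and, Sym2.mk_isDiag_iff] at he
      rcases lt_or_gt_of_ne he with h | h
      · exact ⟨(a, b), by simp [h], rfl⟩
      · exact ⟨(b, a), by simp [h], Sym2.eq_swap⟩
  · intro e _
    simp [edgeProb]

-- Graphs are the subsets of `pairs n`, so this is the expansion of a product of sums.
open Classical in
theorem sum_prod_edges (f g : Sym2 (Fin n) → ℝ) :
    ∑ G : SimpleGraph (Fin n), ∏ e ∈ pairs n, (if e ∈ G.edgeSet then f e else g e)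
      = ∏ e ∈ pairs n, (f e + g e) := by
  rw [Finset.prod_add]
  have hG : ∀ G : SimpleGraph (Fin n), ∀ e, e ∈ G.edgeSet → e ∈ pairs n := by
    intro G e he
    simp only [pairs, Finset.mem_filter, Finset.mem_univ, true_and]
    exact G.not_isDiag_of_mem_edgeSet he
  refine Finset.sum_bij (fun G _ => (pairs n).filter fun e => e ∈ G.edgeSet) ?_ ?_ ?_ ?_
  · intro G _
    simp
  · intro G _ G' _ h
    rw [← SimpleGraph.edgeSet_inj]
    ext e
    have := Finset.ext_iff.1 h e
    simp only [Finset.mem_filter] at this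
    exact ⟨fun he => (this.1 ⟨hG _ _ he, he⟩).2, fun he => (this.2 ⟨hG _ _ he, he⟩).2⟩
  · intro S hS
    refine ⟨SimpleGraph.fromEdgeSet S, Finset.mem_univ _, ?_⟩
    ext e
    rw [Finset.mem_powerset] at hS
    simp only [SimpleGraph.edgeSet_fromEdgeSet, Finset.mem_filter]
    constructor
    · rintro ⟨_, h, _⟩; exact h
    · intro h
      refine ⟨hS h, h, ?_⟩
      have := hS h
      simpa [pairs] using this
  · intro G _
    rw [Finset.prod_ite]
    congr 1
    refine Finset.prod_congr ?_ fun _ _ => rfl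
    ext e
    simp only [Finset.mem_filter, Finset.mem_sdiff, not_and]
    tauto

theorem sum_graphWeight (hM : ∀ x y, M x y = M y x) (ξ : Fin n → Mark) :
    ∑ G, graphWeight hM ξ G = 1 := by
  classical
  unfold graphWeight
  rw [sum_prod_edges]
  exact Finset.prod_eq_one fun e _ => by ring

open Classical in
/-- The weight of the pairs at the vertices of positive height of the tree. -/
def touchWeight (hM : ∀ x y, M x y = M y x) (t : ℕ) (ω : Tree n t) (r : Fin n)
    (ξ : Fin n → Mark) : ℝ :=
  ∏ e ∈ touching t ω r, if e ∈ treeEdges t ω r then edgeProb hM ξ e else 1 - edgeProb hM ξ e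

open Classical in
/-- The weight of the pairs away from the vertices of positive height of the tree. -/
def restWeight (hM : ∀ x y, M x y = M y x) (t : ℕ) (ω : Tree n t) (r : Fin n)
    (G : SimpleGraph (Fin n)) (ξ : Fin n → Mark) : ℝ :=
  ∏ e ∈ pairs n \ touching t ω r, if e ∈ G.edgeSet then edgeProb hM ξ e else 1 - edgeProb hM ξ e

theorem touching_subset (t : ℕ) (ω : Tree n t) (r : Fin n) : touching t ω r ⊆ pairs n :=
  Finset.filter_subset _ _

theorem Agrees.graphWeight_eq {hM : ∀ x y, M x y = M y x} {t : ℕ} {ω : Tree n t} {r : Fin n}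
    {G : SimpleGraph (Fin n)} (hG : Agrees G t ω r) (ξ : Fin n → Mark) :
    graphWeight hM ξ G = touchWeight hM t ω r ξ * restWeight hM t ω r G ξ := by
  classical
  unfold graphWeight touchWeight restWeight
  rw [← Finset.prod_sdiff (touching_subset t ω r), mul_comm]
  congr 1
  exact Finset.prod_congr rfl fun e he => by simp only [hG e he]

open Classical in
theorem sum_restWeight (hM : ∀ x y, M x y = M y x) (t : ℕ) (ω : Tree n t) (r : Fin n)
    (ξ : Fin n → Mark) :
    ∑ G, (if Agrees G t ω r then restWeight hM t ω r G ξ else 0) = 1 := by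
  -- On touching pairs the edge probabilities are replaced by indicators of agreement with the tree,
  -- so that only the graphs that agree survive in the expansion.
  let f : Sym2 (Fin n) → ℝ := fun e =>
    if e ∈ touching t ω r then (if e ∈ treeEdges t ω r then 1 else 0) else edgeProb hM ξ e
  let g : Sym2 (Fin n) → ℝ := fun e =>
    if e ∈ touching t ω r then (if e ∈ treeEdges t ω r then 0 else 1) else 1 - edgeProb hM ξ e
  have h := sum_prod_edges f g
  have h1 : ∏ e ∈ pairs n, (f e + g e) = 1 := by
    refine Finset.prod_eq_one fun e _ => ?_
    simp only [f, g]
    split_ifs <;> ring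
  rw [h1] at h
  rw [← h]
  refine Finset.sum_congr rfl fun G _ => ?_
  rw [← Finset.prod_sdiff (touching_subset t ω r)]
  have h2 : ∏ e ∈ pairs n \ touching t ω r, (if e ∈ G.edgeSet then f e else g e)
      = restWeight hM t ω r G ξ := by
    refine Finset.prod_congr rfl fun e he => ?_
    simp only [f, g, if_neg (Finset.mem_sdiff.1 he).2]
  rw [h2]
  split_ifs with hA
  · rw [Finset.prod_eq_one (s := touching t ω r), mul_one]
    intro e he
    simp only [f, g, he, if_true, hA e he]
    split_ifs <;> rfl
  · simp only [Agrees, not_forall] at hA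
    obtain ⟨e, he, hA⟩ := hA
    rw [Finset.prod_eq_zero he, mul_zero]
    simp only [f, g, he, if_true]
    split_ifs <;> tauto

/-- A pair that is not touching has no endpoint of positive height. The upper bound for tests of the
whole graph rests on this: the remaining graph does not see the marks inside the tree. -/
theorem restWeight_dependsOn (hM : ∀ x y, M x y = M y x) (t : ℕ) (ω : Tree n t) (r : Fin n)
    (G : SimpleGraph (Fin n)) :
    DependsOn (restWeight hM t ω r G) ((interior t ω r : Finset (Fin n)) : Set (Fin n))ᶜ := by
  classical
  intro ξ ξ' h
  refine Finset.prod_congr rfl fun e he => ?_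
  have : edgeProb hM ξ e = edgeProb hM ξ' e := by
    induction e using Sym2.ind with
    | _ a b =>
      simp only [touching, Finset.mem_sdiff, Finset.mem_filter, not_and, not_exists] at he
      have h2 := he.2 he.1
      simp only [edgeProb, Sym2.lift_mk]
      rw [h a (fun ha => h2 a (by simp) ha), h b (fun hb => h2 b (by simp) hb)]
  rw [this]

theorem edgeProb_nonneg (hM : ∀ x y, M x y = M y x) (h : ∀ x y, 0 ≤ M x y) (ξ : Fin n → Mark)
    (e : Sym2 (Fin n)) : 0 ≤ edgeProb hM ξ e := by
  induction e using Sym2.ind with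
  | _ a b => exact h _ _

theorem edgeProb_le (hM : ∀ x y, M x y = M y x) {D : ℝ} (h : ∀ x y, M x y ≤ D) (ξ : Fin n → Mark)
    (e : Sym2 (Fin n)) : edgeProb hM ξ e ≤ D := by
  induction e using Sym2.ind with
  | _ a b => exact h _ _

theorem graphWeight_nonneg (hM : ∀ x y, M x y = M y x) (h : ∀ x y, 0 ≤ M x y)
    (h1 : ∀ x y, M x y ≤ 1) (ξ : Fin n → Mark) (G : SimpleGraph (Fin n)) :
    0 ≤ graphWeight hM ξ G := by
  classical
  refine Finset.prod_nonneg fun e _ => ?_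
  have := edgeProb_nonneg hM h ξ e
  have := edgeProb_le hM h1 ξ e
  split_ifs <;> linarith

theorem restWeight_nonneg (hM : ∀ x y, M x y = M y x) (h : ∀ x y, 0 ≤ M x y)
    (h1 : ∀ x y, M x y ≤ 1) (t : ℕ) (ω : Tree n t) (r : Fin n) (G : SimpleGraph (Fin n))
    (ξ : Fin n → Mark) : 0 ≤ restWeight hM t ω r G ξ := by
  classical
  refine Finset.prod_nonneg fun e _ => ?_
  have := edgeProb_nonneg hM h ξ e
  have := edgeProb_le hM h1 ξ e
  split_ifs <;> linarith

theorem touchWeight_nonneg (hM : ∀ x y, M x y = M y x) (h : ∀ x y, 0 ≤ M x y)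
    (h1 : ∀ x y, M x y ≤ 1) (t : ℕ) (ω : Tree n t) (r : Fin n)
    (ξ : Fin n → Mark) : 0 ≤ touchWeight hM t ω r ξ := by
  classical
  refine Finset.prod_nonneg fun e _ => ?_
  have := edgeProb_nonneg hM h ξ e
  have := edgeProb_le hM h1 ξ e
  split_ifs <;> linarith

theorem touchWeight_eq (hM : ∀ x y, M x y = M y x) {t : ℕ} {ω : Tree n t} {r : Fin n}
    (hω : Inj t ω r) (ξ : Fin n → Mark) :
    touchWeight hM t ω r ξ = (∏ e ∈ touching t ω r \ treeEdges t ω r, (1 - edgeProb hM ξ e)) *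
      ∏ e ∈ treeEdges t ω r, edgeProb hM ξ e := by
  classical
  unfold touchWeight
  rw [← Finset.prod_sdiff (treeEdges_subset_touching hω)]
  congr 1
  · exact Finset.prod_congr (by congr!) fun e he => if_neg (Finset.mem_sdiff.1 he).2
  · exact Finset.prod_congr rfl fun e he => if_pos he

end GraphWeight


/-! ### Nonedges of the graph compared with absent children of the tree. -/

theorem prod_le_prod_of_subset_of_mem_unit {β : Type*} {A B : Finset β} (h : A ⊆ B) {g : β → ℝ}
    (h0 : ∀ b, 0 ≤ g b) (h1 : ∀ b, g b ≤ 1) : ∏ b ∈ B, g b ≤ ∏ b ∈ A, g b := by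
  classical
  rw [← Finset.prod_sdiff h]
  exact mul_le_of_le_one_left (Finset.prod_nonneg fun b _ => h0 b)
    (Finset.prod_le_one (fun b _ => h0 b) fun b _ => h1 b)

/-- The map need not be injective: repeated factors are at most one and only lower the left side. It
is used for (v, u) ↦ s(v, u), where a pair may arise twice. -/
theorem prod_comp_le_prod_of_subset_image {β κ : Type*} [DecidableEq β] {S : Finset κ}
    {A : Finset β} (f : κ → β) (h : A ⊆ S.image f) {g : β → ℝ}
    (h0 : ∀ b, 0 ≤ g b) (h1 : ∀ b, g b ≤ 1) : ∏ s ∈ S, g (f s) ≤ ∏ b ∈ A, g b := by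
  classical
  refine le_trans ?_ (prod_le_prod_of_subset_of_mem_unit h h0 h1)
  rcases isEmpty_or_nonempty κ with _ | _
  · simp [Finset.eq_empty_of_isEmpty S]
  have hex : ∀ b ∈ S.image f, ∃ s ∈ S, f s = b := fun b hb => Finset.mem_image.1 hb
  choose! k hk hk' using hex
  have hsub : (S.image f).image k ⊆ S := by
    intro s hs
    obtain ⟨b, hb, rfl⟩ := Finset.mem_image.1 hs
    exact hk b hb
  refine (prod_le_prod_of_subset_of_mem_unit hsub (fun s => h0 (f s)) (fun s => h1 (f s))).trans ?_
  rw [Finset.prod_image (by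
    intro b hb b' hb' hbb
    rw [← hk' b hb, ← hk' b' hb', hbb])]
  exact (Finset.prod_congr rfl fun b hb => by rw [hk' b hb]).le

/-- Apply 1 + y ≤ exp y to y = x / (1 - x), which is at most x + 2 x² for x ≤ 1/2. -/
theorem exp_neg_le_one_sub {x : ℝ} (h1 : x ≤ 1 / 2) :
    Real.exp (-(x + 2 * x ^ 2)) ≤ 1 - x := by
  have h2 : 0 < 1 - x := by linarith
  have h3 : x / (1 - x) ≤ x + 2 * x ^ 2 := by
    rw [div_le_iff₀ h2]
    nlinarith [mul_nonneg (sq_nonneg x) (by linarith : (0 : ℝ) ≤ 1 - 2 * x)]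
  have h4 := Real.add_one_le_exp (x / (1 - x))
  have h5 : x / (1 - x) + 1 = (1 - x)⁻¹ := by field_simp; ring
  rw [h5] at h4
  calc Real.exp (-(x + 2 * x ^ 2)) ≤ Real.exp (-(x / (1 - x))) := Real.exp_le_exp.2 (by linarith)
    _ ≤ 1 - x := by
      rw [Real.exp_neg]
      exact inv_le_of_inv_le₀ h2 h4

section NonEdges

variable {n : ℕ} {M : Matrix Label Label ℝ}

/-- The numbers of vertices with given labels are close to their means, in terms of `M`. -/
def Typical (M : Matrix Label Label ℝ) (d θ : ℝ) (ξ : Fin n → Mark) : Prop :=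
  ∀ x, |∑ u, M x (ξ u).1 - d| ≤ θ

/-- Including all factors s(v, u) with v of positive height and u arbitrary only decreases the
product. For typical marks each such v then costs about exp(-d), and 2 n D² bounds the quadratic
terms. -/
theorem nonEdges_ge (hM : ∀ x y, M x y = M y x) (h0 : ∀ x y, 0 ≤ M x y) {D : ℝ}
    (hD : ∀ x y, M x y ≤ D) (hD' : D ≤ 1 / 2) {d θ : ℝ} {ξ : Fin n → Mark}
    (hξ : Typical M d θ ξ) {t : ℕ} (ω : Tree n t) (r : Fin n) :
    Real.exp (-((interior t ω r).card * (d + θ + 2 * n * D ^ 2)))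
      ≤ ∏ e ∈ touching t ω r \ treeEdges t ω r, (1 - edgeProb hM ξ e) := by
  classical
  set I := interior t ω r
  have hsub : touching t ω r \ treeEdges t ω r
      ⊆ (I ×ˢ (Finset.univ : Finset (Fin n))).image fun z => s(z.1, z.2) := by
    intro e he
    simp only [Finset.mem_sdiff, touching, Finset.mem_filter] at he
    obtain ⟨⟨_, v, hv, hvI⟩, _⟩ := he
    obtain ⟨u, rfl⟩ := Sym2.mem_iff_exists.1 hv
    exact Finset.mem_image.2 ⟨(v, u), by simp [I, hvI], rfl⟩
  have hg0 : ∀ e, 0 ≤ 1 - edgeProb hM ξ e := fun e => by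
    linarith [edgeProb_le hM hD ξ e]
  have hg1 : ∀ e, 1 - edgeProb hM ξ e ≤ 1 := fun e => by
    linarith [edgeProb_nonneg hM h0 ξ e]
  refine le_trans ?_ (prod_comp_le_prod_of_subset_image _ hsub hg0 hg1)
  rw [Finset.prod_product]
  have hDn : 0 ≤ D := (h0 0 0).trans (hD 0 0)
  have h1 : ∀ v, Real.exp (-(d + θ + 2 * n * D ^ 2)) ≤ ∏ u, (1 - edgeProb hM ξ s(v, u)) := by
    intro v
    have hs : -(d + θ + 2 * n * D ^ 2) ≤ ∑ u, -(M (ξ v).1 (ξ u).1 + 2 * M (ξ v).1 (ξ u).1 ^ 2) := by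
      have ha := (abs_le.1 (hξ (ξ v).1)).2
      have hb : ∑ u, M (ξ v).1 (ξ u).1 ^ 2 ≤ n * D ^ 2 := by
        calc ∑ u, M (ξ v).1 (ξ u).1 ^ 2 ≤ ∑ _u : Fin n, D ^ 2 :=
              Finset.sum_le_sum fun u _ => pow_le_pow_left₀ (h0 _ _) (hD _ _) 2
          _ = n * D ^ 2 := by simp
      rw [Finset.sum_neg_distrib, Finset.sum_add_distrib, ← Finset.mul_sum]
      linarith
    refine (Real.exp_le_exp.2 hs).trans ?_
    rw [Real.exp_sum]
    exact Finset.prod_le_prod (fun u _ => (Real.exp_pos _).le) fun u _ =>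
      exp_neg_le_one_sub ((hD _ _).trans hD')
  calc _ = ∏ _v ∈ I, Real.exp (-(d + θ + 2 * n * D ^ 2)) := by
        rw [Finset.prod_const, ← Real.exp_nat_mul]; ring_nf
    _ ≤ _ := Finset.prod_le_prod (fun v _ => (Real.exp_pos _).le) fun v _ => h1 v

/-- Keep only the pairs from a vertex of positive height to a vertex outside the tree: these are
distinct and never tree edges. The at most K vertices left out of each inner product cost K D in the
exponent. -/
theorem nonEdges_le (hM : ∀ x y, M x y = M y x) (h0 : ∀ x y, 0 ≤ M x y) {D : ℝ}
    (hD : ∀ x y, M x y ≤ D) (hD' : D ≤ 1) {d θ : ℝ} {ξ : Fin n → Mark}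
    (hξ : Typical M d θ ξ) {t : ℕ} (ω : Tree n t) (r : Fin n) {K : ℕ}
    (hK : (names t ω).card + 1 ≤ K) :
    ∏ e ∈ touching t ω r \ treeEdges t ω r, (1 - edgeProb hM ξ e)
      ≤ Real.exp (-((interior t ω r).card * (d - θ - K * D))) := by
  classical
  set I := interior t ω r
  set N := insert r (names t ω)
  have hIN : I ⊆ N := interior_subset ω r
  have hg0 : ∀ e, 0 ≤ 1 - edgeProb hM ξ e := fun e => by
    linarith [edgeProb_le hM hD ξ e]
  have hg1 : ∀ e, 1 - edgeProb hM ξ e ≤ 1 := fun e => by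
    linarith [edgeProb_nonneg hM h0 ξ e]
  have hsub : (I ×ˢ Nᶜ).image (fun z => s(z.1, z.2)) ⊆ touching t ω r \ treeEdges t ω r := by
    intro e he
    obtain ⟨⟨v, u⟩, hz, rfl⟩ := Finset.mem_image.1 he
    simp only [Finset.mem_product, Finset.mem_compl] at hz
    simp only [Finset.mem_sdiff, touching, pairs, Finset.mem_filter, Finset.mem_univ, true_and]
    refine ⟨⟨?_, v, by simp, hz.1⟩, fun h => hz.2 (mem_of_mem_treeEdges h (by simp))⟩
    simp only [Sym2.mk_isDiag_iff]
    rintro rfl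
    exact hz.2 (hIN hz.1)
  refine (prod_le_prod_of_subset_of_mem_unit hsub hg0 hg1).trans ?_
  rw [Finset.prod_image, Finset.prod_product]
  · have hDn : 0 ≤ D := (h0 0 0).trans (hD 0 0)
    have h1 : ∀ v, ∏ u ∈ Nᶜ, (1 - edgeProb hM ξ s(v, u)) ≤ Real.exp (-(d - θ - K * D)) := by
      intro v
      have hs : ∑ u ∈ Nᶜ, -(M (ξ v).1 (ξ u).1) ≤ -(d - θ - K * D) := by
        have ha := (abs_le.1 (hξ (ξ v).1)).1
        have hb : ∑ u ∈ N, M (ξ v).1 (ξ u).1 ≤ K * D := by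
          calc ∑ u ∈ N, M (ξ v).1 (ξ u).1 ≤ ∑ _u ∈ N, D := Finset.sum_le_sum fun u _ => hD _ _
            _ = N.card * D := by simp
            _ ≤ K * D := by
              refine mul_le_mul_of_nonneg_right ?_ hDn
              exact_mod_cast (Finset.card_insert_le _ _).trans hK
        have hc := Finset.sum_add_sum_compl N fun u => M (ξ v).1 (ξ u).1
        rw [Finset.sum_neg_distrib]
        linarith
      refine le_trans ?_ (Real.exp_le_exp.2 hs)
      rw [Real.exp_sum]
      exact Finset.prod_le_prod (fun u _ => hg0 _) fun u _ => Real.one_sub_le_exp_neg _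
    calc _ ≤ ∏ _v ∈ I, Real.exp (-(d - θ - K * D)) :=
          Finset.prod_le_prod (fun v _ => Finset.prod_nonneg fun u _ => hg0 _) fun v _ => h1 v
      _ = _ := by
        rw [Finset.prod_const, ← Real.exp_nat_mul]; ring_nf
  · rintro ⟨v, u⟩ hz ⟨v', u'⟩ hz' h
    simp only [Finset.coe_product, Set.mem_prod, Finset.mem_coe, Finset.mem_compl] at hz hz'
    rcases Sym2.eq_iff.1 h with ⟨h1, h2⟩ | ⟨h1, h2⟩
    · simp only at h1 h2; rw [h1, h2]
    · simp only at h1 h2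
      exact absurd (hIN (h1 ▸ hz.1)) hz'.2

open Classical in
/-- For typical marks the law of the unfolding on small trees is close to the tree weight. -/
theorem abs_touchWeight_sub_treeWeight_le {η d θ D : ℝ} {σ : ℕ → Mark → Option Label}
    (hM : ∀ x y, M x y = M y x) (h0 : ∀ x y, 0 ≤ M x y) (hD : ∀ x y, M x y ≤ D)
    (hD' : D ≤ 1 / 2) (hη : 0 ≤ η) (hη' : η ≤ 1 / 2) (hd : n * η = d) (hθ : 0 ≤ θ)
    {ξ : Fin n → Mark} (hξ : Typical M d θ ξ) {t : ℕ} {ω : Tree n t} {r : Fin n}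
    (hω : Inj t ω r) {K : ℕ} (hK : (names t ω).card + 1 ≤ K) :
    |(if Matches (fun t u => σ t (ξ u)) t ω then 1 else 0) * touchWeight hM t ω r ξ
        - treeWeight M η σ t ω ξ r|
      ≤ (Real.exp (K * (θ + K * D + 2 * d * η + 2 * n * D ^ 2 + η)) - 1)
          * treeWeight M η σ t ω ξ r := by
  have hDn : 0 ≤ D := (h0 0 0).trans (hD 0 0)
  have hd0 : 0 ≤ d := hd ▸ mul_nonneg (Nat.cast_nonneg _) hη
  set s := K * (θ + K * D + 2 * d * η + 2 * n * D ^ 2 + η) with hs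
  set k := (interior t ω r).card with hk
  have hkK : (k : ℝ) ≤ K := by
    exact_mod_cast (Finset.card_le_card (interior_subset ω r)).trans
      ((Finset.card_insert_le _ _).trans hK)
  -- The absent children of the tree give B, the nonedges of the graph give P. Both are compared
  -- with exp(-k d), and s collects all the errors in the exponents; the edge factors are the same
  -- on both sides.
  set B := (1 - η) ^ absences t ω with hB
  set P := ∏ e ∈ touching t ω r \ treeEdges t ω r, (1 - edgeProb hM ξ e) with hP
  have hB0 : 0 < B := pow_pos (by linarith) _
  have hcard : (absences t ω : ℝ) + (names t ω).card = n * k := by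
    exact_mod_cast absences_add_card_names hω
  have hBup : B ≤ Real.exp (-(k * d) + K * η) := by
    calc B ≤ Real.exp (-η) ^ absences t ω :=
          pow_le_pow_left₀ (by linarith) (Real.one_sub_le_exp_neg _) _
      _ = Real.exp (absences t ω * (-η)) := by rw [← Real.exp_nat_mul]
      _ ≤ _ := by
        refine Real.exp_le_exp.2 ?_
        have h1 : ((names t ω).card : ℝ) ≤ K := by exact_mod_cast (Nat.le_succ _).trans hK
        have h2 : (absences t ω : ℝ) = n * k - (names t ω).card := by linarith
        have h3 := mul_le_mul_of_nonneg_right h1 hη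
        rw [h2, ← hd]; linarith
  have hBlow : Real.exp (-(k * d) - k * (2 * d * η)) ≤ B := by
    calc Real.exp (-(k * d) - k * (2 * d * η)) = Real.exp ((n * k : ℕ) * (-(η + 2 * η ^ 2))) := by
          congr 1; rw [← hd]; push_cast; ring
      _ = Real.exp (-(η + 2 * η ^ 2)) ^ (n * k) := by rw [← Real.exp_nat_mul]
      _ ≤ (1 - η) ^ (n * k) :=
          pow_le_pow_left₀ (Real.exp_pos _).le (exp_neg_le_one_sub hη') _
      _ ≤ B := by
          refine pow_le_pow_of_le_one (by linarith) (by linarith) ?_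
          have : absences t ω + (names t ω).card = n * k := absences_add_card_names hω
          omega
  have hPup : P ≤ Real.exp s * B := by
    refine (nonEdges_le hM h0 hD (by linarith) hξ ω r hK).trans ?_
    refine le_trans ?_ (mul_le_mul_of_nonneg_left hBlow (Real.exp_pos _).le)
    rw [← Real.exp_add]
    refine Real.exp_le_exp.2 ?_
    have : k * (θ + K * D + 2 * d * η) ≤ s := by
      rw [hs]
      refine mul_le_mul hkK ?_ (by positivity) (Nat.cast_nonneg _)
      have : 0 ≤ 2 * n * D ^ 2 := by positivity
      linarith
    linarith
  have hPlow : Real.exp (-s) * B ≤ P := by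
    refine le_trans ?_ (nonEdges_ge hM h0 hD hD' hξ ω r)
    refine (mul_le_mul_of_nonneg_left hBup (Real.exp_pos _).le).trans ?_
    rw [← Real.exp_add]
    refine Real.exp_le_exp.2 ?_
    have h1 : k * (θ + 2 * n * D ^ 2) ≤ K * (θ + 2 * n * D ^ 2) :=
      mul_le_mul_of_nonneg_right hkK (by positivity)
    have h2 : 0 ≤ K * (K * D + 2 * d * η) := by positivity
    rw [← hk]
    linarith
  have hPB : |P - B| ≤ (Real.exp s - 1) * B := by
    have h1 : 1 - Real.exp (-s) ≤ Real.exp s - 1 := by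
      have := Real.add_one_le_exp s
      have := Real.add_one_le_exp (-s)
      linarith
    have h2 := mul_le_mul_of_nonneg_right h1 hB0.le
    rw [abs_le]
    constructor <;> linarith
  rw [touchWeight_eq hM hω, treeWeight_eq hM hω]
  change |_ * (P * ∏ e ∈ treeEdges t ω r, edgeProb hM ξ e) -
    _ * (B * ∏ e ∈ treeEdges t ω r, edgeProb hM ξ e)| ≤
    _ * (_ * (B * ∏ e ∈ treeEdges t ω r, edgeProb hM ξ e))
  set E := ∏ e ∈ treeEdges t ω r, edgeProb hM ξ e
  have hE : 0 ≤ E := Finset.prod_nonneg fun e _ => edgeProb_nonneg hM h0 ξ e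
  split_ifs
  · have : (1 : ℝ) * (P * E) - 1 * (B * E) = (P - B) * E := by ring
    rw [this, abs_mul, abs_of_nonneg hE]
    calc _ ≤ (Real.exp s - 1) * B * E := mul_le_mul_of_nonneg_right hPB hE
      _ = _ := by ring
  · simp

end NonEdges

/-! ### The label counts are typical with high probability. -/

section TypicalMarks

variable {n : ℕ} {M : Matrix Label Label ℝ} {η p : ℝ}

-- Chebyshev's inequality for each of the two labels x, with variance at most n D²; the factor 2
-- counts the labels.
open Classical in
theorem prodExp_not_typical_le (h : Admissible M η p) {q₀ d θ D : ℝ} (hq : 0 ≤ q₀) (hq' : q₀ ≤ 1)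
    (hD : ∀ x y, M x y ≤ D) (hd : n * η = d) (hθ : 0 < θ) :
    prodExp (markWeight p q₀) (fun ξ : Fin n → Mark => if Typical M d θ ξ then 0 else 1)
      ≤ 2 * n * D ^ 2 / θ ^ 2 := by
  have hw0 := markWeight_nonneg h.p_nonneg h.p_le_one hq hq'
  have hw := sum_markWeight p q₀
  have hDn : 0 ≤ D := (h.nonneg 0 0).trans (hD 0 0)
  have hmean : ∀ x, ∑ m, markWeight p q₀ m * M x m.1 = η := by
    intro x
    rw [sum_markWeight_mul]
    simp only [← Finset.sum_mul, sum_boolWeight, one_mul]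
    exact h.sum_eq x
  have hηD : η ≤ D := by
    rw [← hmean 0]
    calc _ ≤ ∑ m, markWeight p q₀ m * D :=
          Finset.sum_le_sum fun m _ => mul_le_mul_of_nonneg_left (hD _ _) (hw0 m)
      _ = D := by rw [← Finset.sum_mul, hw, one_mul]
  have hη0 := h.density_nonneg
  have hle : ∀ ξ : Fin n → Mark, (if Typical M d θ ξ then (0 : ℝ) else 1)
      ≤ ∑ x, (1 / θ ^ 2) * (∑ u, (M x (ξ u).1 - η)) ^ 2 := by
    intro ξ
    split_ifs with hT
    · exact Finset.sum_nonneg fun x _ => by positivity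
    · simp only [Typical, not_forall, not_le] at hT
      obtain ⟨x, hx⟩ := hT
      refine le_trans ?_ (Finset.single_le_sum (f := fun x =>
        (1 / θ ^ 2) * (∑ u, (M x (ξ u).1 - η)) ^ 2) (fun x _ => by positivity)
        (Finset.mem_univ x))
      rw [Finset.sum_sub_distrib]
      simp only [Finset.sum_const, Finset.card_univ, Fintype.card_fin, nsmul_eq_mul, hd]
      rw [one_div, inv_mul_eq_div, one_le_div (by positivity), ← sq_abs (_ - d)]
      exact pow_le_pow_left₀ hθ.le hx.le 2
  refine (prodExp_mono hw0 hle).trans ?_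
  rw [prodExp_sum]
  have hx : ∀ x, prodExp (markWeight p q₀)
      (fun ξ : Fin n → Mark => (1 / θ ^ 2) * (∑ u, (M x (ξ u).1 - η)) ^ 2)
      ≤ n * D ^ 2 / θ ^ 2 := by
    intro x
    rw [prodExp_mul_left, prodExp_sq_sum hw (f := fun m => M x m.1 - η)]
    · have h1 : ∑ m, markWeight p q₀ m * (M x m.1 - η) ^ 2 ≤ D ^ 2 := by
        calc _ ≤ ∑ m, markWeight p q₀ m * D ^ 2 := by
              refine Finset.sum_le_sum fun m _ => mul_le_mul_of_nonneg_left ?_ (hw0 m)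
              refine sq_le_sq' ?_ ?_
              · linarith [h.nonneg x m.1]
              · linarith [hD x m.1]
          _ = D ^ 2 := by rw [← Finset.sum_mul, hw, one_mul]
      rw [Fintype.card_fin, one_div, inv_mul_eq_div]
      gcongr
    · simp only [mul_sub, Finset.sum_sub_distrib, hmean, ← Finset.sum_mul, hw]
      ring
  refine (Finset.sum_le_sum fun x _ => hx x).trans (le_of_eq ?_)
  simp only [Finset.sum_const, Finset.card_univ, Fintype.card_fin, nsmul_eq_mul]
  push_cast
  ring

end TypicalMarks


/-! ### Total variation comparison of the graph unfolding with the tree. -/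

open Classical in
/-- The trees with distinct vertices and less than `K` vertices besides the root. -/
def goodTrees (n t K : ℕ) (r : Fin n) : Finset (Tree n t) :=
  Finset.univ.filter fun ω => Inj t ω r ∧ (names t ω).card + 1 ≤ K

/-- The assumptions under which the local structure of the graph is compared with a tree. -/
structure Comparable (n : ℕ) (M : Matrix Label Label ℝ) (η p q₀ D : ℝ) (q : ℕ → ℝ)
    (σ : ℕ → Mark → Option Label) : Prop where
  adm : Admissible M η p
  le : ∀ x y, M x y ≤ D
  D_le : D ≤ 1 / 2
  density_le : η ≤ 1 / 2
  q₀_nonneg : 0 ≤ q₀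
  q₀_le : q₀ ≤ 1
  q_nonneg : ∀ t, 0 ≤ q t
  q_le : ∀ t, q t ≤ 1
  obs : ObservesWith q₀ σ q

/-- A bound for the distance between the graph and tree weights of the good trees. -/
def closeError (n K t : ℕ) (η D θ : ℝ) : ℝ :=
  (Real.exp (K * (θ + K * D + 2 * (n * η) * η + 2 * n * D ^ 2 + η)) - 1)
    + (1 + growth (n * D) t) * (2 * n * D ^ 2 / θ ^ 2)

/-- A bound for the probability of the trees that are not good. -/
def badError (n K t : ℕ) (η : ℝ) : ℝ :=
  collisionBound (n * η) t / n + sizeBound (n * η) t / K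

variable {n : ℕ} {M : Matrix Label Label ℝ} {η p q₀ D : ℝ} {q : ℕ → ℝ}
  {σ : ℕ → Mark → Option Label}

theorem Comparable.D_nonneg (h : Comparable n M η p q₀ D q σ) : 0 ≤ D :=
  (h.adm.nonneg 0 0).trans (h.le 0 0)

theorem Comparable.le_one (h : Comparable n M η p q₀ D q σ) (x y : Label) : M x y ≤ 1 :=
  (h.le x y).trans (h.D_le.trans (by norm_num))

theorem Comparable.markWeight_nonneg (h : Comparable n M η p q₀ D q σ) (m : Mark) :
    0 ≤ markWeight p q₀ m :=
  SBM.markWeight_nonneg h.adm.p_nonneg h.adm.p_le_one h.q₀_nonneg h.q₀_le m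

theorem Comparable.lik_nonneg (h : Comparable n M η p q₀ D q σ) (t : ℕ) (ω : Tree n t) (x : Label) :
    0 ≤ lik M η p q t ω x :=
  SBM.lik_nonneg h.adm.p_nonneg h.adm.p_le_one h.adm.nonneg h.adm.le_one h.q_nonneg h.q_le t ω x

open Classical in
/-- The event that the unfolding of the graph is the good tree `ω`, as an indicator. -/
def hit (σ : ℕ → Mark → Option Label) (t : ℕ) (ω : Tree n t) (r : Fin n) (ξ : Fin n → Mark)
    (G : SimpleGraph (Fin n)) : ℝ :=
  (if Matches (fun t u => σ t (ξ u)) t ω then 1 else 0) * (if Agrees G t ω r then 1 else 0)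

theorem hit_nonneg (t : ℕ) (ω : Tree n t) (r : Fin n) (ξ : Fin n → Mark)
    (G : SimpleGraph (Fin n)) : 0 ≤ hit σ t ω r ξ G := by
  unfold hit; split_ifs <;> norm_num

open Classical in
theorem hit_le {t K : ℕ} {r : Fin n} {ω : Tree n t} (hω : ω ∈ goodTrees n t K r) (ξ : Fin n → Mark)
    (G : SimpleGraph (Fin n)) :
    hit σ t ω r ξ G ≤ if unfolding G (fun t u => σ t (ξ u)) t r r = ω then 1 else 0 := by
  simp only [goodTrees, Finset.mem_filter] at hω
  unfold hit
  by_cases h1 : Matches (fun t u => σ t (ξ u)) t ω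
  · by_cases h2 : Agrees G t ω r
    · rw [if_pos (h2.unfolding_eq hω.2.1 h1)]; simp [h1, h2]
    · simp only [h2, if_false, mul_zero]; split_ifs <;> norm_num
  · simp only [h1, if_false, zero_mul]; split_ifs <;> norm_num

/-- A good tree that is hit is recovered by unfolding G, so at most one is hit. -/
theorem sum_hit_le_one (t K : ℕ) (r : Fin n) (ξ : Fin n → Mark) (G : SimpleGraph (Fin n)) :
    ∑ ω ∈ goodTrees n t K r, hit σ t ω r ξ G ≤ 1 := by
  classical
  refine (Finset.sum_le_sum fun ω hω => hit_le hω ξ G).trans ?_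
  refine (Finset.sum_le_univ_sum_of_nonneg fun _ => by split_ifs <;> norm_num).trans ?_
  simp

theorem sum_hit_mul (t K : ℕ) (r : Fin n) (ξ : Fin n → Mark) (G : SimpleGraph (Fin n))
    (f : Tree n t → ℝ) :
    ∑ ω ∈ goodTrees n t K r, hit σ t ω r ξ G * f ω
      = f (unfolding G (fun t u => σ t (ξ u)) t r r) *
        ∑ ω ∈ goodTrees n t K r, hit σ t ω r ξ G := by
  classical
  rw [Finset.mul_sum]
  refine Finset.sum_congr rfl fun ω hω => ?_
  have h1 := hit_le (σ := σ) hω ξ G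
  have h2 := hit_nonneg (σ := σ) t ω r ξ G
  split_ifs at h1 with h
  · rw [h, mul_comm]
  · rw [le_antisymm h1 h2]; simp

open Classical in
/-- The conditional probability that the unfolding is the good tree `ω`. -/
def hitProb (hM : ∀ x y, M x y = M y x) (σ : ℕ → Mark → Option Label) (t : ℕ) (ω : Tree n t)
    (r : Fin n) (ξ : Fin n → Mark) : ℝ :=
  (if Matches (fun t u => σ t (ξ u)) t ω then 1 else 0) * touchWeight hM t ω r ξ

open Classical in
theorem graphWeight_mul_hit (hM : ∀ x y, M x y = M y x) (t : ℕ) (ω : Tree n t) (r : Fin n)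
    (ξ : Fin n → Mark) (G : SimpleGraph (Fin n)) :
    graphWeight hM ξ G * hit σ t ω r ξ G
      = hitProb hM σ t ω r ξ * (if Agrees G t ω r then restWeight hM t ω r G ξ else 0) := by
  unfold hit hitProb
  by_cases h : Agrees G t ω r
  · rw [h.graphWeight_eq, if_pos h, if_pos h]; ring
  · simp [h]

theorem sum_graphWeight_mul_hit (hM : ∀ x y, M x y = M y x) (t : ℕ) (ω : Tree n t) (r : Fin n)
    (ξ : Fin n → Mark) :
    ∑ G, graphWeight hM ξ G * hit σ t ω r ξ G = hitProb hM σ t ω r ξ := by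
  classical
  simp only [graphWeight_mul_hit, ← Finset.mul_sum, sum_restWeight, mul_one]

theorem hitProb_nonneg (h : Comparable n M η p q₀ D q σ) (t : ℕ) (ω : Tree n t)
    (r : Fin n) (ξ : Fin n → Mark) : 0 ≤ hitProb h.adm.symm σ t ω r ξ := by
  unfold hitProb
  refine mul_nonneg ?_ (touchWeight_nonneg _ h.adm.nonneg h.le_one _ _ _ _)
  split_ifs <;> norm_num

theorem sum_hitProb_eq (hM : ∀ x y, M x y = M y x) (t K : ℕ) (r : Fin n) (ξ : Fin n → Mark) :
    ∑ ω ∈ goodTrees n t K r, hitProb hM σ t ω r ξ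
      = ∑ G, graphWeight hM ξ G * ∑ ω ∈ goodTrees n t K r, hit σ t ω r ξ G := by
  simp only [← sum_graphWeight_mul_hit, Finset.mul_sum]
  exact Finset.sum_comm

theorem sum_hitProb_le_one (h : Comparable n M η p q₀ D q σ) (t K : ℕ) (r : Fin n)
    (ξ : Fin n → Mark) : ∑ ω ∈ goodTrees n t K r, hitProb h.adm.symm σ t ω r ξ ≤ 1 := by
  rw [sum_hitProb_eq, ← sum_graphWeight h.adm.symm ξ]
  exact Finset.sum_le_sum fun G _ => mul_le_of_le_one_right
    (graphWeight_nonneg _ h.adm.nonneg h.le_one _ _) (sum_hit_le_one _ _ _ _ _)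

theorem prodExp_treeWeight_sum (h : Comparable n M η p q₀ D q σ) (t K : ℕ) (r : Fin n) :
    prodExp (markWeight p q₀) (fun ξ => ∑ ω ∈ goodTrees n t K r, treeWeight M η σ t ω ξ r)
      = ∑ y, labelWeight p y * ∑ ω ∈ goodTrees n t K r, lik M η p q t ω y := by
  rw [prodExp_sum]
  simp only [Finset.mul_sum]
  rw [Finset.sum_comm]
  refine Finset.sum_congr rfl fun ω hω => ?_
  simp only [goodTrees, Finset.mem_filter] at hω
  have := prodExp_mul_treeWeight (M := M) (η := η) (p := p) h.obs hω.2.1 (fun _ => 1)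
  simpa using this

theorem prodExp_treeWeight_sum_le_one (h : Comparable n M η p q₀ D q σ) (t K : ℕ) (r : Fin n) :
    prodExp (markWeight p q₀) (fun ξ => ∑ ω ∈ goodTrees n t K r, treeWeight M η σ t ω ξ r) ≤ 1 := by
  rw [prodExp_treeWeight_sum h, ← sum_labelWeight p]
  refine Finset.sum_le_sum fun y _ => mul_le_of_le_one_right
    (labelWeight_nonneg h.adm.p_nonneg h.adm.p_le_one y) ?_
  rw [← sum_lik (n := n) (q := q) h.adm.sum_eq t y]
  exact Finset.sum_le_univ_sum_of_nonneg fun ω => h.lik_nonneg _ _ _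

/-- On the good trees the laws of the unfolding of the graph and of the tree are close. -/
theorem prodExp_sum_abs_le (h : Comparable n M η p q₀ D q σ) (t K : ℕ) (r : Fin n) {θ : ℝ}
    (hθ : 0 < θ) :
    prodExp (markWeight p q₀) (fun ξ => ∑ ω ∈ goodTrees n t K r,
        |hitProb h.adm.symm σ t ω r ξ - treeWeight M η σ t ω ξ r|) ≤ closeError n K t η D θ := by
  classical
  have hD := h.D_nonneg
  have hη := h.adm.density_nonneg
  set c := Real.exp (K * (θ + K * D + 2 * (n * η) * η + 2 * n * D ^ 2 + η)) - 1 with hc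
  have hc0 : 0 ≤ c := by
    have : 0 ≤ K * (θ + K * D + 2 * (n * η) * η + 2 * n * D ^ 2 + η) := by positivity
    have := Real.one_le_exp this
    linarith
  have hg := growth_nonneg (n * D) t
  have hJ0 : ∀ (ξ : Fin n → Mark) (ω : Tree n t), 0 ≤ treeWeight M η σ t ω ξ r := fun ξ ω =>
    treeWeight_nonneg h.adm.nonneg h.adm.le_one ω ξ r
  have hle : ∀ ξ : Fin n → Mark, ∑ ω ∈ goodTrees n t K r,
      |hitProb h.adm.symm σ t ω r ξ - treeWeight M η σ t ω ξ r|
      ≤ c * ∑ ω ∈ goodTrees n t K r, treeWeight M η σ t ω ξ r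
        + (1 + growth (n * D) t) * (if Typical M (n * η) θ ξ then 0 else 1) := by
    intro ξ
    by_cases hT : Typical M (n * η) θ ξ
    · rw [if_pos hT, mul_zero, add_zero, Finset.mul_sum]
      refine Finset.sum_le_sum fun ω hω => ?_
      simp only [goodTrees, Finset.mem_filter] at hω
      exact abs_touchWeight_sub_treeWeight_le h.adm.symm h.adm.nonneg h.le h.D_le hη h.density_le
        rfl hθ.le hT hω.2.1 hω.2.2
    -- For atypical marks only the crude bounds 1 and `growth` are available; the small probability
    -- of these marks compensates.
    · rw [if_neg hT, mul_one]
      have h1 : ∑ ω ∈ goodTrees n t K r,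
          |hitProb h.adm.symm σ t ω r ξ - treeWeight M η σ t ω ξ r|
          ≤ ∑ ω ∈ goodTrees n t K r, hitProb h.adm.symm σ t ω r ξ
            + ∑ ω ∈ goodTrees n t K r, treeWeight M η σ t ω ξ r := by
        rw [← Finset.sum_add_distrib]
        refine Finset.sum_le_sum fun ω _ => ?_
        have h1 := hitProb_nonneg h t ω r ξ
        have h2 := hJ0 ξ ω
        rw [abs_le]; constructor <;> linarith
      have h2 := sum_hitProb_le_one h t K r ξ
      have h3 : ∑ ω ∈ goodTrees n t K r, treeWeight M η σ t ω ξ r ≤ growth (n * D) t :=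
        (Finset.sum_le_univ_sum_of_nonneg fun ω => hJ0 ξ ω).trans
          (sum_treeWeight_le h.adm.nonneg h.le hη h.adm.le_one le_rfl t ξ r)
      have h4 : 0 ≤ c * ∑ ω ∈ goodTrees n t K r, treeWeight M η σ t ω ξ r :=
        mul_nonneg hc0 (Finset.sum_nonneg fun ω _ => hJ0 ξ ω)
      linarith
  refine (prodExp_mono h.markWeight_nonneg hle).trans ?_
  rw [prodExp_add, prodExp_mul_left, prodExp_mul_left]
  refine add_le_add ?_ ?_
  · exact mul_le_of_le_one_right hc0 (prodExp_treeWeight_sum_le_one h t K r)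
  · exact mul_le_mul_of_nonneg_left
      (prodExp_not_typical_le h.adm h.q₀_nonneg h.q₀_le h.le rfl hθ) (by linarith)

-- A tree fails to be good through repeated names or through its size; the latter is Markov's
-- inequality for the number of names.
open Classical in
theorem one_sub_sum_lik_le (h : Comparable n M η p q₀ D q σ) (t : ℕ) {K : ℕ} (hK : 0 < K)
    (r : Fin n) (y : Label) :
    1 - ∑ ω ∈ goodTrees n t K r, lik M η p q t ω y ≤ badError n K t η := by
  have hK' : (0 : ℝ) < K := by exact_mod_cast hK
  have hd0 : 0 ≤ n * η := mul_nonneg (Nat.cast_nonneg _) h.adm.density_nonneg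
  have h1 : ∑ ω : Tree n t, lik M η p q t ω y
      - ∑ ω ∈ goodTrees n t K r, lik M η p q t ω y
      = ∑ ω : Tree n t, lik M η p q t ω y * (if ω ∈ goodTrees n t K r then 0 else 1) := by
    rw [← Finset.sum_filter_add_sum_filter_not Finset.univ (fun ω => ω ∈ goodTrees n t K r)]
    rw [Finset.filter_mem_eq_inter, Finset.univ_inter, add_sub_cancel_left, Finset.sum_filter]
    refine Finset.sum_congr rfl fun ω _ => ?_
    by_cases hω : ω ∈ goodTrees n t K r <;> simp [hω]
  rw [← sum_lik (n := n) (q := q) h.adm.sum_eq t y, h1]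
  have h2 : ∀ ω : Tree n t, lik M η p q t ω y * (if ω ∈ goodTrees n t K r then (0 : ℝ) else 1)
      ≤ lik M η p q t ω y * (if Inj t ω r then 0 else 1)
        + lik M η p q t ω y * (names t ω).card * (1 / K) := by
    intro ω
    have h3 := h.lik_nonneg t ω y
    rw [mul_assoc, ← mul_add]
    refine mul_le_mul_of_nonneg_left ?_ h3
    have h4 : (0 : ℝ) ≤ (names t ω).card * (1 / K) := by positivity
    by_cases hI : Inj t ω r
    · by_cases hc : (names t ω).card + 1 ≤ K
      · simp only [goodTrees, Finset.mem_filter, Finset.mem_univ, hI, hc, and_self, if_true]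
        linarith
      · have h5 : (K : ℝ) ≤ (names t ω).card := by
          have : K ≤ (names t ω).card := by omega
          exact_mod_cast this
        have : 1 ≤ ((names t ω).card : ℝ) * (1 / K) := by
          rw [mul_one_div, le_div_iff₀ hK']; linarith
        simp only [goodTrees, Finset.mem_filter, Finset.mem_univ, hI, hc, and_false, if_false,
          if_true]
        linarith
    · simp only [goodTrees, Finset.mem_filter, Finset.mem_univ, hI, false_and, and_false, if_false]
      linarith
  refine (Finset.sum_le_sum fun ω _ => h2 ω).trans ?_
  rw [Finset.sum_add_distrib, ← Finset.sum_mul]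
  refine add_le_add (sum_lik_not_inj_le h.adm rfl h.q_nonneg h.q_le t y r) ?_
  rw [mul_one_div]
  exact div_le_div_of_nonneg_right
    (sum_lik_card_names_le h.adm rfl hd0 h.q_nonneg h.q_le t y) hK'.le

theorem badError_nonneg (h : Comparable n M η p q₀ D q σ) (t K : ℕ) : 0 ≤ badError n K t η := by
  have hd0 : 0 ≤ n * η := mul_nonneg (Nat.cast_nonneg _) h.adm.density_nonneg
  exact add_nonneg (div_nonneg (collisionBound_nonneg hd0 _) (Nat.cast_nonneg _))
    (div_nonneg (sizeBound_nonneg hd0 _) (Nat.cast_nonneg _))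

/-- The good trees carry almost all the tree weight, and the graph weights are close to it in total
variation; so with high probability the neighbourhood in the graph is a good tree. -/
theorem one_sub_prodExp_hitProb_le (h : Comparable n M η p q₀ D q σ) (t : ℕ) {K : ℕ} (hK : 0 < K)
    (r : Fin n) {θ : ℝ} (hθ : 0 < θ) :
    prodExp (markWeight p q₀) (fun ξ => 1 - ∑ ω ∈ goodTrees n t K r, hitProb h.adm.symm σ t ω r ξ)
      ≤ badError n K t η + closeError n K t η D θ := by
  have h1 := prodExp_sum_abs_le h t K r hθ
  have h2 : ∀ ξ : Fin n → Mark, 1 - ∑ ω ∈ goodTrees n t K r, hitProb h.adm.symm σ t ω r ξ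
      ≤ (1 - ∑ ω ∈ goodTrees n t K r, treeWeight M η σ t ω ξ r)
        + ∑ ω ∈ goodTrees n t K r, |hitProb h.adm.symm σ t ω r ξ - treeWeight M η σ t ω ξ r| := by
    intro ξ
    have h3 : ∑ ω ∈ goodTrees n t K r, treeWeight M η σ t ω ξ r
        - ∑ ω ∈ goodTrees n t K r, hitProb h.adm.symm σ t ω r ξ
        ≤ ∑ ω ∈ goodTrees n t K r, |hitProb h.adm.symm σ t ω r ξ - treeWeight M η σ t ω ξ r| := by
      rw [← Finset.sum_sub_distrib]
      refine Finset.sum_le_sum fun ω _ => ?_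
      rw [abs_sub_comm]
      exact le_abs_self _
    linarith
  refine (prodExp_mono h.markWeight_nonneg h2).trans ?_
  rw [prodExp_add, prodExp_sub, prodExp_const (sum_markWeight p q₀)]
  refine add_le_add ?_ h1
  rw [prodExp_treeWeight_sum h, ← sum_labelWeight p, ← Finset.sum_sub_distrib]
  have h4 : ∀ y, labelWeight p y - labelWeight p y * ∑ ω ∈ goodTrees n t K r, lik M η p q t ω y
      ≤ labelWeight p y * badError n K t η := by
    intro y
    rw [← mul_one_sub]
    exact mul_le_mul_of_nonneg_left (one_sub_sum_lik_le h t hK r y)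
      (labelWeight_nonneg h.adm.p_nonneg h.adm.p_le_one y)
  refine (Finset.sum_le_sum fun y _ => h4 y).trans ?_
  rw [← Finset.sum_mul, sum_labelWeight, one_mul]

/-- Tests of the unfolding of the graph perform as tests of the tree. -/
theorem abs_graph_sub_tree_le (h : Comparable n M η p q₀ D q σ) (t : ℕ) {K : ℕ} (hK : 0 < K)
    (r : Fin n) {θ : ℝ} (hθ : 0 < θ) {g : Label → ℝ} {C : ℝ} (hg : ∀ y, |g y| ≤ C)
    {f : Tree n t → ℝ} (hf : ∀ ω, |f ω| ≤ 1) :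
    |prodExp (markWeight p q₀) (fun ξ => ∑ G, graphWeight h.adm.symm ξ G *
          (g (ξ r).1 * f (unfolding G (fun t u => σ t (ξ u)) t r r)))
        - ∑ ω : Tree n t, (∑ y, labelWeight p y * g y * lik M η p q t ω y) * f ω|
      ≤ C * (2 * badError n K t η + 2 * closeError n K t η D θ) := by
  classical
  have hC : 0 ≤ C := (abs_nonneg _).trans (hg 0)
  set 𝒢 := goodTrees n t K r with h𝒢
  set A := prodExp (markWeight p q₀) (fun ξ => ∑ G, graphWeight h.adm.symm ξ G *
          (g (ξ r).1 * f (unfolding G (fun t u => σ t (ξ u)) t r r))) with hA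
  -- B restricts the graph expectation to the good trees, B' replaces graph weights by tree weights,
  -- and the last comparison restores the trees that are not good.
  set B := prodExp (markWeight p q₀) (fun ξ => g (ξ r).1 *
    ∑ ω ∈ 𝒢, hitProb h.adm.symm σ t ω r ξ * f ω) with hB
  set B' := prodExp (markWeight p q₀) (fun ξ => g (ξ r).1 *
    ∑ ω ∈ 𝒢, treeWeight M η σ t ω ξ r * f ω) with hB'
  have hAB : |A - B| ≤ C * (badError n K t η + closeError n K t η D θ) := by
    rw [hA, hB, ← prodExp_sub]
    refine (abs_prodExp_le h.markWeight_nonneg _).trans ?_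
    refine le_trans ?_ (mul_le_mul_of_nonneg_left (one_sub_prodExp_hitProb_le h t hK r hθ) hC)
    rw [← prodExp_mul_left]
    refine prodExp_mono h.markWeight_nonneg fun ξ => ?_
    have h1 : ∑ ω ∈ 𝒢, hitProb h.adm.symm σ t ω r ξ * f ω
        = ∑ G, graphWeight h.adm.symm ξ G * (f (unfolding G (fun t u => σ t (ξ u)) t r r) *
          ∑ ω ∈ 𝒢, hit σ t ω r ξ G) := by
      simp only [← sum_graphWeight_mul_hit, Finset.sum_mul]
      rw [Finset.sum_comm]
      refine Finset.sum_congr rfl fun G _ => ?_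
      simp only [mul_assoc, ← Finset.mul_sum]
      rw [sum_hit_mul]
    have h2 : (1 : ℝ) - ∑ ω ∈ 𝒢, hitProb h.adm.symm σ t ω r ξ
        = ∑ G, graphWeight h.adm.symm ξ G * (1 - ∑ ω ∈ 𝒢, hit σ t ω r ξ G) := by
      rw [sum_hitProb_eq]
      simp only [mul_sub, mul_one, Finset.sum_sub_distrib, sum_graphWeight]
      rfl
    rw [h1, h2, Finset.mul_sum, Finset.mul_sum, ← Finset.sum_sub_distrib]
    refine (Finset.abs_sum_le_sum_abs _ _).trans (Finset.sum_le_sum fun G _ => ?_)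
    have h3 := graphWeight_nonneg h.adm.symm h.adm.nonneg h.le_one ξ G
    have h4 : 0 ≤ 1 - ∑ ω ∈ 𝒢, hit σ t ω r ξ G := by
      have := sum_hit_le_one (σ := σ) t K r ξ G
      linarith
    set u := f (unfolding G (fun t u => σ t (ξ u)) t r r) with hu
    have h5 : graphWeight h.adm.symm ξ G * (g (ξ r).1 * u)
        - g (ξ r).1 * (graphWeight h.adm.symm ξ G * (u * ∑ ω ∈ 𝒢, hit σ t ω r ξ G))
        = (g (ξ r).1 * u) * (graphWeight h.adm.symm ξ G * (1 - ∑ ω ∈ 𝒢, hit σ t ω r ξ G)) := by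
      ring
    rw [h5, abs_mul, abs_of_nonneg (mul_nonneg h3 h4), abs_mul]
    refine mul_le_mul_of_nonneg_right ?_ (mul_nonneg h3 h4)
    calc |g (ξ r).1| * |u| ≤ C * 1 := mul_le_mul (hg _) (hf _) (abs_nonneg _) hC
      _ = C := mul_one C
  have hBB : |B - B'| ≤ C * closeError n K t η D θ := by
    rw [hB, hB', ← prodExp_sub]
    refine (abs_prodExp_le h.markWeight_nonneg _).trans ?_
    refine le_trans ?_ (mul_le_mul_of_nonneg_left (prodExp_sum_abs_le h t K r hθ) hC)
    rw [← prodExp_mul_left]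
    refine prodExp_mono h.markWeight_nonneg fun ξ => ?_
    rw [← mul_sub, ← Finset.sum_sub_distrib, abs_mul]
    refine mul_le_mul (hg _) ?_ (abs_nonneg _) hC
    refine (Finset.abs_sum_le_sum_abs _ _).trans (Finset.sum_le_sum fun ω _ => ?_)
    rw [← sub_mul, abs_mul]
    exact mul_le_of_le_one_right (abs_nonneg _) (hf ω)
  have hB'e : B' = ∑ ω ∈ 𝒢, (∑ y, labelWeight p y * g y * lik M η p q t ω y) * f ω := by
    rw [hB']
    simp only [Finset.mul_sum]
    rw [prodExp_sum]
    refine Finset.sum_congr rfl fun ω hω => ?_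
    simp only [h𝒢, goodTrees, Finset.mem_filter] at hω
    rw [← prodExp_mul_treeWeight (M := M) (η := η) (p := p) h.obs hω.2.1 g, mul_comm _ (f ω),
      ← prodExp_mul_left]
    congr 1
    ext ξ
    ring
  have hBC : |B' - ∑ ω : Tree n t, (∑ y, labelWeight p y * g y * lik M η p q t ω y) * f ω|
      ≤ C * badError n K t η := by
    have h1 : ∑ ω : Tree n t, (∑ y, labelWeight p y * g y * lik M η p q t ω y) * f ω - B'
        = ∑ ω ∈ 𝒢ᶜ, (∑ y, labelWeight p y * g y * lik M η p q t ω y) * f ω := by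
      rw [hB'e, ← Finset.sum_add_sum_compl 𝒢]; ring
    rw [abs_sub_comm, h1]
    refine (Finset.abs_sum_le_sum_abs _ _).trans ?_
    have h2 : ∀ ω : Tree n t, |(∑ y, labelWeight p y * g y * lik M η p q t ω y) * f ω|
        ≤ C * ∑ y, labelWeight p y * lik M η p q t ω y := by
      intro ω
      rw [abs_mul]
      refine (mul_le_of_le_one_right (abs_nonneg _) (hf ω)).trans ?_
      refine (Finset.abs_sum_le_sum_abs _ _).trans ?_
      rw [Finset.mul_sum]
      refine Finset.sum_le_sum fun y _ => ?_
      have h3 := labelWeight_nonneg h.adm.p_nonneg h.adm.p_le_one y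
      have h4 := h.lik_nonneg t ω y
      rw [abs_mul, abs_mul, abs_of_nonneg h3, abs_of_nonneg h4]
      calc _ = labelWeight p y * lik M η p q t ω y * |g y| := by ring
        _ ≤ labelWeight p y * lik M η p q t ω y * C :=
          mul_le_mul_of_nonneg_left (hg y) (mul_nonneg h3 h4)
        _ = _ := by ring
    refine (Finset.sum_le_sum fun ω _ => h2 ω).trans ?_
    rw [← Finset.mul_sum]
    refine mul_le_mul_of_nonneg_left ?_ hC
    rw [Finset.sum_comm]
    simp only [← Finset.mul_sum]
    have h5 : ∀ y, ∑ ω ∈ 𝒢ᶜ, lik M η p q t ω y ≤ badError n K t η := by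
      intro y
      have h6 := one_sub_sum_lik_le h t hK r y
      have h7 := sum_lik (n := n) (q := q) h.adm.sum_eq t y
      rw [← Finset.sum_add_sum_compl 𝒢] at h7
      linarith
    calc _ ≤ ∑ y, labelWeight p y * badError n K t η := Finset.sum_le_sum fun y _ =>
          mul_le_mul_of_nonneg_left (h5 y) (labelWeight_nonneg h.adm.p_nonneg h.adm.p_le_one y)
      _ = _ := by rw [← Finset.sum_mul, sum_labelWeight, one_mul]
  set E := ∑ ω : Tree n t, (∑ y, labelWeight p y * g y * lik M η p q t ω y) * f ω with hE
  have h1 : A - E = (A - B) + (B - B') + (B' - E) := by ring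
  rw [h1]
  refine (abs_add_three _ _ _).trans ?_
  linarith


/-! ### Conditional independence given the labels at the bottom of the tree. -/

section Leaves

variable {n : ℕ} {M : Matrix Label Label ℝ} {η : ℝ} (σ : ℕ → Mark → Option Label)

/-- The observations at height zero are those of the marks. -/
def LeafMatch : ∀ t, Tree n t → (Fin n → Mark) → Prop
  | 0, _, _ => True
  | 1, ω, ξ => ∀ u z, ω u = some z → σ 0 (ξ u) = z.1
  | t + 2, ω, ξ => ∀ u z, ω u = some z → LeafMatch (t + 1) z.2 ξ

variable {σ}

theorem LeafMatch.congr {t : ℕ} {ω : Tree n t} {r : Fin n} (hω : Inj t ω r) {ξ ξ' : Fin n → Mark}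
    (h : ∀ v ∈ names t ω \ interior t ω r, ξ v = ξ' v) (hξ : LeafMatch σ t ω ξ) :
    LeafMatch σ t ω ξ' := by
  induction t generalizing r with
  | zero => trivial
  | succ t ih =>
    cases t with
    | zero =>
      intro u z hu
      rw [← hξ u z hu, h u]
      rw [Finset.mem_sdiff, mem_interior_succ]
      refine ⟨mem_names_succ.2 ⟨u, z, hu, by simp⟩, ?_⟩
      rintro (h | ⟨_, _, _, h⟩)
      · exact (hω.1 u z hu).1 h
      · simp [interior] at h
    | succ t =>
      intro u z hu
      refine ih (hω.1 u z hu).2.2.2 (fun v hv => h v ?_) (hξ u z hu)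
      rw [Finset.mem_sdiff] at hv ⊢
      refine ⟨mem_names_succ.2 ⟨u, z, hu, Finset.mem_insert_of_mem hv.1⟩, fun hv' => ?_⟩
      rcases mem_interior_succ.1 hv' with rfl | ⟨u', z', hu', hv'⟩
      · exact (hω.1 u z hu).2.2.1 hv.1
      · by_cases huu : u = u'
        · subst huu
          rw [hu] at hu'
          cases hu'
          exact hv.2 hv'
        · exact Finset.disjoint_left.1 (hω.2 u z u' z' hu hu' huu)
            (Finset.mem_insert_of_mem hv.1) (interior_subset _ _ hv')

theorem LeafMatch.of_treeWeight_ne_zero {t : ℕ} {ω : Tree n t} {r : Fin n} {ξ : Fin n → Mark}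
    (h : treeWeight M η σ t ω ξ r ≠ 0) : LeafMatch σ t ω ξ := by
  induction t generalizing r with
  | zero => trivial
  | succ t ih =>
    have hu : ∀ u z, ω u = some z →
        σ t (ξ u) = z.1 ∧ treeWeight M η σ t z.2 ξ u ≠ 0 := by
      intro u z hu
      have h1 := Finset.prod_ne_zero_iff.1 h u (Finset.mem_univ u)
      simp only [hu, Option.elim, mul_ne_zero_iff, ne_eq, ite_eq_right_iff, one_ne_zero,
        imp_false, not_not] at h1
      exact ⟨h1.1.2, h1.2⟩
    cases t with
    | zero => exact fun u z h' => (hu u z h').1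
    | succ t => exact fun u z h' => ih (hu u z h').2

/-- A leaf enters the weight only through its label, and by `hσ` this label is written on the tree;
so all marks consistent with the leaves that agree at positive height give the same weight. -/
theorem treeWeight_congr_of_leafMatch (hσ : ∀ m, σ 0 m = some m.1) {t : ℕ} {ω : Tree n t}
    {r : Fin n} {ξ ξ' : Fin n → Mark} (h : ∀ v ∈ interior t ω r, ξ v = ξ' v)
    (hξ : LeafMatch σ t ω ξ) (hξ' : LeafMatch σ t ω ξ') :
    treeWeight M η σ t ω ξ r = treeWeight M η σ t ω ξ' r := by
  induction t generalizing r with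
  | zero => rfl
  | succ t ih =>
    refine Finset.prod_congr rfl fun u _ => ?_
    rcases hu : ω u with _ | z
    · rfl
    · simp only [Option.elim]
      rw [h r (mem_interior_succ.2 (Or.inl rfl))]
      cases t with
      | zero =>
        have h1 := hξ u z hu
        have h2 := hξ' u z hu
        have h3 : (ξ u).1 = (ξ' u).1 := by
          rw [hσ] at h1 h2
          exact Option.some_injective _ (h1.trans h2.symm)
        rw [h1, h2, h3]
        rfl
      | succ t =>
        have hsub : ∀ v ∈ interior (t + 1) z.2 u, ξ v = ξ' v := fun v hv =>
          h v (mem_interior_succ.2 (Or.inr ⟨u, z, hu, hv⟩))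
        rw [ih hsub (hξ u z hu) (hξ' u z hu), hsub u (mem_interior_succ.2 (Or.inl rfl))]

open Classical in
/-- Given the labels of the leaves, the marks of the vertices of positive height are independent
of the remaining marks. -/
theorem prodExp_treeWeight_mul_leaf (hσ : ∀ m, σ 0 m = some m.1) (w : Mark → ℝ) {t : ℕ}
    {ω : Tree n (t + 1)} {r : Fin n} (hω : Inj (t + 1) ω r) (g : Label → ℝ)
    {R : (Fin n → Mark) → ℝ}
    (hR : DependsOn R ((interior (t + 1) ω r : Finset (Fin n)) : Set (Fin n))ᶜ) :
    prodExp w (fun ξ => g (ξ r).1 * treeWeight M η σ (t + 1) ω ξ r * R ξ) *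
        prodExp w (fun ξ => if LeafMatch σ (t + 1) ω ξ then 1 else 0)
      = prodExp w (fun ξ => g (ξ r).1 * treeWeight M η σ (t + 1) ω ξ r) *
        prodExp w (fun ξ => (if LeafMatch σ (t + 1) ω ξ then 1 else 0) * R ξ) := by
  set I := interior (t + 1) ω r with hI
  -- Exchange the marks of positive height between two independent samples. The tree weight then
  -- combines the inside of ξ with leaves of ξ' that carry the same labels, while R keeps its own
  -- outside. The positive height t + 1 puts the root among the exchanged vertices.
  refine prodExp_mul_prodExp_swap w I fun ξ ξ' => ?_
  have hr : r ∈ I := mem_interior_succ.2 (Or.inl rfl)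
  have hL : ∀ a b : Fin n → Mark, LeafMatch σ (t + 1) ω (I.piecewise a b)
      ↔ LeafMatch σ (t + 1) ω b := by
    intro a b
    have h1 : ∀ v ∈ names (t + 1) ω \ interior (t + 1) ω r, I.piecewise a b v = b v := by
      intro v hv
      exact Finset.piecewise_eq_of_notMem _ _ _ (Finset.mem_sdiff.1 hv).2
    exact ⟨fun h => h.congr hω h1, fun h => h.congr hω fun v hv => (h1 v hv).symm⟩
  have hRe : R (I.piecewise ξ' ξ) = R ξ :=
    hR fun v hv => Finset.piecewise_eq_of_notMem _ _ _ (by simpa using hv)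
  have hg : (I.piecewise ξ ξ') r = ξ r := Finset.piecewise_eq_of_mem _ _ _ hr
  simp only [hL, hRe, hg]
  by_cases h1 : LeafMatch σ (t + 1) ω ξ
  · by_cases h2 : LeafMatch σ (t + 1) ω ξ'
    · rw [if_pos h1, if_pos h2, treeWeight_congr_of_leafMatch hσ (ξ := I.piecewise ξ ξ') (ξ' := ξ)
        (fun v hv => Finset.piecewise_eq_of_mem _ _ _ hv) ((hL _ _).2 h2) h1]
      ring
    · have h3 : treeWeight M η σ (t + 1) ω (I.piecewise ξ ξ') r = 0 := by
        by_contra h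
        exact h2 ((hL _ _).1 (LeafMatch.of_treeWeight_ne_zero h))
      simp [h2, h3]
  · have h3 : treeWeight M η σ (t + 1) ω ξ r = 0 := by
      by_contra h
      exact h1 (LeafMatch.of_treeWeight_ne_zero h)
    simp [h1, h3]

end Leaves

/-! ### No test of the whole graph beats the tree with known bottom labels. -/

section UpperBound

variable {n : ℕ} {M : Matrix Label Label ℝ} {η p q₀ D : ℝ} {q : ℕ → ℝ}
  {σ : ℕ → Mark → Option Label}

-- By conditional independence each graph G contributes the tree mean m times a nonnegative weight
-- that does not involve g, and these weights sum to one over G. Whatever f chooses, the total is at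
-- most max 0 m. If the leaf labels have probability zero, all terms vanish.
open Classical in
theorem sum_agrees_prodExp_le (h : Comparable n M η p q₀ D q σ) (hσ : ∀ m, σ 0 m = some m.1)
    {t : ℕ} {ω : Tree n (t + 1)} {r : Fin n} (hω : Inj (t + 1) ω r) (g : Label → ℝ)
    {f : SimpleGraph (Fin n) → ℝ} (hf0 : ∀ G, 0 ≤ f G) (hf1 : ∀ G, f G ≤ 1) :
    ∑ G, f G * prodExp (markWeight p q₀) (fun ξ => g (ξ r).1 * treeWeight M η σ (t + 1) ω ξ r *
        (if Agrees G (t + 1) ω r then restWeight h.adm.symm (t + 1) ω r G ξ else 0))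
      ≤ max 0 (∑ y, labelWeight p y * g y * lik M η p q (t + 1) ω y) := by
  rw [← prodExp_mul_treeWeight (M := M) (η := η) (p := p) h.obs hω g]
  set w := markWeight p q₀ with hw
  set c := prodExp w (fun ξ : Fin n → Mark => if LeafMatch σ (t + 1) ω ξ then (1 : ℝ) else 0) with hc
  set m := prodExp w (fun ξ : Fin n → Mark => g (ξ r).1 * treeWeight M η σ (t + 1) ω ξ r) with hm
  have hc0 : 0 ≤ c := prodExp_nonneg h.markWeight_nonneg fun ξ => by split_ifs <;> norm_num
  let R : SimpleGraph (Fin n) → (Fin n → Mark) → ℝ := fun G ξ =>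
    if Agrees G (t + 1) ω r then restWeight h.adm.symm (t + 1) ω r G ξ else 0
  have hR : ∀ G, DependsOn (R G) ((interior (t + 1) ω r : Finset (Fin n)) : Set (Fin n))ᶜ := by
    intro G ξ ξ' hξ
    simp only [R]
    rw [restWeight_dependsOn h.adm.symm (t + 1) ω r G hξ]
  have hR0 : ∀ G ξ, 0 ≤ R G ξ := by
    intro G ξ
    simp only [R]
    split_ifs
    · exact restWeight_nonneg _ h.adm.nonneg h.le_one _ _ _ _ _
    · exact le_rfl
  have key : ∀ G, prodExp w (fun ξ => g (ξ r).1 * treeWeight M η σ (t + 1) ω ξ r * R G ξ) * c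
      = m * prodExp w (fun ξ => (if LeafMatch σ (t + 1) ω ξ then 1 else 0) * R G ξ) := fun G =>
    prodExp_treeWeight_mul_leaf hσ w hω g (hR G)
  change ∑ G, f G * prodExp w (fun ξ => g (ξ r).1 * treeWeight M η σ (t + 1) ω ξ r * R G ξ)
    ≤ max 0 m
  rcases hc0.eq_or_lt with hc' | hc'
  · have hzero : ∀ φ : (Fin n → Mark) → ℝ,
        prodExp w (fun ξ => g (ξ r).1 * treeWeight M η σ (t + 1) ω ξ r * φ ξ) = 0 := by
      intro φ
      rw [hc, prodExp_eq] at hc'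
      have h1 := (Finset.sum_eq_zero_iff_of_nonneg (fun ξ _ => mul_nonneg
        (Finset.prod_nonneg fun i _ => h.markWeight_nonneg _)
        (by split_ifs <;> norm_num))).1 hc'.symm
      rw [prodExp_eq]
      refine Finset.sum_eq_zero fun ξ hξ => ?_
      have h2 := h1 ξ hξ
      by_cases h3 : treeWeight M η σ (t + 1) ω ξ r = 0
      · rw [h3]; ring
      · rw [if_pos (LeafMatch.of_treeWeight_ne_zero h3), mul_one] at h2
        rw [h2, zero_mul]
    rw [Finset.sum_eq_zero fun G _ => by rw [hzero, mul_zero]]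
    exact le_max_left _ _
  · have h1 : ∀ G, f G * prodExp w (fun ξ => g (ξ r).1 * treeWeight M η σ (t + 1) ω ξ r * R G ξ)
        ≤ max 0 m * (prodExp w (fun ξ => (if LeafMatch σ (t + 1) ω ξ then 1 else 0) * R G ξ) / c) := by
      intro G
      have h2 : prodExp w (fun ξ => g (ξ r).1 * treeWeight M η σ (t + 1) ω ξ r * R G ξ)
          = m * (prodExp w (fun ξ => (if LeafMatch σ (t + 1) ω ξ then 1 else 0) * R G ξ) / c) := by
        rw [← mul_div_assoc, ← key G, mul_div_cancel_right₀ _ hc'.ne']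
      rw [h2]
      have h3 : 0 ≤ prodExp w (fun ξ => (if LeafMatch σ (t + 1) ω ξ then 1 else 0) * R G ξ) / c := by
        refine div_nonneg (prodExp_nonneg h.markWeight_nonneg fun ξ => mul_nonneg ?_ (hR0 G ξ)) hc0
        split_ifs <;> norm_num
      rw [← mul_assoc]
      refine mul_le_mul_of_nonneg_right ?_ h3
      calc f G * m ≤ f G * max 0 m := mul_le_mul_of_nonneg_left (le_max_right _ _) (hf0 G)
        _ ≤ 1 * max 0 m := mul_le_mul_of_nonneg_right (hf1 G) (le_max_left _ _)
        _ = max 0 m := one_mul _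
    refine (Finset.sum_le_sum fun G _ => h1 G).trans (le_of_eq ?_)
    rw [← Finset.mul_sum, ← Finset.sum_div, ← prodExp_sum]
    simp only [← Finset.mul_sum]
    have h4 : ∀ ξ : Fin n → Mark, ∑ G, R G ξ = 1 := fun ξ =>
      sum_restWeight h.adm.symm (t + 1) ω r ξ
    simp only [h4, mul_one]
    rw [← hc, div_self hc'.ne', mul_one]

/-- A test of the graph is not better than the tests of the tree, when all the labels at height zero
are observed on the tree. -/
theorem graph_le_tree (h : Comparable n M η p q₀ D q σ) (hσ : ∀ m, σ 0 m = some m.1) (t : ℕ) {K : ℕ}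
    (hK : 0 < K) (r : Fin n) {θ : ℝ} (hθ : 0 < θ) {g : Label → ℝ} {C : ℝ} (hg : ∀ y, |g y| ≤ C)
    {f : SimpleGraph (Fin n) → ℝ} (hf0 : ∀ G, 0 ≤ f G) (hf1 : ∀ G, f G ≤ 1) :
    prodExp (markWeight p q₀) (fun ξ => ∑ G, graphWeight h.adm.symm ξ G * (g (ξ r).1 * f G))
      ≤ ∑ ω : Tree n (t + 1), max 0 (∑ y, labelWeight p y * g y * lik M η p q (t + 1) ω y)
        + C * (badError n K (t + 1) η + 2 * closeError n K (t + 1) η D θ) := by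
  classical
  have hC : 0 ≤ C := (abs_nonneg _).trans (hg 0)
  set 𝒢 := goodTrees n (t + 1) K r with h𝒢
  set w := markWeight p q₀ with hw
  let R : Tree n (t + 1) → SimpleGraph (Fin n) → (Fin n → Mark) → ℝ := fun ω G ξ =>
    if Agrees G (t + 1) ω r then restWeight h.adm.symm (t + 1) ω r G ξ else 0
  have hR0 : ∀ ω G ξ, 0 ≤ R ω G ξ := by
    intro ω G ξ
    simp only [R]
    split_ifs
    · exact restWeight_nonneg _ h.adm.nonneg h.le_one _ _ _ _ _
    · exact le_rfl
  have hRsum : ∀ ω ξ, ∑ G, R ω G ξ = 1 := fun ω ξ => sum_restWeight h.adm.symm (t + 1) ω r ξ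
  -- The graphs that hit no good tree are bounded trivially. On the others the weight splits into
  -- `hitProb` times the rest `R`, and `hitProb` is replaced by `treeWeight` at the cost of their
  -- distance; `R` sums to one over the graphs.
  have hpt : ∀ ξ : Fin n → Mark, ∑ G, graphWeight h.adm.symm ξ G * (g (ξ r).1 * f G)
      ≤ (∑ ω ∈ 𝒢, ∑ G, f G * (g (ξ r).1 * treeWeight M η σ (t + 1) ω ξ r * R ω G ξ))
        + (C * (1 - ∑ ω ∈ 𝒢, hitProb h.adm.symm σ (t + 1) ω r ξ)
        + C * ∑ ω ∈ 𝒢, |hitProb h.adm.symm σ (t + 1) ω r ξ - treeWeight M η σ (t + 1) ω ξ r|) := by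
    intro ξ
    have e1 : ∑ G, graphWeight h.adm.symm ξ G * (g (ξ r).1 * f G)
        = ∑ G, (g (ξ r).1 * f G) * (graphWeight h.adm.symm ξ G *
            (1 - ∑ ω ∈ 𝒢, hit σ (t + 1) ω r ξ G))
          + ∑ G, ∑ ω ∈ 𝒢, (g (ξ r).1 * f G) * (hitProb h.adm.symm σ (t + 1) ω r ξ * R ω G ξ) := by
      rw [← Finset.sum_add_distrib]
      refine Finset.sum_congr rfl fun G _ => ?_
      have : ∑ ω ∈ 𝒢, (g (ξ r).1 * f G) * (hitProb h.adm.symm σ (t + 1) ω r ξ * R ω G ξ)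
          = (g (ξ r).1 * f G) * (graphWeight h.adm.symm ξ G * ∑ ω ∈ 𝒢, hit σ (t + 1) ω r ξ G) := by
        rw [Finset.mul_sum, Finset.mul_sum]
        exact Finset.sum_congr rfl fun ω _ => by rw [graphWeight_mul_hit]
      rw [this]
      ring
    have hgf : ∀ G, |g (ξ r).1 * f G| ≤ C := by
      intro G
      rw [abs_mul, abs_of_nonneg (hf0 G)]
      exact (mul_le_of_le_one_right (abs_nonneg _) (hf1 G)).trans (hg _)
    have e2 : ∑ G, (g (ξ r).1 * f G) * (graphWeight h.adm.symm ξ G *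
            (1 - ∑ ω ∈ 𝒢, hit σ (t + 1) ω r ξ G))
        ≤ C * (1 - ∑ ω ∈ 𝒢, hitProb h.adm.symm σ (t + 1) ω r ξ) := by
      have h2 : (1 : ℝ) - ∑ ω ∈ 𝒢, hitProb h.adm.symm σ (t + 1) ω r ξ
          = ∑ G, graphWeight h.adm.symm ξ G * (1 - ∑ ω ∈ 𝒢, hit σ (t + 1) ω r ξ G) := by
        rw [sum_hitProb_eq]
        simp only [mul_sub, mul_one, Finset.sum_sub_distrib, sum_graphWeight]
        rfl
      rw [h2, Finset.mul_sum]
      refine Finset.sum_le_sum fun G _ => mul_le_mul_of_nonneg_right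
        ((le_abs_self _).trans (hgf G)) (mul_nonneg
          (graphWeight_nonneg h.adm.symm h.adm.nonneg h.le_one ξ G) ?_)
      have := sum_hit_le_one (σ := σ) (t + 1) K r ξ G
      linarith
    have e3 : ∑ G, ∑ ω ∈ 𝒢, (g (ξ r).1 * f G) * (hitProb h.adm.symm σ (t + 1) ω r ξ * R ω G ξ)
        ≤ (∑ ω ∈ 𝒢, ∑ G, f G * (g (ξ r).1 * treeWeight M η σ (t + 1) ω ξ r * R ω G ξ))
          + C * ∑ ω ∈ 𝒢, |hitProb h.adm.symm σ (t + 1) ω r ξ - treeWeight M η σ (t + 1) ω ξ r| := by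
      rw [Finset.sum_comm, Finset.mul_sum, ← Finset.sum_add_distrib]
      refine Finset.sum_le_sum fun ω _ => ?_
      rw [← mul_one (C * _), ← hRsum ω ξ, Finset.mul_sum, ← Finset.sum_add_distrib]
      refine Finset.sum_le_sum fun G _ => ?_
      have e4 : (g (ξ r).1 * f G) * (hitProb h.adm.symm σ (t + 1) ω r ξ * R ω G ξ)
          = f G * (g (ξ r).1 * treeWeight M η σ (t + 1) ω ξ r * R ω G ξ)
            + (g (ξ r).1 * f G) * (hitProb h.adm.symm σ (t + 1) ω r ξ
              - treeWeight M η σ (t + 1) ω ξ r) * R ω G ξ := by ring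
      rw [e4]
      refine add_le_add le_rfl (mul_le_mul_of_nonneg_right ?_ (hR0 ω G ξ))
      refine (le_abs_self _).trans ?_
      rw [abs_mul]
      exact mul_le_mul_of_nonneg_right (hgf G) (abs_nonneg _)
    rw [e1]
    linarith
  refine (prodExp_mono h.markWeight_nonneg hpt).trans ?_
  rw [prodExp_add, prodExp_add, prodExp_mul_left, prodExp_mul_left]
  have h1 := mul_le_mul_of_nonneg_left (one_sub_prodExp_hitProb_le h (t + 1) hK r hθ) hC
  have h2 := mul_le_mul_of_nonneg_left (prodExp_sum_abs_le h (t + 1) K r hθ) hC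
  have h3 : prodExp w (fun ξ => ∑ ω ∈ 𝒢, ∑ G,
        f G * (g (ξ r).1 * treeWeight M η σ (t + 1) ω ξ r * R ω G ξ))
      ≤ ∑ ω : Tree n (t + 1), max 0 (∑ y, labelWeight p y * g y * lik M η p q (t + 1) ω y) := by
    rw [prodExp_sum]
    refine le_trans (Finset.sum_le_sum fun ω hω => ?_)
      (Finset.sum_le_univ_sum_of_nonneg fun ω => le_max_left _ _)
    simp only [h𝒢, goodTrees, Finset.mem_filter] at hω
    rw [prodExp_sum]
    simp only [prodExp_mul_left]
    exact sum_agrees_prodExp_le h hσ hω.2.1 g hf0 hf1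
  linarith

end UpperBound


/-! ### The success probability as an expected payoff. -/

section Success

variable {n : ℕ} {M : Matrix Label Label ℝ} {p q : ℝ}

/-- The observation of a mark: its label, if it is revealed. -/
def revealed (m : Mark) : Option Label := if m.2 then some m.1 else none

/-- The outcome with given marks and graph. -/
def toOutcome (ξ : Fin n → Mark) (G : SimpleGraph (Fin n)) : Outcome n :=
  (fun i => (ξ i).1, G, Finset.univ.filter fun i => (ξ i).2 = true)

open Classical in
theorem sum_weight_mul (hM : ∀ x y, M x y = M y x) (φ : Outcome n → ℝ) :
    ∑ ω, weight M p q ω * φ ω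
      = prodExp (markWeight p q) (fun ξ => ∑ G, graphWeight hM ξ G * φ (toOutcome ξ G)) := by
  rw [prodExp_eq]
  simp only [Finset.mul_sum]
  rw [← Fintype.sum_prod_type']
  let e : (Fin n → Mark) × SimpleGraph (Fin n) ≃ Outcome n :=
    { toFun := fun z => toOutcome z.1 z.2
      invFun := fun ω => (fun i => (ω.1 i, decide (i ∈ ω.2.2)), ω.2.1)
      left_inv := by
        rintro ⟨ξ, G⟩
        simp [toOutcome]
      right_inv := by
        rintro ⟨X, G, E⟩
        simp [toOutcome] }
  symm
  refine Fintype.sum_equiv e _ _ fun z => ?_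
  obtain ⟨ξ, G⟩ := z
  simp only [e, Equiv.coe_fn_mk]
  rw [← mul_assoc]
  congr 1
  simp only [weight, sbmWeight, toOutcome, markWeight, Finset.prod_mul_distrib, graphWeight_eq]
  have : ∀ i, boolWeight q (ξ i).2 = if i ∈ Finset.univ.filter (fun i => (ξ i).2 = true)
      then q else 1 - q := by
    intro i
    simp [boolWeight]
  simp only [this]
  rw [mul_right_comm]
  congr!

theorem observed_toOutcome (ξ : Fin n → Mark) (G : SimpleGraph (Fin n)) :
    observed (toOutcome ξ G) = fun v => revealed (ξ v) := by
  funext v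
  simp [observed, toOutcome, revealed]

open Classical in
theorem prob_eq (hM : ∀ x y, M x y = M y x) (A : Set (Outcome n)) :
    prob M p q A = prodExp (markWeight p q)
      (fun ξ => ∑ G, graphWeight hM ξ G * (if toOutcome ξ G ∈ A then 1 else 0)) := by
  rw [← sum_weight_mul hM (fun ω => if ω ∈ A then 1 else 0), prob, Finset.sum_filter]
  refine Finset.sum_congr rfl fun ω _ => ?_
  split_ifs <;> simp

/-- The payoff of the guess `0`. -/
def payoff (p : ℝ) (y : Label) : ℝ := if y = 0 then 1 / p else -(1 / (1 - p))

theorem prob_label (hM : ∀ x y, M x y = M y x) (i : Fin n) (y : Label) :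
    prob M p q {ω | labels ω i = y} = labelWeight p y := by
  classical
  rw [prob_eq hM]
  trans prodExp (markWeight p q) (fun ξ : Fin n → Mark => if (ξ i).1 = y then (1 : ℝ) else 0)
  · congr 1
    ext ξ
    have : ∀ G, toOutcome ξ G ∈ {ω : Outcome n | labels ω i = y} ↔ (ξ i).1 = y := fun G => Iff.rfl
    simp only [this, ← Finset.sum_mul, sum_graphWeight, one_mul]
  rw [prodExp_apply (sum_markWeight p q) i (fun m : Mark => if m.1 = y then (1 : ℝ) else 0),
    sum_markWeight_mul]
  have h2 : ∀ y' : Label, ∑ b, boolWeight q b * (if ((y', b) : Mark).1 = y then (1 : ℝ) else 0)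
      = if y' = y then 1 else 0 := by
    intro y'
    change ∑ b, boolWeight q b * (if y' = y then (1 : ℝ) else 0) = _
    rw [← Finset.sum_mul, sum_boolWeight, one_mul]
  simp only [h2]
  simp

-- Since P(T = 1 | X = 1) - 1 = -P(T = 0 | X = 1), only the guess 0 matters; it earns 1/p when right
-- and costs 1/(1 - p) when wrong.
open Classical in
theorem condProb_add_condProb (hM : ∀ x y, M x y = M y x) (hp' : p < 1)
    (T : Test n) (i : Fin n) :
    condProb M p q {ω | T (graph ω) (observed ω) i = 0} {ω | labels ω i = 0}
      + condProb M p q {ω | T (graph ω) (observed ω) i = 1} {ω | labels ω i = 1} - 1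
      = prodExp (markWeight p q) (fun ξ => ∑ G, graphWeight hM ξ G *
          (payoff p (ξ i).1 * if T G (fun v => revealed (ξ v)) i = 0 then 1 else 0)) := by
  have hp1 : (1 : ℝ) - p ≠ 0 := by linarith
  have e0 : prob M p q {ω | labels ω i = 0} = p := by rw [prob_label hM]; simp [labelWeight]
  have e1 : prob M p q {ω | labels ω i = 1} = 1 - p := by rw [prob_label hM]; simp [labelWeight]
  have key : condProb M p q {ω | T (graph ω) (observed ω) i = 1} {ω | labels ω i = 1} - 1
      = -(1 / (1 - p)) * prob M p q ({ω | T (graph ω) (observed ω) i = 0} ∩ {ω | labels ω i = 1}) := by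
    rw [condProb, e1]
    have h2 : prob M p q ({ω | T (graph ω) (observed ω) i = 1} ∩ {ω | labels ω i = 1})
        + prob M p q ({ω | T (graph ω) (observed ω) i = 0} ∩ {ω | labels ω i = 1}) = 1 - p := by
      rw [← e1]
      unfold prob
      rw [← Finset.sum_union]
      · refine Finset.sum_congr ?_ fun _ _ => rfl
        ext ω
        simp only [Finset.mem_union, Finset.mem_filter, Finset.mem_univ, true_and, Set.mem_inter_iff,
          Set.mem_ofPred_eq]
        rcases Fin.exists_fin_two.1 ⟨T (graph ω) (observed ω) i, rfl⟩ with h | h <;> simp [h]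
      · rw [Finset.disjoint_left]
        intro ω h1 h2
        simp only [Finset.mem_filter, Finset.mem_univ, true_and, Set.mem_inter_iff,
          Set.mem_ofPred_eq] at h1 h2
        rw [h1.1] at h2
        exact one_ne_zero h2.1
    have h3 : prob M p q ({ω | T (graph ω) (observed ω) i = 1} ∩ {ω | labels ω i = 1})
        = (1 - p) - prob M p q ({ω | T (graph ω) (observed ω) i = 0} ∩ {ω | labels ω i = 1}) := by
      linarith
    rw [h3]
    field_simp
    ring
  rw [add_sub_assoc, key, condProb, e0, prob_eq hM, prob_eq hM, div_eq_inv_mul, ← one_div,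
    ← prodExp_mul_left, ← prodExp_mul_left, ← prodExp_add]
  congr 1
  ext ξ
  rw [Finset.mul_sum, Finset.mul_sum, ← Finset.sum_add_distrib]
  refine Finset.sum_congr rfl fun G _ => ?_
  have hm : ∀ y : Label, toOutcome ξ G ∈
      ({ω | T (graph ω) (observed ω) i = 0} ∩ {ω | labels ω i = y} : Set (Outcome n))
      ↔ T G (fun v => revealed (ξ v)) i = 0 ∧ (ξ i).1 = y := by
    intro y
    rw [Set.mem_inter_iff, Set.mem_ofPred_eq, Set.mem_ofPred_eq, observed_toOutcome]
    rfl
  simp only [hm, payoff]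
  rcases Fin.exists_fin_two.1 ⟨(ξ i).1, rfl⟩ with h | h
  · simp only [h, if_true]
    by_cases hT : T G (fun v => revealed (ξ v)) i = 0
    · simp [hT]; ring
    · simp [hT]
  · simp only [h]
    by_cases hT : T G (fun v => revealed (ξ v)) i = 0
    · simp [hT]; ring
    · simp [hT]

theorem abs_payoff_le (hp : 0 < p) (hp' : p < 1) (y : Label) :
    |payoff p y| ≤ 1 / p + 1 / (1 - p) := by
  have h1 : 0 < 1 / p := by positivity
  have h2 : 0 < 1 / (1 - p) := one_div_pos.2 (by linarith)
  unfold payoff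
  split_ifs
  · rw [abs_of_pos h1]; linarith
  · rw [abs_neg, abs_of_pos h2]; linarith

/-- The payoff cancels the prior. Hence on a tree the best guess depends only on the sign of the
difference of the likelihoods, and its value is `treeValue`. -/
theorem sum_labelWeight_mul_payoff (hp : 0 < p) (hp' : p < 1) (f : Label → ℝ) :
    ∑ y, labelWeight p y * payoff p y * f y = f 0 - f 1 := by
  have : (1 : ℝ) - p ≠ 0 := by linarith
  simp [labelWeight, payoff]
  field_simp
  ring

/-- The advantage of the optimal test between the laws of the tree given the label of the root. -/
def treeValue (n : ℕ) (M : Matrix Label Label ℝ) (η p : ℝ) (q : ℕ → ℝ) (t : ℕ) : ℝ :=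
  ∑ ω : Tree n t, max 0 (lik M η p q t ω 0 - lik M η p q t ω 1)

open Classical in
/-- The belief propagation test at depth `t`: it compares the likelihoods of the two labels on the
unfolding of the graph. -/
def bpTest (n : ℕ) (M : Matrix Label Label ℝ) (η p q : ℝ) (t : ℕ) : Test n := fun G Y i =>
  if lik M η p (fun _ => q) t (unfolding G (fun _ => Y) t i i) 1
    ≤ lik M η p (fun _ => q) t (unfolding G (fun _ => Y) t i i) 0 then 0 else 1

theorem isLocal_bpTest (η : ℝ) (t : ℕ) : IsLocal t (bpTest n M η p q t) := by
  intro i G G' Y Y' hball hadj hY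
  have h : unfolding G (fun _ => Y) t i i = unfolding G' (fun _ => Y') t i i :=
    unfolding_congr hball hadj hY t i i (by simp) (by simp)
  simp only [bpTest, h]

theorem observesWith_revealed : ObservesWith q (fun _ => revealed) (fun _ => q) := by
  intro t y o
  rcases o with _ | z
  · simp [boolWeight, revealed, revealWeight]
  · by_cases h : z = y
    · simp [boolWeight, revealed, revealWeight, h]
    · simp [boolWeight, revealed, revealWeight, h, Ne.symm h]

/-- The observation of the labels at height zero only. -/
def leafObs (t : ℕ) (m : Mark) : Option Label := if t = 0 then some m.1 else none

theorem observesWith_leafObs : ObservesWith q leafObs (fun t => if t = 0 then 1 else 0) := by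
  intro t y o
  have h : ∀ b : Bool, leafObs t (y, b) = if t = 0 then some y else none := fun b => rfl
  simp only [h, ← Finset.sum_mul, sum_boolWeight, one_mul]
  by_cases ht : t = 0
  · rcases o with _ | z
    · simp [ht, revealWeight]
    · simp [ht, revealWeight, eq_comm]
  · rcases o with _ | z <;> simp [ht, revealWeight]

end Success


/-! ### The limit of large graphs at fixed degree. -/

section GraphToTree

/-- The order of choices matters: K large makes the Markov term small, then θ small depending on K
controls the exponential, and all other terms vanish as n tends to infinity. -/
theorem exists_error_le {d κ C ε : ℝ} (hd : 0 < d) (hC : 0 ≤ C) (hε : 0 < ε) (t : ℕ) :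
    ∃ K : ℕ, 0 < K ∧ ∃ θ : ℝ, 0 < θ ∧ ∀ᶠ n : ℕ in atTop,
      C * (2 * badError n K t (d / n) + 2 * closeError n K t (d / n) (κ * d / n) θ) ≤ ε := by
  set B := sizeBound d t with hB
  have hB0 : 0 ≤ B := sizeBound_nonneg hd.le t
  obtain ⟨K, hK⟩ := exists_nat_gt (8 * C * B / ε)
  have hK1 : (0 : ℝ) < K + 1 := by positivity
  have hbad : C * (2 * (B / (K + 1 : ℕ))) < ε / 2 := by
    push_cast
    rw [div_lt_iff₀ hε] at hK
    rw [← mul_div_assoc, ← mul_div_assoc, div_lt_iff₀ hK1]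
    nlinarith [mul_nonneg hC hB0]
  have hexp : Tendsto (fun θ : ℝ => C * (2 * (Real.exp ((K + 1 : ℕ) * θ) - 1))) (𝓝[>] 0) (𝓝 0) := by
    have : Continuous fun θ : ℝ => C * (2 * (Real.exp ((K + 1 : ℕ) * θ) - 1)) := by fun_prop
    have h := this.tendsto 0
    simp only [mul_zero, Real.exp_zero, sub_self] at h
    exact h.mono_left nhdsWithin_le_nhds
  obtain ⟨θ, hθ1, hθ⟩ := ((hexp.eventually (gt_mem_nhds (half_pos hε))).and
    self_mem_nhdsWithin).exists
  refine ⟨K + 1, Nat.succ_pos K, θ, hθ, ?_⟩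
  have hlim : Tendsto (fun n : ℕ => C * (2 * (collisionBound d t / n + B / (K + 1 : ℕ))
      + 2 * ((Real.exp ((K + 1 : ℕ) * (θ + (K + 1 : ℕ) * (κ * d / n) + 2 * d * (d / n)
        + 2 * (κ * d) * (κ * d / n) + d / n)) - 1)
        + (1 + growth (κ * d) t) * (2 * (κ * d) * (κ * d / n) / θ ^ 2)))) atTop
      (𝓝 (C * (2 * (0 + B / (K + 1 : ℕ)) + 2 * ((Real.exp ((K + 1 : ℕ) * (θ + (K + 1 : ℕ) * 0
        + 2 * d * 0 + 2 * (κ * d) * 0 + 0)) - 1)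
        + (1 + growth (κ * d) t) * (2 * (κ * d) * 0 / θ ^ 2))))) := by
    have hc : ∀ c : ℝ, Tendsto (fun n : ℕ => c / (n : ℝ)) atTop (𝓝 0) := fun c =>
      tendsto_const_div_atTop_nhds_zero_nat c
    refine Tendsto.const_mul _ (Tendsto.add (((hc _).add_const _).const_mul _)
      (Tendsto.const_mul _ (Tendsto.add (Tendsto.sub_const ?_ _) (Tendsto.const_mul _
        (((hc _).const_mul _).div_const _)))))
    refine (Real.continuous_exp.tendsto _).comp (Tendsto.const_mul _ ?_)
    exact ((((hc _).const_mul _).const_add _).add ((hc _).const_mul _)).add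
      ((hc _).const_mul _) |>.add (hc _)
  have hlt : C * (2 * (0 + B / (K + 1 : ℕ)) + 2 * ((Real.exp ((K + 1 : ℕ) * (θ + (K + 1 : ℕ) * 0
        + 2 * d * 0 + 2 * (κ * d) * 0 + 0)) - 1)
        + (1 + growth (κ * d) t) * (2 * (κ * d) * 0 / θ ^ 2))) < ε := by
    simp only [mul_zero, zero_add, add_zero, zero_div]
    linarith
  filter_upwards [hlim.eventually (gt_mem_nhds hlt), eventually_gt_atTop 0] with n hn hn0
  refine le_trans (le_of_eq ?_) hn.le
  have hn' : (n : ℝ) ≠ 0 := by positivity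
  have e1 : (n : ℝ) * (d / n) = d := by field_simp
  have e2 : (n : ℝ) * (κ * d / n) = κ * d := by field_simp
  have e3 : 2 * (n : ℝ) * (κ * d / n) ^ 2 = 2 * (κ * d) * (κ * d / n) := by field_simp
  rw [badError, closeError, e1, e2, e3]

variable {a b c d p : ℝ}

/-- A bound for the entries of the rescaled connectivity matrix. -/
def maxEntry (a b c : ℝ) : ℝ := max a (max b c)

theorem eventually_comparable (ha : 0 ≤ a) (hb : 0 ≤ b) (hc : 0 ≤ c) (hd : 0 < d) (hp : 0 ≤ p)
    (hp' : p ≤ 1) (h1 : p * a + (1 - p) * b = 1) (h2 : p * b + (1 - p) * c = 1) {q₀ : ℝ}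
    {q : ℕ → ℝ} {σ : ℕ → Mark → Option Label} (hq₀ : 0 ≤ q₀) (hq₀' : q₀ ≤ 1) (hq : ∀ t, 0 ≤ q t)
    (hq' : ∀ t, q t ≤ 1) (hσ : ObservesWith q₀ σ q) :
    ∀ᶠ n : ℕ in atTop, Comparable n (connectivity a b c d n) (d / n) p q₀
      (maxEntry a b c * d / n) q σ := by
  have hlim : ∀ r : ℝ, ∀ᶠ n : ℕ in atTop, r / (n : ℝ) ≤ 1 / 2 := fun r =>
    (tendsto_const_div_atTop_nhds_zero_nat r).eventually (ge_mem_nhds (by norm_num))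
  filter_upwards [hlim d, hlim (maxEntry a b c * d)] with n hn1 hn2
  have hdn : 0 ≤ d / n := by positivity
  refine ⟨⟨hp, hp', ?_, ?_, ?_, by linarith⟩, ?_, hn2, hn1, hq₀, hq₀', hq, hq', hσ⟩
  · intro x y
    fin_cases x <;> fin_cases y <;> simp [connectivity] <;> positivity
  · intro x y
    fin_cases x <;> fin_cases y <;> simp [connectivity]
  · intro x
    fin_cases x
    · simp [connectivity, labelWeight]
      linear_combination (d / n) * h1
    · simp [connectivity, labelWeight]
      linear_combination (d / n) * h2
  · have e : maxEntry a b c * d / n = d / n * maxEntry a b c := by ring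
    intro x y
    rw [e]
    have ka : a ≤ maxEntry a b c := le_max_left _ _
    have kb : b ≤ maxEntry a b c := (le_max_left _ _).trans (le_max_right _ _)
    have kc : c ≤ maxEntry a b c := (le_max_right _ _).trans (le_max_right _ _)
    fin_cases x <;> fin_cases y <;> simp [connectivity] <;>
      exact mul_le_mul_of_nonneg_left ‹_› hdn

/-- In the limit of large graphs belief propagation on the graph performs as on the tree. -/
theorem tendsto_successProb_bpTest (ha : 0 ≤ a) (hb : 0 ≤ b) (hc : 0 ≤ c) (hd : 0 < d) (hp : 0 < p)
    (hp' : p < 1) (h1 : p * a + (1 - p) * b = 1) (h2 : p * b + (1 - p) * c = 1) {q : ℝ}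
    (hq : 0 ≤ q) (hq' : q ≤ 1) (t : ℕ) :
    Tendsto (fun n : ℕ => successProb (connectivity a b c d n) p q
        (bpTest n (connectivity a b c d n) (d / n) p q t)
      - treeValue n (connectivity a b c d n) (d / n) p (fun _ => q) t) atTop (𝓝 0) := by
  classical
  rw [Metric.tendsto_atTop']
  intro ε hε
  have hC : 0 ≤ 1 / p + 1 / (1 - p) := by
    have : 0 < 1 - p := by linarith
    positivity
  obtain ⟨K, hK, θ, hθ, hev⟩ := exists_error_le (κ := maxEntry a b c) hd hC (half_pos hε) t
  have hcomp := eventually_comparable ha hb hc hd hp.le hp'.le h1 h2 hq hq' (fun _ => hq)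
    (fun _ => hq') observesWith_revealed
  obtain ⟨N, hN⟩ := eventually_atTop.1 (hev.and (hcomp.and (eventually_gt_atTop 0)))
  refine ⟨N, fun n hn => ?_⟩
  obtain ⟨hn1, hn2, hn3⟩ := hN n hn.le
  have hn' : (0 : ℝ) < n := by exact_mod_cast hn3
  rw [Real.dist_eq, sub_zero]
  refine lt_of_le_of_lt ?_ (half_lt_self hε)
  set M := connectivity a b c d n with hMdef
  set V := treeValue n M (d / n) p (fun _ => q) t with hV
  let f : Tree n t → ℝ := fun ω =>
    if lik M (d / n) p (fun _ => q) t ω 1 ≤ lik M (d / n) p (fun _ => q) t ω 0 then 1 else 0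
  have hf : ∀ ω, |f ω| ≤ 1 := by
    intro ω
    simp only [f]
    split_ifs <;> simp
  have hVf : V = ∑ ω : Tree n t, (∑ y, labelWeight p y * payoff p y
      * lik M (d / n) p (fun _ => q) t ω y) * f ω := by
    rw [hV, treeValue]
    refine Finset.sum_congr rfl fun ω _ => ?_
    rw [sum_labelWeight_mul_payoff hp hp']
    simp only [f]
    split_ifs with h
    · rw [max_eq_right (by linarith), mul_one]
    · rw [max_eq_left (by linarith), mul_zero]
  have hi : ∀ i : Fin n, |(condProb M p q {ω | bpTest n M (d / n) p q t (graph ω) (observed ω) i = 0}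
        {ω | labels ω i = 0}
      + condProb M p q {ω | bpTest n M (d / n) p q t (graph ω) (observed ω) i = 1}
        {ω | labels ω i = 1} - 1) - V| ≤ ε / 2 := by
    intro i
    rw [condProb_add_condProb hn2.adm.symm hp' _ i, hVf]
    refine le_trans (le_of_eq ?_) ((abs_graph_sub_tree_le hn2 t hK i hθ
      (fun y => abs_payoff_le hp hp' y) hf).trans hn1)
    congr 3
    ext ξ
    refine Finset.sum_congr rfl fun G _ => ?_
    congr 2
    simp only [bpTest, f]
    by_cases h : lik M (d / n) p (fun _ => q) t (unfolding G (fun _ v => revealed (ξ v)) t i i) 1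
      ≤ lik M (d / n) p (fun _ => q) t (unfolding G (fun _ v => revealed (ξ v)) t i i) 0 <;> simp [h]
  have hsum : successProb M p q (bpTest n M (d / n) p q t) - V
      = (1 / (n : ℝ)) * ∑ i : Fin n, ((condProb M p q
        {ω | bpTest n M (d / n) p q t (graph ω) (observed ω) i = 0} {ω | labels ω i = 0}
      + condProb M p q {ω | bpTest n M (d / n) p q t (graph ω) (observed ω) i = 1}
        {ω | labels ω i = 1} - 1) - V) := by
    rw [Finset.sum_sub_distrib, mul_sub, successProb]
    congr 1
    simp only [Finset.sum_const, Finset.card_univ, Fintype.card_fin, nsmul_eq_mul]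
    field_simp
  rw [hsum, abs_mul, abs_of_pos (by positivity)]
  calc _ ≤ 1 / (n : ℝ) * ∑ _i : Fin n, ε / 2 := by
        refine mul_le_mul_of_nonneg_left ?_ (by positivity)
        exact (Finset.abs_sum_le_sum_abs _ _).trans (Finset.sum_le_sum fun i _ => hi i)
    _ = ε / 2 := by
        simp only [Finset.sum_const, Finset.card_univ, Fintype.card_fin, nsmul_eq_mul]
        field_simp

/-- In the limit of large graphs no test of the graph is better than the tests of the tree that see
the labels at height zero. -/
theorem eventually_successProb_optTest_le (ha : 0 ≤ a) (hb : 0 ≤ b) (hc : 0 ≤ c) (hd : 0 < d)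
    (hp : 0 < p) (hp' : p < 1) (h1 : p * a + (1 - p) * b = 1) (h2 : p * b + (1 - p) * c = 1) (t : ℕ)
    {ε : ℝ} (hε : 0 < ε) :
    ∀ᶠ n : ℕ in atTop, successProb (n := n) (connectivity a b c d n) p 0 (optTest (connectivity a b c d n) p)
      ≤ treeValue n (connectivity a b c d n) (d / n) p (fun s => if s = 0 then 1 else 0) (t + 1)
        + ε := by
  classical
  have hC : 0 ≤ 1 / p + 1 / (1 - p) := by
    have : 0 < 1 - p := by linarith
    positivity
  obtain ⟨K, hK, θ, hθ, hev⟩ := exists_error_le (κ := maxEntry a b c) hd hC hε (t + 1)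
  have hcomp := eventually_comparable (q := fun s => if s = 0 then 1 else 0) ha hb hc hd hp.le hp'.le
    h1 h2 le_rfl zero_le_one (fun s => by split_ifs <;> norm_num)
    (fun s => by split_ifs <;> norm_num) observesWith_leafObs
  filter_upwards [hev, hcomp, eventually_gt_atTop 0] with n hn1 hn2 hn3
  have hn' : (0 : ℝ) < n := by exact_mod_cast hn3
  set M := connectivity a b c d n with hMdef
  set V := treeValue n M (d / n) p (fun s => if s = 0 then 1 else 0) (t + 1) with hV
  have hi : ∀ i : Fin n, (condProb M p 0 {ω | optTest M p (graph ω) (observed ω) i = 0}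
        {ω | labels ω i = 0}
      + condProb M p 0 {ω | optTest M p (graph ω) (observed ω) i = 1}
        {ω | labels ω i = 1} - 1) ≤ V + ε := by
    intro i
    rw [condProb_add_condProb hn2.adm.symm hp' _ i]
    -- `leafObs` shows the bottom labels to the tree even though no label is revealed to the test.
    -- As `optTest` ignores the observations, `none` can be passed for all of them.
    have h3 := graph_le_tree hn2 (fun _ => rfl) t hK i hθ (fun y => abs_payoff_le hp hp' y)
      (f := fun G => if optTest M p G (fun _ => none) i = 0 then 1 else 0)
      (fun G => by split_ifs <;> norm_num) (fun G => by split_ifs <;> norm_num)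
    have h4 : (1 / p + 1 / (1 - p)) * (badError n K (t + 1) (d / n)
        + 2 * closeError n K (t + 1) (d / n) (maxEntry a b c * d / n) θ) ≤ ε := by
      refine le_trans (mul_le_mul_of_nonneg_left ?_ hC) hn1
      have := badError_nonneg hn2 (t + 1) K
      linarith
    have h5 : V = ∑ ω : Tree n (t + 1), max 0 (∑ y, labelWeight p y * payoff p y
        * lik M (d / n) p (fun s => if s = 0 then 1 else 0) (t + 1) ω y) := by
      rw [hV, treeValue]
      exact Finset.sum_congr rfl fun ω _ => by rw [sum_labelWeight_mul_payoff hp hp']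
    rw [h5]
    refine le_trans (le_of_eq ?_) (h3.trans (add_le_add le_rfl h4))
    rfl
  rw [successProb]
  calc _ ≤ 1 / (n : ℝ) * ∑ _i : Fin n, (V + ε) :=
        mul_le_mul_of_nonneg_left (Finset.sum_le_sum fun i _ => hi i) (by positivity)
    _ = V + ε := by
        simp only [Finset.sum_const, Finset.card_univ, Fintype.card_fin, nsmul_eq_mul]
        field_simp

end GraphToTree


/-! ### Expectations at log-normal variables of mean one. -/

section GaussianExpectation

/-- The expectation of `φ` at a log-normal variable of mean one. -/
def logNormalExp (φ : ℝ → ℝ) (μ : ℝ) : ℝ :=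
  ∫ z, φ (Real.exp (Real.sqrt μ * z - μ / 2)) ∂(gaussianReal 0 1)

theorem continuous_comp_exp {φ : ℝ → ℝ} (hφ : ContinuousOn φ (Ioi 0)) {f : ℝ → ℝ}
    (hf : Continuous f) : Continuous fun t => φ (Real.exp (f t)) :=
  hφ.comp_continuous (Real.continuous_exp.comp hf) fun _ => Real.exp_pos _

theorem gaussianReal_eq_map_standard (m : ℝ) {μ : ℝ} (hμ : 0 ≤ μ) :
    gaussianReal m μ.toNNReal = (gaussianReal 0 1).map fun z => m - Real.sqrt μ * z := by
  have h1 : gaussianReal 0 μ.toNNReal = (gaussianReal 0 1).map (Real.sqrt μ * ·) := by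
    rw [gaussianReal_map_const_mul]
    congr 1
    · simp
    · ext
      simp [Real.sq_sqrt hμ, hμ]
  have h2 := gaussianReal_map_const_sub (μ := 0) (v := μ.toNNReal) m
  rw [sub_zero] at h2
  rw [← h2, h1, Measure.map_map (by fun_prop) (by fun_prop)]
  rfl

/-- Under `N(μ/2, μ)`, the variable `e^{-x}` is log-normal of mean one. -/
theorem integral_exp_neg_gaussianReal {φ : ℝ → ℝ} (hφ : ContinuousOn φ (Ioi 0)) {μ : ℝ}
    (hμ : 0 ≤ μ) :
    ∫ x, φ (Real.exp (-x)) ∂(gaussianReal (μ / 2) μ.toNNReal) = logNormalExp φ μ := by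
  rw [gaussianReal_eq_map_standard _ hμ, integral_map (by fun_prop)
    (continuous_comp_exp hφ (by fun_prop)).aestronglyMeasurable, logNormalExp]
  simp only [neg_sub]

theorem continuous_logNormalExp {φ : ℝ → ℝ} (hφ : ContinuousOn φ (Ioi 0)) {C : ℝ}
    (hC : ∀ x, 0 < x → |φ x| ≤ C) : Continuous (logNormalExp φ) := by
  refine continuous_of_dominated (bound := fun _ => C) (fun μ => ?_) (fun μ => ?_) (by fun_prop) ?_
  · exact (continuous_comp_exp hφ (by fun_prop)).aestronglyMeasurable
  · exact Eventually.of_forall fun z => hC _ (Real.exp_pos _)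
  · exact Eventually.of_forall fun z => continuous_comp_exp hφ (by fun_prop)

theorem integrable_comp_exp {φ : ℝ → ℝ} (hφ : ContinuousOn φ (Ioi 0)) {C : ℝ}
    (hC : ∀ x, 0 < x → |φ x| ≤ C) {f : ℝ → ℝ} (hf : Continuous f) (ν : Measure ℝ)
    [IsFiniteMeasure ν] : Integrable (fun z => φ (Real.exp (f z))) ν :=
  Integrable.of_bound (continuous_comp_exp hφ hf).aestronglyMeasurable C
    (Eventually.of_forall fun _ => hC _ (Real.exp_pos _))

/-- Jensen's inequality: raising μ by s multiplies the log-normal variable by an independent one of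
mean one, through the convolution of Gaussians. `hsub` is convexity, as a supporting line at x in
the multiplicative variable y. -/
theorem logNormalExp_le {φ : ℝ → ℝ} (hφ : ContinuousOn φ (Ioi 0)) {C : ℝ}
    (hC : ∀ x, 0 < x → |φ x| ≤ C)
    (hsub : ∀ x, 0 < x → ∃ c, ∀ y, 0 < y → φ x + c * (y - 1) ≤ φ (x * y)) {μ s : ℝ} (hμ : 0 ≤ μ)
    (hs : 0 ≤ s) : logNormalExp φ μ ≤ logNormalExp φ (μ + s) := by
  have hconv : gaussianReal ((μ + s) / 2) (μ + s).toNNReal =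
      gaussianReal (μ / 2) μ.toNNReal ∗ gaussianReal (s / 2) s.toNNReal := by
    rw [gaussianReal_conv_gaussianReal, Real.toNNReal_add hμ hs]
    congr 1
    ring
  rw [← integral_exp_neg_gaussianReal hφ hμ, ← integral_exp_neg_gaussianReal hφ (add_nonneg hμ hs),
    hconv, integral_conv (integrable_comp_exp hφ hC continuous_neg _)]
  have hint : Integrable (fun x => ∫ y, φ (Real.exp (-(x + y))) ∂(gaussianReal (s / 2) s.toNNReal))
      (gaussianReal (μ / 2) μ.toNNReal) := by
    refine Integrable.of_bound (C := C) ?_ (Eventually.of_forall fun x => ?_)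
    · refine Continuous.aestronglyMeasurable ?_
      refine continuous_of_dominated (bound := fun _ => C) (fun μ => ?_) (fun μ => ?_)
        (by fun_prop) ?_
      · exact (continuous_comp_exp hφ (by fun_prop)).aestronglyMeasurable
      · exact Eventually.of_forall fun z => hC _ (Real.exp_pos _)
      · exact Eventually.of_forall fun z => continuous_comp_exp hφ (by fun_prop)
    · refine (norm_integral_le_of_norm_le_const (C := C)
        (Eventually.of_forall fun z => hC _ (Real.exp_pos _))).trans ?_
      simp
  refine integral_mono (integrable_comp_exp hφ hC continuous_neg _) hint fun x => ?_
  obtain ⟨c, hc⟩ := hsub (Real.exp (-x)) (Real.exp_pos _)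
  have hexp : Integrable (fun y => Real.exp (-y)) (gaussianReal (s / 2) s.toNNReal) := by
    have := integrable_exp_mul_gaussianReal (μ := s / 2) (v := s.toNNReal) (-1)
    simpa using this
  have hval : ∫ y, Real.exp (-y) ∂(gaussianReal (s / 2) s.toNNReal) = 1 := by
    have := mgf_gaussianReal (p := gaussianReal (s / 2) s.toNNReal) (X := id) Measure.map_id (-1)
    simp only [mgf, id, neg_mul, one_mul] at this
    rw [this, Real.coe_toNNReal _ hs]
    simp
  have hexp1 : Integrable (fun y => c * (Real.exp (-y) - 1)) (gaussianReal (s / 2) s.toNNReal) :=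
    (hexp.sub (integrable_const 1)).const_mul c
  have hlin : ∫ y, (φ (Real.exp (-x)) + c * (Real.exp (-y) - 1))
      ∂(gaussianReal (s / 2) s.toNNReal) = φ (Real.exp (-x)) := by
    rw [integral_add (integrable_const _) hexp1,
      integral_const_mul, integral_sub hexp (integrable_const _), hval]
    simp
  calc φ (Real.exp (-x)) = _ := hlin.symm
    _ ≤ _ := by
      refine integral_mono ((integrable_const _).add hexp1)
        (integrable_comp_exp hφ hC (by fun_prop) _) fun y => ?_
      have := hc (Real.exp (-y)) (Real.exp_pos _)
      simpa [neg_add, Real.exp_add, mul_comm] using this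

/-- Change of measure between the two Gaussians. -/
theorem integral_mul_exp_neg_gaussianReal (f : ℝ → ℝ) {μ : ℝ} (hμ : 0 ≤ μ) :
    ∫ x, f x * Real.exp (-x) ∂(gaussianReal (μ / 2) μ.toNNReal)
      = ∫ x, f x ∂(gaussianReal (-(μ / 2)) μ.toNNReal) := by
  rcases hμ.eq_or_lt with rfl | hμ
  · simp
  have hv : μ.toNNReal ≠ 0 := by simpa using hμ
  rw [integral_gaussianReal_eq_integral_smul hv, integral_gaussianReal_eq_integral_smul hv]
  congr 1
  ext x
  simp only [smul_eq_mul, gaussianPDFReal, Real.coe_toNNReal _ hμ.le]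
  have : Real.exp (-(x - -(μ / 2)) ^ 2 / (2 * μ))
      = Real.exp (-(x - μ / 2) ^ 2 / (2 * μ)) * Real.exp (-x) := by
    rw [← Real.exp_add]
    congr 1
    field_simp
    ring
  rw [this]
  ring

theorem integrable_mul_exp_neg_gaussianReal {f : ℝ → ℝ} (hf : Measurable f) {C : ℝ}
    (hC : ∀ x, |f x| ≤ C) (m : ℝ) (v : NNReal) :
    Integrable (fun x => f x * Real.exp (-x)) (gaussianReal m v) := by
  have h : Integrable (fun y => Real.exp (-y)) (gaussianReal m v) := by
    have := integrable_exp_mul_gaussianReal (μ := m) (v := v) (-1)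
    simpa using this
  exact h.bdd_mul hf.aestronglyMeasurable (Eventually.of_forall hC)

/-- The limiting success probability of belief propagation at signal-to-noise ratio `μ`. -/
def gaussGain (μ : ℝ) : ℝ := logNormalExp (fun x => max 0 (1 - x)) μ

theorem abs_max_zero_one_sub_le (x : ℝ) (hx : 0 < x) : |max 0 (1 - x)| ≤ 1 := by
  rw [abs_of_nonneg (le_max_left _ _)]
  exact max_le zero_le_one (by linarith)

theorem continuous_gaussGain : Continuous gaussGain :=
  continuous_logNormalExp (by fun_prop) abs_max_zero_one_sub_le

theorem gaussGain_mono {μ ν : ℝ} (hμ : 0 ≤ μ) (h : μ ≤ ν) : gaussGain μ ≤ gaussGain ν := by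
  have := logNormalExp_le (φ := fun x => max 0 (1 - x)) (by fun_prop) abs_max_zero_one_sub_le
    (fun x hx => ?_) hμ (sub_nonneg.2 h)
  · simpa [gaussGain] using this
  · rcases le_total 1 x with h1 | h1
    · exact ⟨0, fun y hy => by simp [h1]⟩
    · refine ⟨-x, fun y hy => ?_⟩
      rw [max_eq_right (by linarith)]
      exact le_max_of_le_right (by linarith)

theorem gaussGain_eq_integral {μ : ℝ} (hμ : 0 ≤ μ) :
    gaussGain μ = ∫ x, max 0 (1 - Real.exp (-x)) ∂(gaussianReal (μ / 2) μ.toNNReal) :=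
  (integral_exp_neg_gaussianReal (φ := fun x => max 0 (1 - x)) (by fun_prop) hμ).symm

/-- The integrand is the indicator of x > 0 times 1 - exp(-x). The density exp(-x) turns N(μ/2, μ)
into N(-μ/2, μ), whose mass on the positive axis is one minus that of N(μ/2, μ) by reflection; there
is no atom at 0 because μ > 0. -/
theorem gaussSuccess_eq {μ : ℝ} (hμ : 0 < μ) : gaussSuccess μ = gaussGain μ := by
  have hv : μ.toNNReal ≠ 0 := by simpa using hμ
  have := nullSingletonClass_gaussianReal (μ := μ / 2) hv
  rw [gaussGain_eq_integral hμ.le]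
  have h1 : ∀ x : ℝ, max 0 (1 - Real.exp (-x))
      = (Ioi 0).indicator 1 x - (Ioi 0).indicator 1 x * Real.exp (-x) := by
    intro x
    rcases lt_or_ge 0 x with hx | hx
    · rw [indicator_of_mem (by exact hx), max_eq_right (by simp [hx.le])]
      simp
    · rw [indicator_of_notMem (by simpa using hx), max_eq_left (by simp [hx])]
      simp
  have hm : Measurable ((Ioi (0:ℝ)).indicator (1 : ℝ → ℝ)) :=
    measurable_one.indicator measurableSet_Ioi
  have hb : ∀ x, |(Ioi (0:ℝ)).indicator (1 : ℝ → ℝ) x| ≤ 1 := by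
    intro x
    by_cases hx : x ∈ Ioi (0:ℝ)
    · simp [indicator_of_mem hx]
    · simp [indicator_of_notMem hx]
  simp_rw [h1]
  rw [integral_sub (Integrable.of_bound hm.aestronglyMeasurable 1 (Eventually.of_forall hb))
    (integrable_mul_exp_neg_gaussianReal hm hb _ _), integral_mul_exp_neg_gaussianReal _ hμ.le,
    integral_indicator_one measurableSet_Ioi, integral_indicator_one measurableSet_Ioi]
  have h2 : (gaussianReal (-(μ / 2)) μ.toNNReal).real (Ioi 0)
      = 1 - (gaussianReal (μ / 2) μ.toNNReal).real (Ioi 0) := by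
    rw [← gaussianReal_map_neg, map_measureReal_apply (by fun_prop) measurableSet_Ioi]
    have h3 : (fun x : ℝ => -x) ⁻¹' Ioi 0 = Iio 0 := by ext; simp
    rw [h3, ← probReal_compl_eq_one_sub measurableSet_Ioi, compl_Ioi]
    exact measureReal_congr Iio_ae_eq_Iic
  rw [h2, gaussSuccess]
  ring

end GaussianExpectation

/-! ### The map G: monotonicity, bounds and its least positive fixed point. -/

section GaussMap

variable {p lam : ℝ}

theorem gaussMap_eq (p lam μ : ℝ) : gaussMap p lam μ
    = lam / (1 - p) ^ 2 * logNormalExp (fun x => 1 / (p + (1 - p) * x) - 1) μ := rfl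

theorem mix_pos (hp' : p < 1) {x : ℝ} (hx : 0 < x) : p < p + (1 - p) * x := by
  have := mul_pos (sub_pos.2 hp') hx
  linarith

theorem abs_one_div_mix_sub_one_le (hp : 0 < p) (hp' : p < 1) (x : ℝ) (hx : 0 < x) :
    |1 / (p + (1 - p) * x) - 1| ≤ 1 / p := by
  have h := mix_pos hp' hx
  have h1 : 1 / (p + (1 - p) * x) ≤ 1 / p := one_div_le_one_div_of_le hp h.le
  have h2 : 0 < 1 / (p + (1 - p) * x) := one_div_pos.2 (hp.trans h)
  have h3 : 1 ≤ 1 / p := by rw [le_div_iff₀ hp]; linarith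
  rw [abs_le]
  constructor <;> linarith

theorem continuousOn_one_div_mix (hp : 0 < p) (hp' : p < 1) :
    ContinuousOn (fun x => 1 / (p + (1 - p) * x) - 1) (Ioi 0) := by
  refine ContinuousOn.sub (ContinuousOn.div continuousOn_const (by fun_prop) fun x hx => ?_)
    continuousOn_const
  exact (hp.trans (mix_pos hp' hx)).ne'

theorem continuous_gaussMap (hp : 0 < p) (hp' : p < 1) : Continuous (gaussMap p lam) :=
  (continuous_logNormalExp (continuousOn_one_div_mix hp hp')
    (abs_one_div_mix_sub_one_le hp hp')).const_mul _

/-- The function 1 / (p + (1 - p) x) is convex; the slope given to `logNormalExp_le` is x times its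
derivative at x. -/
theorem gaussMap_mono (hp : 0 < p) (hp' : p < 1) (hlam : 0 ≤ lam) {μ ν : ℝ} (hμ : 0 ≤ μ)
    (h : μ ≤ ν) : gaussMap p lam μ ≤ gaussMap p lam ν := by
  have := logNormalExp_le (continuousOn_one_div_mix hp hp')
    (abs_one_div_mix_sub_one_le hp hp') (fun x hx => ?_) hμ (sub_nonneg.2 h)
  · rw [add_sub_cancel] at this
    rw [gaussMap_eq, gaussMap_eq]
    exact mul_le_mul_of_nonneg_left this (by positivity)
  · refine ⟨-((1 - p) * x / (p + (1 - p) * x) ^ 2), fun y hy => ?_⟩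
    have h1 := hp.trans (mix_pos hp' hx)
    have h2 := hp.trans (mix_pos hp' (mul_pos hx hy))
    set U := p + (1 - p) * x with hU
    set V := p + (1 - p) * (x * y) with hV
    have h3 : (1 - p) * x * (y - 1) = V - U := by rw [hU, hV]; ring
    have h4 : 1 / V - 1 - (1 / U - 1 + -((1 - p) * x / U ^ 2) * (y - 1)) = (V - U) ^ 2 / (V * U ^ 2) := by
      have : -((1 - p) * x / U ^ 2) * (y - 1) = -((V - U) / U ^ 2) := by
        rw [← h3]; ring
      rw [this]
      field_simp
      ring
    have h5 : 0 ≤ (V - U) ^ 2 / (V * U ^ 2) := by positivity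
    linarith

theorem gaussMap_zero (p lam : ℝ) : gaussMap p lam 0 = 0 := by
  simp [gaussMap]

/-- The bound is the contribution of known labels, obtained by deleting the positive exponential
from the denominator. Strictness is what makes revealed labels useful in `exists_le_evo`. -/
theorem gaussMap_lt (hp : 0 < p) (hp' : p < 1) (hlam : 0 < lam) (μ : ℝ) :
    gaussMap p lam μ < lam / (p * (1 - p)) := by
  have hq : 0 < 1 - p := sub_pos.2 hp'
  have hint := integrable_comp_exp (continuousOn_one_div_mix hp hp')
    (abs_one_div_mix_sub_one_le hp hp') (f := fun z => Real.sqrt μ * z - μ / 2) (by fun_prop)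
    (gaussianReal 0 1)
  have hpos : ∀ z : ℝ, 0 < (1 / p - 1) - (1 / (p + (1 - p) * Real.exp (Real.sqrt μ * z - μ / 2)) - 1) := by
    intro z
    have := one_div_lt_one_div_of_lt hp (mix_pos hp' (Real.exp_pos (Real.sqrt μ * z - μ / 2)))
    linarith
  have h : 0 < ∫ z, ((1 / p - 1) - (1 / (p + (1 - p) * Real.exp (Real.sqrt μ * z - μ / 2)) - 1))
      ∂(gaussianReal 0 1) := by
    rw [integral_pos_iff_support_of_nonneg (fun z => (hpos z).le)
      ((integrable_const _).sub hint)]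
    have : Function.support (fun z => (1 / p - 1)
      - (1 / (p + (1 - p) * Real.exp (Real.sqrt μ * z - μ / 2)) - 1)) = univ := by
      ext z
      simpa using (hpos z).ne'
    rw [this]
    simp
  rw [integral_sub (integrable_const _) hint] at h
  simp only [integral_const, probReal_univ, one_smul, sub_pos] at h
  have h2 : lam / (p * (1 - p)) = lam / (1 - p) ^ 2 * (1 / p - 1) := by
    field_simp
  rw [h2, gaussMap]
  exact mul_lt_mul_of_pos_left h (by positivity)

theorem integral_exp_nat_mul (μ : ℝ) (hμ : 0 ≤ μ) (k : ℕ) :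
    Integrable (fun z => Real.exp (Real.sqrt μ * z - μ / 2) ^ k) (gaussianReal 0 1) ∧
    ∫ z, Real.exp (Real.sqrt μ * z - μ / 2) ^ k ∂(gaussianReal 0 1)
      = Real.exp ((k ^ 2 - k) / 2 * μ) := by
  have h : ∀ z : ℝ, Real.exp (Real.sqrt μ * z - μ / 2) ^ k
      = Real.exp (k * Real.sqrt μ * z) * Real.exp (-(k * μ / 2)) := by
    intro z
    rw [← Real.exp_nat_mul, ← Real.exp_add]
    congr 1
    ring
  simp_rw [h]
  refine ⟨(integrable_exp_mul_gaussianReal _).mul_const _, ?_⟩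
  rw [integral_mul_const]
  have := mgf_gaussianReal (p := gaussianReal 0 1) (X := id) Measure.map_id (k * Real.sqrt μ)
  simp only [mgf, id] at this
  rw [this, ← Real.exp_add]
  congr 1
  simp only [NNReal.coe_one, mul_pow, Real.sq_sqrt hμ]
  ring

/-- With U the denominator, 1/U - 1 exceeds (1 - U) + (1 - U)² + (1 - U)³ by (1 - U)⁴ / U ≥ 0. The
moments of the log-normal variable then evaluate the polynomial exactly. -/
theorem gaussMap_ge (hp : 0 < p) (hp' : p < 1) (hlam : 0 ≤ lam) {μ : ℝ} (hμ : 0 ≤ μ) :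
    lam * ((Real.exp μ - 1) - (1 - p) * ((Real.exp μ - 1) ^ 2 * (Real.exp μ + 2)))
      ≤ gaussMap p lam μ := by
  have hq : 0 < 1 - p := sub_pos.2 hp'
  set Y : ℝ → ℝ := fun z => Real.exp (Real.sqrt μ * z - μ / 2) with hY
  have hk := integral_exp_nat_mul μ hμ
  have hlow : ∀ z, (1 - p) * (1 - Y z) + (1 - p) ^ 2 * (1 - Y z) ^ 2 + (1 - p) ^ 3 * (1 - Y z) ^ 3
      ≤ 1 / (p + (1 - p) * Y z) - 1 := by
    intro z
    have hU := hp.trans (mix_pos hp' (Real.exp_pos (Real.sqrt μ * z - μ / 2)))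
    change 0 < p + (1 - p) * Y z at hU
    set U := p + (1 - p) * Y z with hU'
    have e : (1 - p) * (1 - Y z) = 1 - U := by rw [hU']; ring
    have : 1 / U - 1 - ((1 - U) + (1 - U) ^ 2 + (1 - U) ^ 3) = (1 - U) ^ 4 / U := by
      field_simp
      ring
    have h2 : 0 ≤ (1 - U) ^ 4 / U := by positivity
    rw [← mul_pow, ← mul_pow, e]
    linarith
  have hpoly : ∀ z, (1 - p) * (1 - Y z) + (1 - p) ^ 2 * (1 - Y z) ^ 2
      + (1 - p) ^ 3 * (1 - Y z) ^ 3
      = ((1 - p) + (1 - p) ^ 2 + (1 - p) ^ 3)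
        + (-(1 - p) - 2 * (1 - p) ^ 2 - 3 * (1 - p) ^ 3) * Y z ^ 1
        + ((1 - p) ^ 2 + 3 * (1 - p) ^ 3) * Y z ^ 2 + (-(1 - p) ^ 3) * Y z ^ 3 := by
    intro z; ring
  have hi0 := integrable_const (μ := gaussianReal 0 1) ((1 - p) + (1 - p) ^ 2 + (1 - p) ^ 3)
  have hi1 := (hk 1).1.const_mul (-(1 - p) - 2 * (1 - p) ^ 2 - 3 * (1 - p) ^ 3)
  have hi2 := (hk 2).1.const_mul ((1 - p) ^ 2 + 3 * (1 - p) ^ 3)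
  have hi3 := (hk 3).1.const_mul (-(1 - p) ^ 3)
  have hint := integral_mono (((hi0.add hi1).add hi2).add hi3)
    (integrable_comp_exp (continuousOn_one_div_mix hp hp')
    (abs_one_div_mix_sub_one_le hp hp') (f := fun z => Real.sqrt μ * z - μ / 2) (by fun_prop)
    (gaussianReal 0 1)) (fun z => by
      have := hlow z
      rw [hpoly z] at this
      exact this)
  have h01 : Integrable (fun z => ((1 - p) + (1 - p) ^ 2 + (1 - p) ^ 3)
      + (-(1 - p) - 2 * (1 - p) ^ 2 - 3 * (1 - p) ^ 3) * Y z ^ 1) (gaussianReal 0 1) := hi0.add hi1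
  have h012 : Integrable (fun z => ((1 - p) + (1 - p) ^ 2 + (1 - p) ^ 3)
      + (-(1 - p) - 2 * (1 - p) ^ 2 - 3 * (1 - p) ^ 3) * Y z ^ 1
      + ((1 - p) ^ 2 + 3 * (1 - p) ^ 3) * Y z ^ 2) (gaussianReal 0 1) := h01.add hi2
  simp only [Pi.add_apply] at hint
  rw [integral_add h012 hi3, integral_add h01 hi2,
    integral_add hi0 hi1, integral_const_mul, integral_const_mul, integral_const_mul,
    (hk 1).2, (hk 2).2, (hk 3).2] at hint
  have e1 : Real.exp ((((1:ℕ):ℝ) ^ 2 - ((1:ℕ):ℝ)) / 2 * μ) = 1 := by norm_num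
  have e2 : Real.exp ((((2:ℕ):ℝ) ^ 2 - ((2:ℕ):ℝ)) / 2 * μ) = Real.exp μ := by norm_num
  have e3 : Real.exp ((((3:ℕ):ℝ) ^ 2 - ((3:ℕ):ℝ)) / 2 * μ) = Real.exp μ ^ 3 := by
    rw [← Real.exp_nat_mul]; norm_num
  rw [e1, e2, e3] at hint
  simp only [integral_const, probReal_univ, one_smul] at hint
  rw [gaussMap]
  refine le_trans (le_of_eq ?_) (mul_le_mul_of_nonneg_left hint (by positivity))
  field_simp
  ring

/-- By `gaussMap_ge`, G(μ) is at least e^μ - 1 times a factor that tends to λ > 1 at 0, and e^μ - 1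
> μ. -/
theorem exists_lt_gaussMap (hp : 0 < p) (hp' : p < 1) (hlam : 1 < lam) :
    ∃ δ > 0, ∀ μ, 0 < μ → μ ≤ δ → μ < gaussMap p lam μ := by
  have hc : ContinuousAt (fun μ : ℝ => lam * (1 - (1 - p) * ((Real.exp μ - 1) * (Real.exp μ + 2)))) 0 := by
    fun_prop
  have h1 : ∀ᶠ μ in 𝓝 (0:ℝ), 1 < lam * (1 - (1 - p) * ((Real.exp μ - 1) * (Real.exp μ + 2))) :=
    hc.eventually_const_lt (by simpa using hlam)
  obtain ⟨δ, hδ, h⟩ := Metric.eventually_nhds_iff.1 h1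
  refine ⟨δ / 2, by positivity, fun μ hμ hμ' => ?_⟩
  have h2 := h (y := μ) (by rw [Real.dist_eq, sub_zero, abs_of_pos hμ]; linarith)
  have h3 : μ < Real.exp μ - 1 := by linarith [Real.add_one_lt_exp hμ.ne']
  have h4 := gaussMap_ge hp hp' (by linarith : 0 ≤ lam) hμ.le
  have h5 : Real.exp μ - 1 ≤ lam * ((Real.exp μ - 1)
      - (1 - p) * ((Real.exp μ - 1) ^ 2 * (Real.exp μ + 2))) := by
    have := mul_le_mul_of_nonneg_left h2.le (hμ.trans h3).le
    linarith
  linarith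

/-- The map `gaussMap` has a least positive fixed point, and lies above the diagonal before it. -/
theorem exists_isLeast_fixedPoint (hp : 0 < p) (hp' : p < 1) (hlam : 1 < lam) :
    ∃ α, IsLeast {μ : ℝ | 0 < μ ∧ gaussMap p lam μ = μ} α
      ∧ ∀ μ, 0 ≤ μ → μ ≤ α → μ ≤ gaussMap p lam μ := by
  obtain ⟨δ, hδ, h⟩ := exists_lt_gaussMap hp hp' hlam
  have hG := continuous_gaussMap (lam := lam) hp hp'
  set K := lam / (p * (1 - p)) with hK
  have hKδ : δ < K := (h δ hδ le_rfl).trans (gaussMap_lt hp hp' (by linarith) _)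
  -- There is no fixed point in (0, δ]; restricting to μ ≥ δ loses none, and gives a closed set away
  -- from 0 that contains its infimum.
  have hS : IsClosed {μ : ℝ | δ ≤ μ ∧ gaussMap p lam μ = μ} :=
    (isClosed_le continuous_const continuous_id).inter (isClosed_eq hG continuous_id)
  have hfix : ∀ x y : ℝ, x ≤ y → x ≤ gaussMap p lam x → gaussMap p lam y ≤ y →
      ∃ z ∈ Icc x y, gaussMap p lam z = z := by
    intro x y hxy hx hy
    obtain ⟨z, hz, hz'⟩ := intermediate_value_Icc' (f := fun μ => gaussMap p lam μ - μ) hxy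
      (by fun_prop) (show (0:ℝ) ∈ Icc _ _ from ⟨by simpa using hy, by simpa using hx⟩)
    exact ⟨z, hz, by simpa [sub_eq_zero] using hz'⟩
  have hne : {μ : ℝ | δ ≤ μ ∧ gaussMap p lam μ = μ}.Nonempty := by
    obtain ⟨z, hz, hz'⟩ := hfix δ K hKδ.le (h δ hδ le_rfl).le (gaussMap_lt hp hp' (by linarith) _).le
    exact ⟨z, hz.1, hz'⟩
  have hbd : BddBelow {μ : ℝ | δ ≤ μ ∧ gaussMap p lam μ = μ} := ⟨δ, fun x hx => hx.1⟩
  have hmem := hS.csInf_mem hne hbd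
  set α := sInf {μ : ℝ | δ ≤ μ ∧ gaussMap p lam μ = μ}
  have hα : 0 < α := hδ.trans_le hmem.1
  have hleast : ∀ μ, 0 < μ → gaussMap p lam μ = μ → α ≤ μ := by
    intro μ hμ hfx
    refine csInf_le hbd ⟨?_, hfx⟩
    by_contra hlt
    have := h μ hμ (not_le.1 hlt).le
    rw [hfx] at this
    exact lt_irrefl _ this
  refine ⟨α, ⟨⟨hα, hmem.2⟩, fun μ hμ => hleast μ hμ.1 hμ.2⟩, fun μ hμ hμα => ?_⟩
  rcases hμ.eq_or_lt with rfl | hμ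
  · rw [gaussMap_zero]
  by_contra! hlt
  have hδμ : δ < μ := by
    by_contra! hle
    exact absurd (h μ hμ hle) (not_lt.2 hlt.le)
  obtain ⟨z, hz, hz'⟩ := hfix δ μ hδμ.le (h δ hδ le_rfl).le hlt.le
  have h1 := hleast z (hδ.trans_le hz.1) hz'
  have h2 : z = μ := le_antisymm hz.2 (hμα.trans h1)
  rw [h2] at hz'
  linarith

/-- The expected signed difference of the posterior label probabilities, given the log-likelihood
ratio `x`, in units where it is `1/p` or `-1/(1-p)` when the label is known. -/
def disc (p x : ℝ) : ℝ := (Real.exp x - 1) / (p * Real.exp x + (1 - p))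

theorem mix_exp_pos (hp : 0 < p) (hp' : p < 1) (x : ℝ) : 0 < p * Real.exp x + (1 - p) := by
  have := mul_pos hp (Real.exp_pos x)
  linarith

theorem continuous_disc (hp : 0 < p) (hp' : p < 1) : Continuous (disc p) := by
  unfold disc
  exact Continuous.div (by fun_prop) (by fun_prop) fun x => (mix_exp_pos hp hp' x).ne'

theorem disc_le (hp : 0 < p) (hp' : p < 1) (x : ℝ) : disc p x ≤ 1 / p := by
  rw [disc, div_le_div_iff₀ (mix_exp_pos hp hp' x) hp]
  nlinarith

theorem le_disc (hp : 0 < p) (hp' : p < 1) (x : ℝ) : -(1 / (1 - p)) ≤ disc p x := by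
  rw [disc, ← neg_div, div_le_div_iff₀ (sub_pos.2 hp') (mix_exp_pos hp hp' x)]
  nlinarith [Real.exp_pos x]

/-- G is λ times the second moment of the posterior discrepancy when the label has its prior law.
Under the first Gaussian the two integrals combine into the integrand of G plus a multiple of
exp(-x) - 1, which has mean zero. -/
theorem gaussMap_eq_integral_disc (hp : 0 < p) (hp' : p < 1) (lam : ℝ) {μ : ℝ} (hμ : 0 ≤ μ) :
    gaussMap p lam μ = lam * (p * ∫ x, disc p x ^ 2 ∂(gaussianReal (μ / 2) μ.toNNReal)
      + (1 - p) * ∫ x, disc p x ^ 2 ∂(gaussianReal (-(μ / 2)) μ.toNNReal)) := by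
  have hq : 0 < 1 - p := sub_pos.2 hp'
  set B := max (1 / p) (1 / (1 - p))
  have hb : ∀ x, |disc p x ^ 2| ≤ B ^ 2 := by
    intro x
    rw [abs_pow]
    refine pow_le_pow_left₀ (abs_nonneg _) (abs_le.2 ⟨?_, ?_⟩) 2
    · exact (neg_le_neg (le_max_right _ _)).trans (le_disc hp hp' x)
    · exact (disc_le hp hp' x).trans (le_max_left _ _)
  have hm : Measurable fun x => disc p x ^ 2 := ((continuous_disc hp hp').pow 2).measurable
  have hi : Integrable (fun x => disc p x ^ 2) (gaussianReal (μ / 2) μ.toNNReal) :=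
    Integrable.of_bound hm.aestronglyMeasurable _ (Eventually.of_forall hb)
  have hie := integrable_mul_exp_neg_gaussianReal hm hb (μ / 2) μ.toNNReal
  rw [← integral_mul_exp_neg_gaussianReal _ hμ, ← integral_const_mul, ← integral_const_mul,
    ← integral_add (hi.const_mul _) (hie.const_mul _)]
  have hpt : ∀ x : ℝ, p * disc p x ^ 2 + (1 - p) * (disc p x ^ 2 * Real.exp (-x))
      = 1 / (1 - p) ^ 2 * ((1 / (p + (1 - p) * Real.exp (-x)) - 1)
        + (1 - p) * (Real.exp (-x) - 1)) := by
    intro x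
    have h1 := mix_exp_pos hp hp' x
    have h2 : p + (1 - p) * Real.exp (-x) = (p * Real.exp x + (1 - p)) / Real.exp x := by
      rw [Real.exp_neg]; field_simp
    rw [h2, disc, Real.exp_neg]
    have := Real.exp_pos x
    field_simp
    ring
  have hexp : Integrable (fun y => Real.exp (-y)) (gaussianReal (μ / 2) μ.toNNReal) := by
    have := integrable_exp_mul_gaussianReal (μ := μ / 2) (v := μ.toNNReal) (-1)
    simpa using this
  have hval : ∫ y, Real.exp (-y) ∂(gaussianReal (μ / 2) μ.toNNReal) = 1 := by
    have := integral_mul_exp_neg_gaussianReal (fun _ => 1) hμ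
    simpa using this
  have hexp1 : Integrable (fun y => (1 - p) * (Real.exp (-y) - 1))
      (gaussianReal (μ / 2) μ.toNNReal) := (hexp.sub (integrable_const 1)).const_mul _
  simp_rw [hpt]
  rw [integral_const_mul, integral_add
    (integrable_comp_exp (continuousOn_one_div_mix hp hp') (abs_one_div_mix_sub_one_le hp hp')
      continuous_neg _) hexp1, integral_const_mul,
    integral_sub hexp (integrable_const _), hval,
    integral_exp_neg_gaussianReal (continuousOn_one_div_mix hp hp') hμ, gaussMap_eq]
  simp
  ring

end GaussMap

/-! ### The recursion for the signal-to-noise ratio. -/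

section Evolution

variable {p lam : ℝ}

/-- The signal-to-noise ratios of belief propagation at depth `t`, when the labels at depth `s`
below the root are revealed with probability `q s`. -/
def evo (p lam : ℝ) (q : ℕ → ℝ) : ℕ → ℝ
  | 0 => 0
  | t + 1 => q t * (lam / (p * (1 - p))) + (1 - q t) * gaussMap p lam (evo p lam q t)

theorem gaussMap_nonneg (hp : 0 < p) (hp' : p < 1) (hlam : 0 ≤ lam) {μ : ℝ} (hμ : 0 ≤ μ) :
    0 ≤ gaussMap p lam μ := by
  rw [← gaussMap_zero p lam]
  exact gaussMap_mono hp hp' hlam le_rfl hμ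

theorem evo_nonneg (hp : 0 < p) (hp' : p < 1) (hlam : 0 ≤ lam) {q : ℕ → ℝ}
    (hq : ∀ t, 0 ≤ q t) (hq' : ∀ t, q t ≤ 1) (t : ℕ) : 0 ≤ evo p lam q t := by
  have h1 : 0 ≤ 1 - p := by linarith
  induction t with
  | zero => exact le_rfl
  | succ t ih =>
    have := gaussMap_nonneg hp hp' hlam ih
    have h2 := hq t
    have h3 := sub_nonneg.2 (hq' t)
    rw [evo]
    positivity

/-- With side information the evolution passes the least positive fixed point. -/
theorem exists_le_evo (hp : 0 < p) (hp' : p < 1) (hlam : 0 < lam) {q α : ℝ} (hq : 0 < q)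
    (hq' : q ≤ 1) (hα : ∀ μ, 0 ≤ μ → μ ≤ α → μ ≤ gaussMap p lam μ) :
    ∃ t, α ≤ evo p lam (fun _ => q) t := by
  by_contra! hlt
  have hnn := evo_nonneg hp hp' hlam.le (q := fun _ => q) (fun _ => hq.le) (fun _ => hq')
  have hgap := gaussMap_lt hp hp' hlam α
  -- Below α a step gains at least κ: it adds q (λ / (p (1 - p)) - G(μ)) to G(μ), where G(μ) ≥ μ and
  -- G(μ) ≤ G(α). So α is reached after finitely many steps.
  set κ := q * (lam / (p * (1 - p)) - gaussMap p lam α) with hκ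
  have hκ0 : 0 < κ := mul_pos hq (sub_pos.2 hgap)
  have hstep : ∀ t, evo p lam (fun _ => q) t + κ ≤ evo p lam (fun _ => q) (t + 1) := by
    intro t
    have h1 := hα _ (hnn t) (hlt t).le
    have h2 := mul_le_mul_of_nonneg_left
      (gaussMap_mono hp hp' hlam.le (hnn t) (hlt t).le) hq.le
    rw [evo]
    simp only [hκ]
    linarith
  have hlin : ∀ t : ℕ, t * κ ≤ evo p lam (fun _ => q) t := by
    intro t
    induction t with
    | zero => simpa using hnn 0
    | succ t ih =>
      have := hstep t
      push_cast
      linarith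
  obtain ⟨t, ht⟩ := exists_nat_gt (α / κ)
  rw [div_lt_iff₀ hκ0] at ht
  linarith [hlin t, hlt t]

/-- When the labels far away are all known, the evolution decreases to a fixed point. -/
theorem exists_tendsto_evo (hp : 0 < p) (hp' : p < 1) (hlam : 0 < lam) :
    ∃ L, 0 ≤ L ∧ gaussMap p lam L = L ∧
      Tendsto (fun t => evo p lam (fun s => if s = 0 then 1 else 0) (t + 1)) atTop (𝓝 L) := by
  set u : ℕ → ℝ := fun t => evo p lam (fun s => if s = 0 then 1 else 0) (t + 1) with hu
  have hnn : ∀ t, 0 ≤ u t := fun t => evo_nonneg hp hp' hlam.le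
    (fun s => by split_ifs <;> norm_num) (fun s => by split_ifs <;> norm_num) (t + 1)
  have hsucc : ∀ t, u (t + 1) = gaussMap p lam (u t) := by
    intro t
    simp only [hu]
    rw [evo]
    simp
  have hanti : Antitone u := by
    refine antitone_nat_of_succ_le fun t => ?_
    induction t with
    | zero =>
      rw [hsucc]
      -- The evolution starts at λ / (p (1 - p)), which is above every value of G.
      refine (gaussMap_lt hp hp' hlam _).le.trans (le_of_eq ?_)
      simp [hu, evo]
    | succ t ih =>
      rw [hsucc (t + 1), hsucc t]
      rw [hsucc t] at ih
      exact gaussMap_mono hp hp' hlam.le (hsucc t ▸ hnn (t + 1)) ih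
  have hlim := tendsto_atTop_ciInf hanti ⟨0, by rintro _ ⟨t, rfl⟩; exact hnn t⟩
  refine ⟨_, ge_of_tendsto' hlim hnn, ?_, hlim⟩
  have h1 := ((continuous_gaussMap (lam := lam) hp hp').tendsto _).comp hlim
  have h2 := hlim.comp (tendsto_add_atTop_nat 1)
  refine tendsto_nhds_unique h1 (h2.congr fun t => ?_)
  exact hsucc t

end Evolution


/-! ### Weak limits of finitely supported laws through characteristic functions. -/

section WeakLimits

/-- A form of Lévy's continuity theorem in which the limit need not be known to be a characteristic
function. -/
theorem exists_tendsto_of_tendsto_charFun {ν : ℕ → ProbabilityMeasure ℝ} {f : ℝ → ℂ}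
    (hf : ContinuousAt f 0)
    (h : ∀ s, Tendsto (fun n => charFun (ν n : Measure ℝ) s) atTop (𝓝 (f s))) :
    ∃ κ : ProbabilityMeasure ℝ, (∀ s, charFun (κ : Measure ℝ) s = f s)
      ∧ Tendsto ν atTop (𝓝 κ) := by
  -- Continuity of f at 0 gives tightness, hence a limit point along an ultrafilter. Its
  -- characteristic function must be f, and then the whole sequence converges to it.
  have htight : IsTightMeasureSet (range fun n => (ν n : Measure ℝ)) :=
    isTightMeasureSet_of_tendsto_charFun hf h
  have hcomp : IsCompact (closure (range ν)) := by
    refine isCompact_closure_of_isTightMeasureSet ?_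
    convert htight using 1
    ext m
    simp
  obtain ⟨κ, -, hκ⟩ := hcomp.ultrafilter_le_nhds ((Ultrafilter.of atTop).map ν)
    (.trans (by simp) (monotone_principal subset_closure))
  have hκ' : Tendsto ν (Ultrafilter.of (atTop : Filter ℕ)) (𝓝 κ) := hκ
  have hchar : ∀ s, charFun (κ : Measure ℝ) s = f s := by
    intro s
    have h1 : Tendsto (fun n => charFun (ν n : Measure ℝ) s) (Ultrafilter.of (atTop : Filter ℕ))
        (𝓝 (charFun (κ : Measure ℝ) s)) := by
      rw [ProbabilityMeasure.tendsto_iff_forall_integral_rclike_tendsto ℂ] at hκ'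
      simp_rw [charFun_eq_integral_innerProbChar]
      exact hκ' (BoundedContinuousFunction.innerProbChar s)
    exact tendsto_nhds_unique h1 ((h s).mono_left (Ultrafilter.of_le _))
  refine ⟨κ, hchar, ProbabilityMeasure.tendsto_of_tendsto_charFun fun s => ?_⟩
  rw [hchar]
  exact h s

/-- Weak convergence tested on a bounded continuous function. -/
theorem tendsto_integral_of_tendsto {𝕜 ι : Type*} [RCLike 𝕜] {l : Filter ι}
    {ν : ι → ProbabilityMeasure ℝ} {κ : ProbabilityMeasure ℝ} (h : Tendsto ν l (𝓝 κ)) {f : ℝ → 𝕜}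
    (hf : Continuous f) {C : ℝ} (hC : ∀ x, ‖f x‖ ≤ C) :
    Tendsto (fun n => ∫ x, f x ∂(ν n : Measure ℝ)) l (𝓝 (∫ x, f x ∂(κ : Measure ℝ))) := by
  rw [ProbabilityMeasure.tendsto_iff_forall_integral_rclike_tendsto 𝕜] at h
  exact h (BoundedContinuousFunction.ofNormedAddCommGroup f hf C hC)

variable {Ω : Type} [Fintype Ω]

theorem isProbabilityMeasure_sum_dirac {w : Ω → ℝ} (hw : ∀ ω, 0 ≤ w ω) (hw1 : ∑ ω, w ω = 1)
    (X : Ω → ℝ) : IsProbabilityMeasure (∑ ω, ENNReal.ofReal (w ω) • Measure.dirac (X ω)) := by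
  constructor
  simp only [Measure.coe_finsetSum, Measure.coe_smul, Finset.sum_apply, Pi.smul_apply,
    measure_univ, smul_eq_mul, mul_one]
  rw [← ENNReal.ofReal_sum_of_nonneg fun ω _ => hw ω, hw1, ENNReal.ofReal_one]

open Classical in
/-- The law of `X` under the weights `w`; a junk value when the weights are not a probability. -/
def finLaw (w X : Ω → ℝ) : ProbabilityMeasure ℝ :=
  if h : (∀ ω, 0 ≤ w ω) ∧ ∑ ω, w ω = 1 then
    ⟨∑ ω, ENNReal.ofReal (w ω) • Measure.dirac (X ω), isProbabilityMeasure_sum_dirac h.1 h.2 X⟩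
  else ⟨Measure.dirac 0, inferInstance⟩

theorem integral_finLaw {E : Type*} [NormedAddCommGroup E] [NormedSpace ℝ E] [CompleteSpace E]
    {w : Ω → ℝ} (hw : ∀ ω, 0 ≤ w ω) (hw1 : ∑ ω, w ω = 1) (X : Ω → ℝ) (f : ℝ → E) :
    ∫ x, f x ∂(finLaw w X : Measure ℝ) = ∑ ω, w ω • f (X ω) := by
  have h : (finLaw w X : Measure ℝ) = ∑ ω, ENNReal.ofReal (w ω) • Measure.dirac (X ω) := by
    exact congrArg Subtype.val (dif_pos (⟨hw, hw1⟩ : (∀ ω, 0 ≤ w ω) ∧ ∑ ω, w ω = 1))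
  rw [h, integral_finsetSum_measure]
  · refine Finset.sum_congr rfl fun ω _ => ?_
    rw [integral_smul_measure, integral_dirac, ENNReal.toReal_ofReal (hw ω)]
  · intro ω _
    exact (integrable_dirac (by simp)).smul_measure ENNReal.ofReal_ne_top

theorem charFun_finLaw {w : Ω → ℝ} (hw : ∀ ω, 0 ≤ w ω) (hw1 : ∑ ω, w ω = 1) (X : Ω → ℝ) (s : ℝ) :
    charFun (finLaw w X : Measure ℝ) s = ∑ ω, (w ω : ℂ) * Complex.exp (s * X ω * Complex.I) := by
  rw [charFun_apply_real, integral_finLaw hw hw1]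
  simp

end WeakLimits

/-! ### Second order expansion of the contribution of a child. -/

section Expansion

open Asymptotics

/-- The log-likelihood ratio contributed by a child, as a function of its signed discrepancy in
units of the signal. -/
def jump (p h : ℝ) : ℝ := Real.log (1 + (1 - p) * h) - Real.log (1 - p * h)

/-- The factor by which the label of the parent tilts the law of a child. -/
def tilt (p : ℝ) (x : Label) (h : ℝ) : ℝ := 1 + (if x = 0 then 1 - p else -p) * h

/-- The tilted characteristic exponential of a child. -/
def tiltChar (p : ℝ) (x : Label) (s h : ℝ) : ℂ :=
  (tilt p x h : ℂ) * Complex.exp (s * jump p h * Complex.I)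

/-- The second order coefficient of `tiltChar`. -/
def driftCoeff (x : Label) (s : ℝ) : ℂ :=
  (if x = 0 then (1 : ℂ) else -1) * (s * Complex.I / 2) - s ^ 2 / 2

theorem log_expansion : (fun u : ℝ => Real.log (1 - u) + u + u ^ 2 / 2) =O[𝓝 0] fun u => u ^ 3 := by
  refine IsBigO.of_bound 2 ?_
  have h : ∀ᶠ u : ℝ in 𝓝 0, |u| < 1 / 2 := by
    have : Metric.ball (0 : ℝ) (1 / 2) ∈ 𝓝 (0 : ℝ) := Metric.ball_mem_nhds _ (by norm_num)
    filter_upwards [this] with u hu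
    simpa [Real.dist_eq] using hu
  filter_upwards [h] with u hu
  have h1 := Real.abs_log_sub_add_sum_range_le (x := u) (by linarith) 2
  simp only [Finset.sum_range_succ, Finset.sum_range_zero] at h1
  norm_num at h1
  have h2 : |u| ^ 3 / (1 - |u|) ≤ 2 * |u| ^ 3 := by
    rw [div_le_iff₀ (by linarith)]
    have : 0 ≤ |u| ^ 3 := by positivity
    nlinarith
  rw [Real.norm_eq_abs, Real.norm_eq_abs, abs_pow]
  refine le_trans (le_of_eq ?_) (h1.trans h2)
  congr 1
  ring

theorem jump_expansion (p : ℝ) :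
    (fun h => jump p h - h + (1 - 2 * p) / 2 * h ^ 2) =O[𝓝 0] fun h : ℝ => h ^ 3 := by
  have hlin : ∀ c : ℝ, (fun h : ℝ => Real.log (1 - c * h) + c * h + (c * h) ^ 2 / 2)
      =O[𝓝 0] fun h : ℝ => h ^ 3 := by
    intro c
    have ht : Tendsto (fun h : ℝ => c * h) (𝓝 0) (𝓝 0) := by
      have : Continuous fun h : ℝ => c * h := by fun_prop
      simpa using this.tendsto 0
    refine (log_expansion.comp_tendsto ht).trans ?_
    refine IsBigO.of_bound (|c| ^ 3) (Eventually.of_forall fun h => ?_)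
    simp [mul_pow]
  refine ((hlin (-(1 - p))).sub (hlin p)).congr_left fun h => ?_
  rw [jump]
  have : 1 - -(1 - p) * h = 1 + (1 - p) * h := by ring
  rw [this]
  ring

/-- The tilt contributes 1 - p or -p to the drift and the curvature of `jump` contributes -(1 -
2p)/2. Their sum is ± 1/2, so p drops out and `driftCoeff` is the exponent of N(± 1/2, 1). The value
of c is irrelevant because the discrepancies are centered. -/
theorem tiltChar_expansion (p : ℝ) (x : Label) (s : ℝ) : ∃ c : ℂ,
    (fun h : ℝ => tiltChar p x s h - 1 - c * h - driftCoeff x s * h ^ 2)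
      =o[𝓝 0] fun h : ℝ => h ^ 2 := by
  set e : ℝ := if x = 0 then 1 - p else -p with he
  set k : ℝ := (1 - 2 * p) / 2 with hk
  have h32 : (fun h : ℝ => h ^ 3) =o[𝓝 0] fun h : ℝ => h ^ 2 := isLittleO_pow_pow (by norm_num)
  have h31 : (fun h : ℝ => h ^ 3) =O[𝓝 0] fun h : ℝ => h := by
    simpa using (isLittleO_pow_pow (𝕜 := ℝ) (m := 1) (n := 3) (by norm_num)).isBigO
  have h21 : (fun h : ℝ => h ^ 2) =O[𝓝 0] fun h : ℝ => h := by
    simpa using (isLittleO_pow_pow (𝕜 := ℝ) (m := 1) (n := 2) (by norm_num)).isBigO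
  have hJ := jump_expansion p
  have hJ2 : (fun h => jump p h - h) =O[𝓝 0] fun h : ℝ => h ^ 2 := by
    refine ((hJ.trans h32.isBigO).sub ((isBigO_refl (fun h : ℝ => h ^ 2) (𝓝 0)).const_mul_left k)).congr_left
      fun h => by ring
  have hJ1 : (fun h => jump p h) =O[𝓝 0] fun h : ℝ => h := by
    refine ((hJ2.trans h21).add (isBigO_refl (fun h : ℝ => h) (𝓝 0))).congr_left fun h => by ring
  have hJsq : (fun h => jump p h ^ 2 - h ^ 2) =O[𝓝 0] fun h : ℝ => h ^ 3 := by
    refine (hJ2.mul (hJ1.add (isBigO_refl (fun h : ℝ => h) (𝓝 0)))).congr (fun h => ?_) fun h => ?_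
    · ring
    · ring
  have hJ0 : Tendsto (fun h => (s * jump p h * Complex.I : ℂ)) (𝓝 0) (𝓝 0) := by
    have h1 : Tendsto (fun h => jump p h) (𝓝 0) (𝓝 0) := hJ1.trans_tendsto tendsto_id
    have h2 : Continuous fun y : ℝ => (s * y * Complex.I : ℂ) := by fun_prop
    have h3 := (h2.tendsto 0).comp h1
    simpa [Function.comp_def] using h3
  have hE : (fun h => Complex.exp (s * jump p h * Complex.I) - 1 - s * jump p h * Complex.I
      + s ^ 2 * jump p h ^ 2 / 2) =O[𝓝 0] fun h : ℝ => h ^ 3 := by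
    have h1 := (Complex.exp_sub_sum_range_isBigO_pow 3).comp_tendsto hJ0
    refine IsBigO.trans (h1.congr_left (f₂ := fun h => Complex.exp (s * jump p h * Complex.I) - 1
      - s * jump p h * Complex.I + s ^ 2 * jump p h ^ 2 / 2) fun h => ?_) ?_
    · simp only [Function.comp_apply, Finset.sum_range_succ, Finset.sum_range_zero]
      norm_num [Nat.factorial]
      rw [mul_pow, Complex.I_sq]
      ring
    · have h4 : (fun h : ℝ => (s * jump p h * Complex.I : ℂ)) =O[𝓝 0] fun h : ℝ => h := by
        refine IsBigO.trans (IsBigO.of_bound |s| (Eventually.of_forall fun h => ?_)) hJ1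
        simp
      exact h4.pow 3
  have hJc : (fun h : ℝ => ((jump p h - h + k * h ^ 2 : ℝ) : ℂ)) =O[𝓝 0] fun h : ℝ => h ^ 3 :=
    IsBigO.trans (IsBigO.of_bound 1 (Eventually.of_forall fun h => by
      rw [Complex.norm_real, one_mul])) hJ
  have hJsqc : (fun h : ℝ => ((jump p h ^ 2 - h ^ 2 : ℝ) : ℂ)) =O[𝓝 0] fun h : ℝ => h ^ 3 :=
    IsBigO.trans (IsBigO.of_bound 1 (Eventually.of_forall fun h => by
      rw [Complex.norm_real, one_mul])) hJsq
  have hh3 : (fun h : ℝ => (h : ℂ) ^ 3) =O[𝓝 0] fun h : ℝ => h ^ 3 :=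
    IsBigO.of_bound 1 (Eventually.of_forall fun h => by simp)
  have hbr := (hE.add (hJc.const_mul_left (s * Complex.I))).sub
    (hJsqc.const_mul_left ((s : ℂ) ^ 2 / 2))
  have hfac : (fun h : ℝ => ((1 + e * h : ℝ) : ℂ)) =O[𝓝 0] fun _ : ℝ => (1 : ℝ) := by
    refine Tendsto.isBigO_one (c := (1 : ℂ)) ℝ ?_
    have : Continuous fun h : ℝ => ((1 + e * h : ℝ) : ℂ) := by fun_prop
    simpa using this.tendsto 0
  have hall := ((hfac.mul hbr).congr_right (g₂ := fun h : ℝ => h ^ 3) fun h => by ring).sub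
    (hh3.const_mul_left (e * (s * Complex.I * k + s ^ 2 / 2)))
  refine ⟨e + s * Complex.I, (hall.congr_left fun h => ?_).trans_isLittleO h32⟩
  have hd : driftCoeff x s = e * (s * Complex.I) - s * Complex.I * k - s ^ 2 / 2 := by
    rw [driftCoeff, he, hk]
    split_ifs <;> push_cast <;> ring
  rw [hd, tiltChar, tilt, ← he]
  push_cast
  ring

end Expansion


/-! ### The law of the posterior discrepancy of a child. -/

section ChildLaw

variable {p r : ℝ}

/-- A bound for the signed discrepancies. -/
def discBound (p : ℝ) : ℝ := 1 / p + 1 / (1 - p)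

/-- The law of the signed discrepancy of a child, whose label is revealed with probability `r`, and
whose log-likelihood ratio has law `κ y` when its label is `y`. -/
def childLaw (p r : ℝ) (κ : Label → ProbabilityMeasure ℝ) : Measure ℝ :=
  ENNReal.ofReal (r * p) • Measure.dirac (1 / p)
    + ENNReal.ofReal (r * (1 - p)) • Measure.dirac (-(1 / (1 - p)))
    + (ENNReal.ofReal ((1 - r) * p) • (κ 0 : Measure ℝ).map (disc p)
    + ENNReal.ofReal ((1 - r) * (1 - p)) • (κ 1 : Measure ℝ).map (disc p))

theorem discBound_nonneg (hp : 0 < p) (hp' : p < 1) : 0 ≤ discBound p := by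
  have := sub_pos.2 hp'
  rw [discBound]
  positivity

theorem abs_disc_le (hp : 0 < p) (hp' : p < 1) (x : ℝ) : |disc p x| ≤ discBound p := by
  have h1 := one_div_pos.2 hp
  have h2 := one_div_pos.2 (sub_pos.2 hp')
  have h3 := disc_le hp hp' x
  have h4 := le_disc hp hp' x
  rw [discBound, abs_le]
  constructor <;> linarith

theorem abs_one_div_le_discBound (hp : 0 < p) (hp' : p < 1) : |1 / p| ≤ discBound p := by
  have h1 := one_div_pos.2 hp
  have h2 := one_div_pos.2 (sub_pos.2 hp')
  rw [discBound, abs_of_pos h1]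
  linarith

theorem abs_neg_one_div_le_discBound (hp : 0 < p) (hp' : p < 1) :
    |-(1 / (1 - p))| ≤ discBound p := by
  have h1 := one_div_pos.2 hp
  have h2 := one_div_pos.2 (sub_pos.2 hp')
  rw [discBound, abs_neg, abs_of_pos h2]
  linarith

theorem isProbabilityMeasure_childLaw (hp : 0 < p) (hp' : p < 1) (hr : 0 ≤ r) (hr' : r ≤ 1)
    (κ : Label → ProbabilityMeasure ℝ) : IsProbabilityMeasure (childLaw p r κ) := by
  have h1 := sub_pos.2 hp'
  have h2 := sub_nonneg.2 hr'
  have hm := (continuous_disc hp hp').measurable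
  have i0 : IsProbabilityMeasure ((κ 0 : Measure ℝ).map (disc p)) :=
    Measure.isProbabilityMeasure_map hm.aemeasurable
  have i1 : IsProbabilityMeasure ((κ 1 : Measure ℝ).map (disc p)) :=
    Measure.isProbabilityMeasure_map hm.aemeasurable
  constructor
  simp only [childLaw, Measure.coe_add, Measure.coe_smul, Pi.add_apply, Pi.smul_apply,
    measure_univ, smul_eq_mul, mul_one]
  rw [← ENNReal.ofReal_add (by positivity) (by positivity), ← ENNReal.ofReal_add (by positivity)
    (by positivity), ← ENNReal.ofReal_add (by positivity) (by positivity)]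
  simp only [ENNReal.ofReal_eq_one]
  ring

theorem ae_childLaw (hp : 0 < p) (hp' : p < 1) (κ : Label → ProbabilityMeasure ℝ) :
    ∀ᵐ D ∂(childLaw p r κ), |D| ≤ discBound p := by
  have hm := (continuous_disc hp hp').measurable
  have hset : MeasurableSet {D : ℝ | |D| ≤ discBound p} :=
    measurableSet_le (by fun_prop) (by fun_prop)
  have hmap : ∀ y, ∀ᵐ D ∂((κ y : Measure ℝ).map (disc p)), |D| ≤ discBound p := by
    intro y
    rw [ae_map_iff hm.aemeasurable hset]
    exact Eventually.of_forall (abs_disc_le hp hp')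
  rw [childLaw, ae_add_measure_iff, ae_add_measure_iff, ae_add_measure_iff]
  refine ⟨⟨?_, ?_⟩, ?_, ?_⟩ <;> refine Measure.ae_smul_measure ?_ _
  · rw [ae_dirac_iff hset]
    exact abs_one_div_le_discBound hp hp'
  · rw [ae_dirac_iff hset]
    exact abs_neg_one_div_le_discBound hp hp'
  · exact hmap 0
  · exact hmap 1

variable {𝕜 : Type*} [RCLike 𝕜]

theorem integral_childLaw (hp : 0 < p) (hp' : p < 1) (hr : 0 ≤ r) (hr' : r ≤ 1)
    (κ : Label → ProbabilityMeasure ℝ) {g : ℝ → 𝕜} (hg : Measurable g) {C : ℝ}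
    (hC : ∀ D, |D| ≤ discBound p → ‖g D‖ ≤ C) :
    ∫ D, g D ∂(childLaw p r κ) = (r * p) • g (1 / p) + (r * (1 - p)) • g (-(1 / (1 - p)))
      + (((1 - r) * p) • ∫ x, g (disc p x) ∂(κ 0 : Measure ℝ)
      + ((1 - r) * (1 - p)) • ∫ x, g (disc p x) ∂(κ 1 : Measure ℝ)) := by
  have h1 := sub_pos.2 hp'
  have h2 := sub_nonneg.2 hr'
  have hm := (continuous_disc hp hp').measurable
  have hint : ∀ y, Integrable g ((κ y : Measure ℝ).map (disc p)) := by
    intro y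
    rw [integrable_map_measure hg.aestronglyMeasurable hm.aemeasurable]
    exact Integrable.of_bound (hg.comp hm).aestronglyMeasurable C
      (Eventually.of_forall fun x => hC _ (abs_disc_le hp hp' x))
  have hd : ∀ y : ℝ, Integrable g (Measure.dirac y) := fun y => integrable_dirac (by simp)
  rw [childLaw, integral_add_measure
      (((hd _).smul_measure ENNReal.ofReal_ne_top).add_measure
        ((hd _).smul_measure ENNReal.ofReal_ne_top))
      (((hint 0).smul_measure ENNReal.ofReal_ne_top).add_measure
        ((hint 1).smul_measure ENNReal.ofReal_ne_top)),
    integral_add_measure ((hd _).smul_measure ENNReal.ofReal_ne_top)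
      ((hd _).smul_measure ENNReal.ofReal_ne_top),
    integral_add_measure ((hint 0).smul_measure ENNReal.ofReal_ne_top)
      ((hint 1).smul_measure ENNReal.ofReal_ne_top)]
  simp only [integral_smul_measure, integral_dirac]
  rw [integral_map hm.aemeasurable hg.aestronglyMeasurable,
    integral_map hm.aemeasurable hg.aestronglyMeasurable, ENNReal.toReal_ofReal (by positivity),
    ENNReal.toReal_ofReal (by positivity), ENNReal.toReal_ofReal (by positivity),
    ENNReal.toReal_ofReal (by positivity)]

/-- Only the composition of g with `disc p` is asked to be continuous: the logarithms in `tiltChar`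
are well behaved on the range of the discrepancies, not on the whole line. -/
theorem tendsto_integral_childLaw (hp : 0 < p) (hp' : p < 1) (hr : 0 ≤ r) (hr' : r ≤ 1)
    {ι : Type*} {l : Filter ι} {ν : ι → Label → ProbabilityMeasure ℝ}
    {κ : Label → ProbabilityMeasure ℝ} (h : ∀ y, Tendsto (fun k => ν k y) l (𝓝 (κ y))) {g : ℝ → 𝕜}
    (hg : Measurable g) (hgc : Continuous fun x => g (disc p x)) {C : ℝ}
    (hC : ∀ D, |D| ≤ discBound p → ‖g D‖ ≤ C) :
    Tendsto (fun k => ∫ D, g D ∂(childLaw p r (ν k))) l (𝓝 (∫ D, g D ∂(childLaw p r κ))) := by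
  simp_rw [integral_childLaw hp hp' hr hr' _ hg hC]
  have hy : ∀ y, Tendsto (fun k => ∫ x, g (disc p x) ∂(ν k y : Measure ℝ)) l
      (𝓝 (∫ x, g (disc p x) ∂(κ y : Measure ℝ))) := fun y =>
    tendsto_integral_of_tendsto (h y) hgc fun x => hC _ (abs_disc_le hp hp' x)
  exact tendsto_const_nhds.add (((hy 0).const_smul _).add ((hy 1).const_smul _))

end ChildLaw

/-! ### Bounds for a weak signal, which keep the arguments of the logarithms at least 1/2. -/

section TiltBounds

variable {p ε : ℝ}

theorem abs_mul_le_half (hε : |ε| * discBound p ≤ 1 / 2) {D : ℝ} (hD : |D| ≤ discBound p) :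
    |ε * D| ≤ 1 / 2 := by
  rw [abs_mul]
  exact (mul_le_mul_of_nonneg_left hD (abs_nonneg _)).trans hε

theorem half_le_one_add (hp : 0 < p) (hp' : p < 1) {h : ℝ} (hh : |h| ≤ 1 / 2) :
    1 / 2 ≤ 1 + (1 - p) * h := by
  have := abs_le.1 hh
  nlinarith

theorem half_le_one_sub (hp : 0 < p) (hp' : p < 1) {h : ℝ} (hh : |h| ≤ 1 / 2) :
    1 / 2 ≤ 1 - p * h := by
  have := abs_le.1 hh
  nlinarith

theorem tilt_zero_eq (hp : 0 < p) (hp' : p < 1) {h : ℝ} (hh : |h| ≤ 1 / 2) :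
    tilt p 0 h = Real.exp (jump p h) * tilt p 1 h := by
  have h1 := half_le_one_add hp hp' hh
  have h2 := half_le_one_sub hp hp' hh
  have e1 : tilt p 1 h = 1 - p * h := by simp [tilt]; ring
  rw [e1, jump, Real.exp_sub, Real.exp_log (by linarith), Real.exp_log (by linarith),
    div_mul_cancel₀ _ (by linarith)]
  simp [tilt]

theorem norm_tiltChar_le (hp : 0 < p) (hp' : p < 1) (x : Label) (s : ℝ) {h : ℝ}
    (hh : |h| ≤ 1 / 2) : ‖tiltChar p x s h‖ ≤ 2 := by
  have h3 := abs_le.1 hh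
  have e : (s * jump p h * Complex.I : ℂ) = ((s * jump p h : ℝ) : ℂ) * Complex.I := by push_cast; ring
  rw [tiltChar, norm_mul, e, Complex.norm_exp_ofReal_mul_I, mul_one, Complex.norm_real, tilt,
    Real.norm_eq_abs, abs_le]
  split_ifs <;> constructor <;> nlinarith

theorem measurable_tiltChar (p : ℝ) (x : Label) (s ε : ℝ) :
    Measurable fun D => tiltChar p x s (ε * D) := by
  unfold tiltChar tilt jump
  fun_prop

theorem continuous_tiltChar_disc (hp : 0 < p) (hp' : p < 1) (hε : |ε| * discBound p ≤ 1 / 2)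
    (x : Label) (s : ℝ) : Continuous fun y => tiltChar p x s (ε * disc p y) := by
  have hc := continuous_disc hp hp'
  have hJ : Continuous fun y => jump p (ε * disc p y) := by
    unfold jump
    refine (Continuous.log (by fun_prop) fun y => ?_).sub (Continuous.log (by fun_prop) fun y => ?_)
    · have := half_le_one_add hp hp' (abs_mul_le_half hε (abs_disc_le hp hp' y))
      linarith
    · have := half_le_one_sub hp hp' (abs_mul_le_half hε (abs_disc_le hp hp' y))
      linarith
  unfold tiltChar tilt
  fun_prop

theorem continuous_integral_tiltChar (hp : 0 < p) (hp' : p < 1)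
    (hε : |ε| * discBound p ≤ 1 / 2) {r : ℝ} (hr : 0 ≤ r) (hr' : r ≤ 1)
    (κ : Label → ProbabilityMeasure ℝ) (x : Label) :
    Continuous fun s => ∫ D, tiltChar p x s (ε * D) ∂(childLaw p r κ) := by
  have := isProbabilityMeasure_childLaw hp hp' hr hr' κ
  refine continuous_of_dominated (bound := fun _ => 2) (fun s => ?_) (fun s => ?_) (by fun_prop) ?_
  · exact (measurable_tiltChar p x s ε).aestronglyMeasurable
  · filter_upwards [ae_childLaw hp hp' κ] with D hD
    exact norm_tiltChar_le hp hp' x s (abs_mul_le_half hε hD)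
  · refine Eventually.of_forall fun D => ?_
    unfold tiltChar
    fun_prop

end TiltBounds

/-! ### The log-likelihood ratio on the tree. -/

section TreeLaw

variable {p ε : ℝ}

/-- The connectivity matrix with signal `ε`. -/
def blockMatrix (p ε d : ℝ) (n : ℕ) : Matrix Label Label ℝ :=
  connectivity (1 + (1 - p) / p * ε) (1 - ε) (1 + p / (1 - p) * ε) d n

variable {β : Type}

/-- The signed discrepancy of an observed child. -/
def childDisc (p : ℝ) (Λ : β → ℝ) : Option Label × β → ℝ
  | (some z, _) => if z = 0 then 1 / p else -(1 / (1 - p))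
  | (none, b) => disc p (Λ b)

/-- The log-likelihood ratio contributed by a slot. -/
def slotLLR (p ε : ℝ) (Λ : β → ℝ) (s : Option (Option Label × β)) : ℝ :=
  s.elim 0 fun z => jump p (ε * childDisc p Λ z)

/-- The log-likelihood ratio of the root label given a tree observation. -/
def llr (p ε : ℝ) {n : ℕ} : ∀ t, Tree n t → ℝ
  | 0, _ => 0
  | t + 1, ω => ∑ u, slotLLR p ε (llr p ε t) (ω u)

/-- The weight of an observed child, averaged over its label. -/
def childWeight (p r : ℝ) (L : β → Label → ℝ) (z : Option Label × β) : ℝ :=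
  ∑ y, labelWeight p y * revealWeight r y z.1 * L z.2 y

theorem abs_childDisc_le (hp : 0 < p) (hp' : p < 1) (Λ : β → ℝ) (z : Option Label × β) :
    |childDisc p Λ z| ≤ discBound p := by
  rcases z with ⟨_ | y, b⟩
  · exact abs_disc_le hp hp' _
  · simp only [childDisc]
    split_ifs
    · exact abs_one_div_le_discBound hp hp'
    · exact abs_neg_one_div_le_discBound hp hp'

/-- Up to the factor d/n the matrix is one plus ε times a rank one matrix: the entry at (x, y) is 1
+ ε e_x g_y, with e = (1 - p, -p) and g = (1/p, -1/(1 - p)). Averaging over the posterior of y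
replaces g_y by the discrepancy of the observed child. -/
theorem slotWeight_some (hp : 0 < p) (hp' : p < 1) {L : β → Label → ℝ} {Λ : β → ℝ}
    (hL : ∀ b, L b 0 = Real.exp (Λ b) * L b 1) (d : ℝ) (n : ℕ) (r : ℝ) (x : Label)
    (z : Option Label × β) :
    slotWeight (blockMatrix p ε d n) (d / n) p L r x (some z)
      = d / n * (childWeight p r L z * tilt p x (ε * childDisc p Λ z)) := by
  have h1 := (sub_pos.2 hp').ne'
  have h0 := hp.ne'
  rcases z with ⟨_ | y, b⟩
  · have h2 := (mix_exp_pos hp hp' (Λ b)).ne'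
    revert x
    rw [Fin.forall_fin_two]
    constructor <;>
    · simp only [slotWeight, Option.elim, childWeight, Fin.sum_univ_two, childDisc, disc, hL,
        blockMatrix, connectivity, tilt, labelWeight, revealWeight]
      simp
      field_simp
      ring
  · revert x y
    rw [Fin.forall_fin_two]
    constructor <;>
    · rw [Fin.forall_fin_two]
      constructor <;>
      · simp only [slotWeight, Option.elim, childWeight, Fin.sum_univ_two, childDisc,
          blockMatrix, connectivity, tilt, labelWeight, revealWeight]
        simp
        field_simp
        try ring

/-- Likelihoods multiply over the slots, and an occupied slot contributes the ratio of the two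
tilts, whose logarithm is `jump`. An absent slot contributes nothing, as its weight does not depend
on the label of the parent. -/
theorem lik_zero_eq (hp : 0 < p) (hp' : p < 1) (hε : |ε| * discBound p ≤ 1 / 2) (d : ℝ)
    (q : ℕ → ℝ) (n t : ℕ) (ω : Tree n t) :
    lik (blockMatrix p ε d n) (d / n) p q t ω 0
      = Real.exp (llr p ε t ω) * lik (blockMatrix p ε d n) (d / n) p q t ω 1 := by
  induction t with
  | zero => simp [lik, llr]
  | succ t ih =>
    simp only [lik, llr]
    rw [Real.exp_sum, ← Finset.prod_mul_distrib]
    refine Finset.prod_congr rfl fun u _ => ?_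
    rcases ω u with _ | z
    · simp [slotWeight, slotLLR]
    · rw [slotWeight_some hp hp' ih, slotWeight_some hp hp' ih,
        tilt_zero_eq hp hp' (abs_mul_le_half hε (abs_childDisc_le hp hp' _ z))]
      simp only [slotLLR, Option.elim]
      ring

/-- The law of the log-likelihood ratio of the root at depth `t`, given the label of the root. -/
def treeLaw (p ε d : ℝ) (q : ℕ → ℝ) (n t : ℕ) (x : Label) : ProbabilityMeasure ℝ :=
  finLaw (fun ω : Tree n t => lik (blockMatrix p ε d n) (d / n) p q t ω x) (llr p ε t)

/-- This identifies `childLaw` as the law of the discrepancy of an observed child, and so closes the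
recursion on laws of log-likelihood ratios. -/
theorem sum_childWeight [Fintype β] (hp : 0 < p) (hp' : p < 1) {r : ℝ} (hr : 0 ≤ r) (hr' : r ≤ 1)
    {L : β → Label → ℝ} (hL : ∀ b y, 0 ≤ L b y) (hL1 : ∀ y, ∑ b, L b y = 1) (Λ : β → ℝ)
    {𝕜 : Type*} [RCLike 𝕜] {g : ℝ → 𝕜} (hg : Measurable g) {C : ℝ}
    (hC : ∀ D, |D| ≤ discBound p → ‖g D‖ ≤ C) :
    ∑ z, (childWeight p r L z : 𝕜) * g (childDisc p Λ z)
      = ∫ D, g D ∂(childLaw p r fun y => finLaw (fun b => L b y) Λ) := by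
  rw [integral_childLaw hp hp' hr hr' _ hg hC, integral_finLaw (fun b => hL b 0) (hL1 0),
    integral_finLaw (fun b => hL b 1) (hL1 1), Fintype.sum_prod_type, Fintype.sum_option,
    Fin.sum_univ_two]
  have e0 : ∀ b, childWeight p r L (some 0, b) = (r * p) * L b 0 := by
    intro b
    simp [childWeight, labelWeight, revealWeight]
    left; ring
  have e1 : ∀ b, childWeight p r L (some 1, b) = (r * (1 - p)) * L b 1 := by
    intro b
    simp [childWeight, labelWeight, revealWeight]
    left; ring
  have e2 : ∀ b, childWeight p r L (none, b)
      = (1 - r) * p * L b 0 + (1 - r) * (1 - p) * L b 1 := by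
    intro b
    simp [childWeight, Fin.sum_univ_two, labelWeight, revealWeight]
    ring
  simp only [e0, e1, e2, childDisc, ← Finset.sum_mul, ← RCLike.ofReal_sum, ← Finset.mul_sum, hL1,
    RCLike.real_smul_eq_coe_mul, RCLike.ofReal_add, RCLike.ofReal_mul, add_mul,
    Finset.sum_add_distrib, mul_assoc]
  simp only [if_true, one_ne_zero, if_false, RCLike.ofReal_one]
  ring

end TreeLaw


/-! ### Compound Poisson limit as the number of vertices grows. -/

section TreeLimit

variable {p ε d : ℝ} {q : ℕ → ℝ} {n : ℕ}

theorem sum_labelWeight_mul_blockMatrix (hp : 0 < p) (hp' : p < 1) (x : Label) :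
    ∑ y, labelWeight p y * blockMatrix p ε d n x y = d / n := by
  have h1 := (sub_pos.2 hp').ne'
  have h0 := hp.ne'
  revert x
  rw [Fin.forall_fin_two]
  constructor <;>
  · simp [labelWeight, blockMatrix, connectivity]
    field_simp
    ring

theorem entries_nonneg (hp : 0 < p) (hp' : p < 1) (hε : |ε| * discBound p ≤ 1 / 2) :
    0 ≤ 1 + (1 - p) / p * ε ∧ 0 ≤ 1 - ε ∧ 0 ≤ 1 + p / (1 - p) * ε := by
  have h1 := abs_mul_le_half hε (abs_one_div_le_discBound hp hp')
  have h2 := abs_mul_le_half hε (abs_neg_one_div_le_discBound hp hp')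
  have e1 : 1 + (1 - p) / p * ε = 1 + (1 - p) * (ε * (1 / p)) := by ring
  have e2 : 1 + p / (1 - p) * ε = 1 - p * (ε * -(1 / (1 - p))) := by ring
  have e3 : 1 - ε = 1 - p * (ε * (1 / p)) := by field_simp
  refine ⟨?_, ?_, ?_⟩
  · rw [e1]; linarith [half_le_one_add hp hp' h1]
  · rw [e3]; linarith [half_le_one_sub hp hp' h1]
  · rw [e2]; linarith [half_le_one_sub hp hp' h2]

theorem blockMatrix_nonneg (hp : 0 < p) (hp' : p < 1) (hε : |ε| * discBound p ≤ 1 / 2)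
    (hd : 0 ≤ d) (x y : Label) : 0 ≤ blockMatrix p ε d n x y := by
  obtain ⟨h1, h2, h3⟩ := entries_nonneg hp hp' hε
  have h4 : 0 ≤ d / (n : ℝ) := by positivity
  revert x y
  simp only [Fin.forall_fin_two]
  simp only [blockMatrix, connectivity, Matrix.smul_apply, smul_eq_mul]
  refine ⟨⟨mul_nonneg h4 ?_, mul_nonneg h4 ?_⟩, mul_nonneg h4 ?_, mul_nonneg h4 ?_⟩ <;> simp <;>
    linarith

theorem div_natCast_le_one (hd : 0 < d) (hn : d ≤ n) : d / (n : ℝ) ≤ 1 := by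
  rw [div_le_one (hd.trans_le hn)]
  exact hn

section Fixed

variable (hp : 0 < p) (hp' : p < 1) (hε : |ε| * discBound p ≤ 1 / 2) (hd : 0 < d)
  (hq : ∀ t, 0 ≤ q t) (hq' : ∀ t, q t ≤ 1)
include hp hp' hε hd hq hq'

theorem blockLik_nonneg (hn : d ≤ n) (t : ℕ) (ω : Tree n t) (x : Label) :
    0 ≤ lik (blockMatrix p ε d n) (d / n) p q t ω x :=
  lik_nonneg hp.le hp'.le (blockMatrix_nonneg hp hp' hε hd.le) (div_natCast_le_one hd hn) hq hq' t ω x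

/-- Given the root label the n slots are independent and identically distributed, each occupied with
probability d/n, and the tilt is the change of law due to that label. -/
theorem charFun_treeLaw_succ (hn : d ≤ n) (t : ℕ) (x : Label) (s : ℝ) :
    charFun (treeLaw p ε d q n (t + 1) x : Measure ℝ) s
      = (1 + (d / n : ℝ) * (∫ D, tiltChar p x s (ε * D) ∂(childLaw p (q t) (treeLaw p ε d q n t))
        - 1)) ^ n := by
  have hnn := fun t ω x => blockLik_nonneg hp hp' hε hd hq hq' hn t ω x
  have hsum : ∀ t x, ∑ ω : Tree n t, lik (blockMatrix p ε d n) (d / n) p q t ω x = 1 := fun t x =>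
    sum_lik (fun x => sum_labelWeight_mul_blockMatrix hp hp' x) t x
  rw [treeLaw, charFun_finLaw (fun ω => hnn _ ω x) (hsum _ x)]
  have hterm : ∀ ω : Tree n (t + 1), (lik (blockMatrix p ε d n) (d / n) p q (t + 1) ω x : ℂ)
      * Complex.exp (s * llr p ε (t + 1) ω * Complex.I)
      = ∏ u, ((slotWeight (blockMatrix p ε d n) (d / n) p
          (lik (n := n) (blockMatrix p ε d n) (d / n) p q t) (q t) x (ω u) : ℂ)
        * Complex.exp (s * slotLLR p ε (llr p ε t) (ω u) * Complex.I)) := by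
    intro ω
    rw [Finset.prod_mul_distrib, ← Complex.exp_sum]
    simp only [lik, llr]
    push_cast
    rw [← Finset.sum_mul, ← Finset.mul_sum]
  rw [Finset.sum_congr rfl fun ω _ => hterm ω]
  have hpow : ∀ F : Option (Option Label × Tree n t) → ℂ,
      ∑ ω : Tree n (t + 1), ∏ u : Fin n, F (ω u) = (∑ z, F z) ^ n := by
    intro F
    have h := (Finset.prod_univ_sum (fun _ : Fin n => Finset.univ) fun _ z => F z).symm
    rw [Fintype.piFinset_univ] at h
    rw [Finset.prod_const, Finset.card_univ, Fintype.card_fin] at h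
    exact h
  rw [hpow fun z => (slotWeight (blockMatrix p ε d n) (d / n) p
          (lik (n := n) (blockMatrix p ε d n) (d / n) p q t) (q t) x z : ℂ)
        * Complex.exp (s * slotLLR p ε (llr p ε t) z * Complex.I)]
  congr 1
  rw [Fintype.sum_option]
  have hsome : ∀ z : Option Label × Tree n t, (slotWeight (blockMatrix p ε d n) (d / n) p
          (lik (n := n) (blockMatrix p ε d n) (d / n) p q t) (q t) x (some z) : ℂ)
        * Complex.exp (s * slotLLR p ε (llr p ε t) (some z) * Complex.I)
      = ((d / n : ℝ) : ℂ) * ((childWeight p (q t)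
          (lik (n := n) (blockMatrix p ε d n) (d / n) p q t) z : ℂ)
        * tiltChar p x s (ε * childDisc p (llr p ε t) z)) := by
    intro z
    rw [slotWeight_some hp hp' (lik_zero_eq hp hp' hε d q n t), tiltChar]
    simp only [slotLLR, Option.elim]
    push_cast
    ring
  rw [Finset.sum_congr rfl fun z _ => hsome z, ← Finset.mul_sum]
  have hchild := sum_childWeight hp hp' (hq t) (hq' t) (hnn t) (hsum t)
    (llr p ε t) (measurable_tiltChar p x s ε) (C := 2) fun D hD =>
      norm_tiltChar_le hp hp' x s (abs_mul_le_half hε hD)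
  simp only [RCLike.ofReal_eq_complex_ofReal] at hchild
  rw [hchild]
  simp only [slotWeight, slotLLR, Option.elim]
  change _ = 1 + ((d / n : ℝ) : ℂ) * (∫ D, tiltChar p x s (ε * D) ∂(childLaw p (q t) fun y =>
    finLaw (fun ω : Tree n t => lik (blockMatrix p ε d n) (d / n) p q t ω y) (llr p ε t)) - 1)
  push_cast
  simp
  ring

/-- Weighted by its posterior odds, each hidden observation contributes the difference of its two
likelihoods, and both sum to one; the two revealed values cancel likewise. This removes the linear
term of `tiltChar_expansion`, which would diverge with d. -/
theorem integral_childLaw_treeLaw (hn : d ≤ n) (t : ℕ) :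
    ∫ D, D ∂(childLaw p (q t) (treeLaw p ε d q n t)) = 0 := by
  have hnn := fun t ω x => blockLik_nonneg hp hp' hε hd hq hq' hn t ω x
  have hsum : ∀ t x, ∑ ω : Tree n t, lik (blockMatrix p ε d n) (d / n) p q t ω x = 1 := fun t x =>
    sum_lik (fun x => sum_labelWeight_mul_blockMatrix hp hp' x) t x
  have h1 := (sub_pos.2 hp').ne'
  have h0 := hp.ne'
  rw [integral_childLaw (𝕜 := ℝ) hp hp' (hq t) (hq' t) _ (g := fun D => D) measurable_id
    (C := discBound p) fun D hD => hD]
  simp only [treeLaw]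
  rw [integral_finLaw (fun ω => hnn t ω 0) (hsum t 0), integral_finLaw (fun ω => hnn t ω 1) (hsum t 1)]
  have hkey : p * ∑ ω : Tree n t, lik (blockMatrix p ε d n) (d / n) p q t ω 0 * disc p (llr p ε t ω)
      + (1 - p) * ∑ ω : Tree n t, lik (blockMatrix p ε d n) (d / n) p q t ω 1
        * disc p (llr p ε t ω) = 0 := by
    rw [Finset.mul_sum, Finset.mul_sum, ← Finset.sum_add_distrib]
    have hd : ∀ ω : Tree n t, p * (lik (blockMatrix p ε d n) (d / n) p q t ω 0
        * disc p (llr p ε t ω)) + (1 - p) * (lik (blockMatrix p ε d n) (d / n) p q t ω 1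
        * disc p (llr p ε t ω)) = lik (blockMatrix p ε d n) (d / n) p q t ω 0
          - lik (blockMatrix p ε d n) (d / n) p q t ω 1 := by
      intro ω
      have := (mix_exp_pos hp hp' (llr p ε t ω)).ne'
      rw [lik_zero_eq hp hp' hε, disc]
      field_simp
    rw [Finset.sum_congr rfl fun ω _ => hd ω, Finset.sum_sub_distrib, hsum, hsum, sub_self]
  simp only [smul_eq_mul]
  have e : q t * p * (1 / p) + q t * (1 - p) * -(1 / (1 - p)) = 0 := by
    field_simp
    ring
  rw [e]
  linear_combination (1 - q t) * hkey

theorem treeValue_eq_integral (hn : d ≤ n) (t : ℕ) :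
    treeValue n (blockMatrix p ε d n) (d / n) p q t
      = ∫ x, max 0 (1 - Real.exp (-x)) ∂(treeLaw p ε d q n t 0 : Measure ℝ) := by
  have hnn := fun t ω x => blockLik_nonneg hp hp' hε hd hq hq' hn t ω x
  have hsum : ∀ t x, ∑ ω : Tree n t, lik (blockMatrix p ε d n) (d / n) p q t ω x = 1 := fun t x =>
    sum_lik (fun x => sum_labelWeight_mul_blockMatrix hp hp' x) t x
  rw [treeLaw, integral_finLaw (fun ω => hnn t ω 0) (hsum t 0), treeValue]
  refine Finset.sum_congr rfl fun ω _ => ?_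
  rw [smul_eq_mul, mul_max_of_nonneg _ _ (hnn t ω 0), mul_zero]
  congr 1
  rw [mul_sub, mul_one]
  congr 1
  rw [lik_zero_eq hp hp' hε, Real.exp_neg]
  have := Real.exp_pos (llr p ε t ω)
  field_simp

/-- As `n → ∞` the laws of the log-likelihood ratios converge, to compound Poisson laws. -/
theorem exists_treeLimit : ∃ κ : ℕ → Label → ProbabilityMeasure ℝ,
    (∀ t x, Tendsto (fun n : ℕ => treeLaw p ε d q n t x) atTop (𝓝 (κ t x)))
    ∧ (∀ x s, charFun (κ 0 x : Measure ℝ) s = 1)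
    ∧ (∀ t x s, charFun (κ (t + 1) x : Measure ℝ) s
      = Complex.exp (d * (∫ D, tiltChar p x s (ε * D) ∂(childLaw p (q t) (κ t)) - 1)))
    ∧ ∀ t, ∫ D, D ∂(childLaw p (q t) (κ t)) = 0 := by
  have hev : ∀ᶠ n : ℕ in atTop, d ≤ n := by
    obtain ⟨N, hN⟩ := exists_nat_ge d
    filter_upwards [eventually_ge_atTop N] with n hn
    exact hN.trans (by exact_mod_cast hn)
  have hstep : ∀ (t : ℕ) (κ : Label → ProbabilityMeasure ℝ),
      (∀ y, Tendsto (fun n : ℕ => treeLaw p ε d q n t y) atTop (𝓝 (κ y))) → ∀ x s,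
      Tendsto (fun n : ℕ => charFun (treeLaw p ε d q n (t + 1) x : Measure ℝ) s) atTop
        (𝓝 (Complex.exp (d * (∫ D, tiltChar p x s (ε * D) ∂(childLaw p (q t) κ) - 1)))) := by
    intro t κ hκ x s
    have hlim := tendsto_integral_childLaw hp hp' (hq t) (hq' t) hκ (measurable_tiltChar p x s ε)
      (continuous_tiltChar_disc hp hp' hε x s) (C := 2) fun D hD =>
        norm_tiltChar_le hp hp' x s (abs_mul_le_half hε hD)
    have hmul := (hlim.sub_const 1).const_mul (d : ℂ)
    -- The Poisson limit: (1 + z_n / n)^n tends to exp z when z_n tends to z.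
    refine (Complex.tendsto_one_add_pow_exp_of_tendsto (g := fun n : ℕ => ((d / n : ℝ) : ℂ)
      * (∫ D, tiltChar p x s (ε * D) ∂(childLaw p (q t) (treeLaw p ε d q n t)) - 1))
      (hmul.congr' ?_)).congr' ?_
    · filter_upwards [eventually_gt_atTop 0] with n hn
      have : (n : ℂ) ≠ 0 := by exact_mod_cast hn.ne'
      push_cast
      field_simp
    · filter_upwards [hev] with n hn
      exact (charFun_treeLaw_succ hp hp' hε hd hq hq' hn t x s).symm
  have hzero : ∀ x s, Tendsto (fun n : ℕ => charFun (treeLaw p ε d q n 0 x : Measure ℝ) s) atTop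
      (𝓝 1) := by
    intro x s
    refine tendsto_const_nhds.congr' ?_
    filter_upwards [hev] with n hn
    rw [treeLaw, charFun_finLaw (fun ω => blockLik_nonneg hp hp' hε hd hq hq' hn 0 ω x)
      (sum_lik (fun x => sum_labelWeight_mul_blockMatrix hp hp' x) 0 x)]
    simp [lik, llr]
  have hex : ∀ t, ∃ κ : Label → ProbabilityMeasure ℝ,
      ∀ x, Tendsto (fun n : ℕ => treeLaw p ε d q n t x) atTop (𝓝 (κ x)) := by
    intro t
    induction t with
    | zero =>
      choose κ hκ using fun x => exists_tendsto_of_tendsto_charFun continuousAt_const (hzero x)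
      exact ⟨κ, fun x => (hκ x).2⟩
    | succ t ih =>
      obtain ⟨κ₀, hκ₀⟩ := ih
      have hcont : ∀ x, ContinuousAt (fun s : ℝ =>
          Complex.exp (d * (∫ D, tiltChar p x s (ε * D) ∂(childLaw p (q t) κ₀) - 1))) 0 := by
        intro x
        have := continuous_integral_tiltChar hp hp' hε (hq t) (hq' t) κ₀ x
        exact (Complex.continuous_exp.comp
          (continuous_const.mul (this.sub continuous_const))).continuousAt
      choose κ hκ using fun x => exists_tendsto_of_tendsto_charFun (hcont x) (hstep t κ₀ hκ₀ x)
      exact ⟨κ, fun x => (hκ x).2⟩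
  choose κ hκ using hex
  have hchar : ∀ t x s, Tendsto (fun n : ℕ => charFun (treeLaw p ε d q n t x : Measure ℝ) s) atTop
      (𝓝 (charFun (κ t x : Measure ℝ) s)) := fun t x s =>
    ProbabilityMeasure.tendsto_iff_tendsto_charFun.1 (hκ t x) s
  refine ⟨κ, hκ, fun x s => tendsto_nhds_unique (hchar 0 x s) (hzero x s),
    fun t x s => tendsto_nhds_unique (hchar (t + 1) x s) (hstep t (κ t) (hκ t) x s), fun t => ?_⟩
  have hlim := tendsto_integral_childLaw (𝕜 := ℝ) hp hp' (hq t) (hq' t) (hκ t) measurable_id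
    (continuous_disc hp hp') (C := discBound p) fun D hD => hD
  refine tendsto_nhds_unique hlim (tendsto_const_nhds.congr' ?_)
  filter_upwards [hev] with n hn
  exact (integral_childLaw_treeLaw hp hp' hε hd hq hq' hn t).symm

end Fixed

end TreeLimit


/-! ### Gaussian limit as the degree grows, and conclusion on the tree. -/

section DenseLimit

variable {p lam : ℝ} {q : ℕ → ℝ}

/-- The Gaussian limit of the law of the log-likelihood ratio, given the label of the root. -/
def gaussLaw (μ : ℝ) (x : Label) : ProbabilityMeasure ℝ :=
  ⟨gaussianReal (if x = 0 then μ / 2 else -(μ / 2)) μ.toNNReal, inferInstance⟩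

theorem charFun_gaussLaw {μ : ℝ} (hμ : 0 ≤ μ) (x : Label) (s : ℝ) :
    charFun (gaussLaw μ x : Measure ℝ) s = Complex.exp (driftCoeff x s * μ) := by
  change charFun (gaussianReal (if x = 0 then μ / 2 else -(μ / 2)) μ.toNNReal) s = _
  rw [charFun_gaussianReal, driftCoeff]
  congr 1
  have : ((μ.toNNReal : ℝ) : ℂ) = μ := by rw [Real.coe_toNNReal _ hμ]
  rw [this]
  split_ifs <;> push_cast <;> ring

/-- Expand at h = ε D. The constant cancels, the linear term vanishes as D is centered, and the
quadratic term carries d ε² = λ. Since D is bounded, the remainder is d times o(ε²), which tends to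
0. -/
theorem tendsto_mul_integral_tiltChar (hp : 0 < p) (hp' : p < 1) {ι : Type*} {l : Filter ι}
    {d ε : ι → ℝ} {ρ : ι → Measure ℝ} {m : ℝ} (hε : Tendsto ε l (𝓝 0))
    (hd : ∀ᶠ k in l, 0 < d k ∧ d k * ε k ^ 2 = lam) (hρ : ∀ᶠ k in l, IsProbabilityMeasure (ρ k)
      ∧ (∀ᵐ D ∂(ρ k), |D| ≤ discBound p) ∧ ∫ D, D ∂(ρ k) = 0)
    (hm : Tendsto (fun k => ∫ D, D ^ 2 ∂(ρ k)) l (𝓝 m)) (x : Label) (s : ℝ) :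
    Tendsto (fun k => (d k : ℂ) * (∫ D, tiltChar p x s (ε k * D) ∂(ρ k) - 1)) l
      (𝓝 (driftCoeff x s * ((lam * m : ℝ) : ℂ))) := by
  obtain ⟨c, hR⟩ := tiltChar_expansion p x s
  set B := discBound p with hB
  have hB0 : 0 ≤ B := discBound_nonneg hp hp'
  set R : ℝ → ℂ := fun h => tiltChar p x s h - 1 - c * h - driftCoeff x s * h ^ 2 with hRdef
  have hsmall : ∀ δ : ℝ, 0 < δ → ∀ᶠ k in l, |ε k| * B ≤ δ := by
    intro δ hδ
    have h1 : Tendsto (fun k => |ε k| * B) l (𝓝 0) := by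
      simpa using hε.abs.mul_const B
    exact h1.eventually_le_const hδ
  have hrem : Tendsto (fun k => (d k : ℂ) * ∫ D, R (ε k * D) ∂(ρ k)) l (𝓝 0) := by
    rw [Metric.tendsto_nhds]
    intro η hη
    rcases l.eq_or_neBot with rfl | hl
    · simp
    obtain ⟨k₀, hk₀⟩ := hd.exists
    have hlam : 0 ≤ lam := hk₀.2 ▸ mul_nonneg hk₀.1.le (sq_nonneg _)
    set θ := η / (2 * (lam * B ^ 2 + 1)) with hθ
    have hden : 0 < lam * B ^ 2 + 1 := by positivity
    have hθ0 : 0 < θ := by positivity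
    obtain ⟨δ, hδ, hb⟩ := Metric.eventually_nhds_iff.1 (hR.bound hθ0)
    filter_upwards [hsmall (δ / 2) (by positivity), hd, hρ] with k hk hdk hρk
    obtain ⟨hprob, hae, -⟩ := hρk
    have hbound : ‖∫ D, R (ε k * D) ∂(ρ k)‖ ≤ θ * (ε k ^ 2 * B ^ 2) := by
      refine (norm_integral_le_of_norm_le_const (C := θ * (ε k ^ 2 * B ^ 2)) ?_).trans (by simp)
      filter_upwards [hae] with D hD
      have h1 : |ε k * D| ≤ |ε k| * B := by
        rw [abs_mul]
        exact mul_le_mul_of_nonneg_left hD (abs_nonneg _)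
      refine (hb (y := ε k * D) (by rw [Real.dist_eq, sub_zero]; linarith)).trans ?_
      rw [Real.norm_eq_abs, abs_pow, ← sq_abs (ε k), ← mul_pow]
      exact mul_le_mul_of_nonneg_left (pow_le_pow_left₀ (abs_nonneg _) h1 2) hθ0.le
    rw [dist_zero_right, norm_mul, Complex.norm_real, Real.norm_eq_abs, abs_of_pos hdk.1]
    calc d k * ‖∫ D, R (ε k * D) ∂(ρ k)‖ ≤ d k * (θ * (ε k ^ 2 * B ^ 2)) :=
          mul_le_mul_of_nonneg_left hbound hdk.1.le
      _ = θ * (lam * B ^ 2) := by rw [← hdk.2]; ring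
      _ < η := by
        rw [hθ, div_mul_eq_mul_div, div_lt_iff₀ (by positivity)]
        nlinarith
  have hmain : Tendsto (fun k => driftCoeff x s * ((lam * ∫ D, D ^ 2 ∂(ρ k) : ℝ) : ℂ)) l
      (𝓝 (driftCoeff x s * ((lam * m : ℝ) : ℂ))) :=
    ((Complex.continuous_ofReal.tendsto _).comp (hm.const_mul lam)).const_mul _
  have hsum := hrem.add hmain
  rw [zero_add] at hsum
  refine hsum.congr' ?_
  filter_upwards [hsmall (1 / 2) (by norm_num), hd, hρ] with k hk hdk hρk
  obtain ⟨hprob, hae, hmean⟩ := hρk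
  have iψ : Integrable (fun D => tiltChar p x s (ε k * D)) (ρ k) := by
    refine Integrable.of_bound (measurable_tiltChar p x s (ε k)).aestronglyMeasurable 2 ?_
    filter_upwards [hae] with D hD
    exact norm_tiltChar_le hp hp' x s (abs_mul_le_half hk hD)
  have iD : Integrable (fun D : ℝ => D) (ρ k) :=
    Integrable.of_bound measurable_id.aestronglyMeasurable B hae
  have iD2 : Integrable (fun D : ℝ => D ^ 2) (ρ k) := by
    refine Integrable.of_bound (by fun_prop) (B ^ 2) ?_
    filter_upwards [hae] with D hD
    rw [Real.norm_eq_abs, abs_pow]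
    exact pow_le_pow_left₀ (abs_nonneg _) hD 2
  have iDc : Integrable (fun D : ℝ => c * ε k * (D : ℂ)) (ρ k) := iD.ofReal.const_mul _
  have iD2c : Integrable (fun D : ℝ => driftCoeff x s * ε k ^ 2 * ((D ^ 2 : ℝ) : ℂ)) (ρ k) :=
    iD2.ofReal.const_mul _
  have i1 : Integrable (fun D : ℝ => tiltChar p x s (ε k * D) - 1) (ρ k) :=
    iψ.sub (integrable_const 1)
  have i2 : Integrable (fun D : ℝ => tiltChar p x s (ε k * D) - 1 - c * ε k * (D : ℂ)) (ρ k) :=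
    i1.sub iDc
  have hI : ∫ D, R (ε k * D) ∂(ρ k) = ∫ D, tiltChar p x s (ε k * D) ∂(ρ k) - 1
      - driftCoeff x s * ε k ^ 2 * ((∫ D, D ^ 2 ∂(ρ k) : ℝ) : ℂ) := by
    have hpt : ∀ D : ℝ, R (ε k * D) = tiltChar p x s (ε k * D) - 1 - c * ε k * (D : ℂ)
        - driftCoeff x s * ε k ^ 2 * ((D ^ 2 : ℝ) : ℂ) := by
      intro D
      simp only [hRdef]
      push_cast
      ring
    simp_rw [hpt]
    rw [integral_sub i2 iD2c, integral_sub i1 iDc, integral_sub iψ (integrable_const 1),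
      integral_const_mul, integral_const_mul, integral_complex_ofReal, integral_complex_ofReal,
      hmean]
    simp
  rw [hI, ← hdk.2]
  push_cast
  ring

/-- One step of `evo`: a revealed label has second moment p / p² + (1 - p) / (1 - p)² = 1 / (p (1 -
p)), and a hidden one gives G by `gaussMap_eq_integral_disc`. -/
theorem integral_sq_childLaw_gaussLaw (hp : 0 < p) (hp' : p < 1) (hlam : 0 < lam) {r : ℝ}
    (hr : 0 ≤ r) (hr' : r ≤ 1) {μ : ℝ} (hμ : 0 ≤ μ) :
    lam * ∫ D, D ^ 2 ∂(childLaw p r (gaussLaw μ))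
      = r * (lam / (p * (1 - p))) + (1 - r) * gaussMap p lam μ := by
  have h1 := (sub_pos.2 hp').ne'
  have h0 := hp.ne'
  have hG := gaussMap_eq_integral_disc hp hp' lam hμ
  rw [integral_childLaw (𝕜 := ℝ) hp hp' hr hr' _ (g := fun D => D ^ 2) (by fun_prop)
    (C := discBound p ^ 2) fun D hD => by
      rw [norm_pow, Real.norm_eq_abs]; exact pow_le_pow_left₀ (abs_nonneg _) hD 2, hG]
  have e0 : (gaussLaw μ 0 : Measure ℝ) = gaussianReal (μ / 2) μ.toNNReal := rfl
  have e1 : (gaussLaw μ 1 : Measure ℝ) = gaussianReal (-(μ / 2)) μ.toNNReal := rfl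
  rw [e0, e1]
  simp only [smul_eq_mul]
  field_simp
  ring

/-- As `d → ∞` the limiting laws of the log-likelihood ratios become Gaussian. -/
theorem tendsto_gaussLaw (hp : 0 < p) (hp' : p < 1) (hlam : 0 < lam) (hq : ∀ t, 0 ≤ q t)
    (hq' : ∀ t, q t ≤ 1) {d ε : ℕ → ℝ} {κ : ℕ → ℕ → Label → ProbabilityMeasure ℝ}
    (hε : Tendsto ε atTop (𝓝 0)) (hd : ∀ᶠ k in atTop, 0 < d k ∧ d k * ε k ^ 2 = lam)
    (hκ : ∀ᶠ k in atTop, (∀ x s, charFun (κ k 0 x : Measure ℝ) s = 1)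
      ∧ (∀ t x s, charFun (κ k (t + 1) x : Measure ℝ) s
        = Complex.exp (d k * (∫ D, tiltChar p x s (ε k * D) ∂(childLaw p (q t) (κ k t)) - 1)))
      ∧ ∀ t, ∫ D, D ∂(childLaw p (q t) (κ k t)) = 0) (t : ℕ) (x : Label) :
    Tendsto (fun k => κ k t x) atTop (𝓝 (gaussLaw (evo p lam q t) x)) := by
  induction t generalizing x with
  | zero =>
    rw [ProbabilityMeasure.tendsto_iff_tendsto_charFun]
    intro s
    refine tendsto_const_nhds.congr' ?_
    filter_upwards [hκ] with k hk
    rw [hk.1, evo, charFun_gaussLaw le_rfl]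
    simp
  | succ t ih =>
    rw [ProbabilityMeasure.tendsto_iff_tendsto_charFun]
    intro s
    have hμ := evo_nonneg (lam := lam) hp hp' hlam.le hq hq' t
    have hm := tendsto_integral_childLaw (𝕜 := ℝ) hp hp' (hq t) (hq' t) ih
      (g := fun D => D ^ 2) (by fun_prop) ((continuous_disc hp hp').pow 2) (C := discBound p ^ 2)
      fun D hD => by rw [norm_pow, Real.norm_eq_abs]; exact pow_le_pow_left₀ (abs_nonneg _) hD 2
    have hlim := tendsto_mul_integral_tiltChar hp hp' hε hd (ρ := fun k => childLaw p (q t) (κ k t))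
      (hκ.mono fun k hk => ⟨isProbabilityMeasure_childLaw hp hp' (hq t) (hq' t) _,
        ae_childLaw hp hp' _, hk.2.2 t⟩) hm x s
    rw [integral_sq_childLaw_gaussLaw hp hp' hlam (hq t) (hq' t) hμ] at hlim
    rw [charFun_gaussLaw (evo_nonneg hp hp' hlam.le hq hq' (t + 1))]
    refine ((Complex.continuous_exp.tendsto _).comp hlim).congr' ?_
    filter_upwards [hκ] with k hk
    exact (hk.2.1 t x s).symm

/-- Only |ε d| = √(λ / d) is determined; the sign may vary with d. -/
theorem tendsto_signal {ε : ℝ → ℝ} (hε : ∀ d, 0 < d → d * ε d ^ 2 = lam) :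
    Tendsto ε atTop (𝓝 0) := by
  have h1 : Tendsto (fun d : ℝ => Real.sqrt (lam / d)) atTop (𝓝 0) := by
    have := (Real.continuous_sqrt.tendsto 0).comp (tendsto_const_nhds.div_atTop (tendsto_id) :
      Tendsto (fun d : ℝ => lam / d) atTop (𝓝 0))
    simpa [Function.comp_def] using this
  rw [tendsto_zero_iff_abs_tendsto_zero]
  refine h1.congr' ?_
  filter_upwards [eventually_gt_atTop 0] with d hd
  have h2 : lam / d = ε d ^ 2 := by rw [← hε d hd]; field_simp
  rw [h2, Real.sqrt_sq_eq_abs]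
  rfl

/-- The two successive limits of the success probability of belief propagation on the tree. -/
theorem exists_tendsto_treeValue (hp : 0 < p) (hp' : p < 1) (hlam : 0 < lam)
    (hq : ∀ t, 0 ≤ q t) (hq' : ∀ t, q t ≤ 1) {ε : ℝ → ℝ}
    (hε : ∀ d, 0 < d → d * ε d ^ 2 = lam) :
    ∃ ℓ : ℕ → ℝ → ℝ,
      (∀ᶠ d in atTop, ∀ t, Tendsto (fun n : ℕ => treeValue n (blockMatrix p (ε d) d n) (d / n) p q t)
        atTop (𝓝 (ℓ t d)))
      ∧ ∀ t, Tendsto (ℓ t) atTop (𝓝 (gaussGain (evo p lam q t))) := by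
  have hε0 := tendsto_signal hε
  have hmild : ∀ᶠ d in atTop, 0 < d ∧ |ε d| * discBound p ≤ 1 / 2 := by
    have h1 : Tendsto (fun d => |ε d| * discBound p) atTop (𝓝 0) := by
      simpa using hε0.abs.mul_const (discBound p)
    exact (eventually_gt_atTop 0).and (h1.eventually_le_const (by norm_num))
  obtain ⟨κ, hκ⟩ := (hmild.mono fun d hd => exists_treeLimit hp hp' hd.2 hd.1 hq hq').choice
  have hcont : Continuous fun x : ℝ => max 0 (1 - Real.exp (-x)) := by fun_prop
  have hbd : ∀ x : ℝ, ‖max 0 (1 - Real.exp (-x))‖ ≤ 1 := by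
    intro x
    rw [Real.norm_eq_abs, abs_of_nonneg (le_max_left _ _)]
    exact max_le zero_le_one (by linarith [Real.exp_pos (-x)])
  refine ⟨fun t d => ∫ x, max 0 (1 - Real.exp (-x)) ∂(κ d t 0 : Measure ℝ), ?_, fun t => ?_⟩
  · filter_upwards [hκ, hmild] with d hd hm t
    refine (tendsto_integral_of_tendsto (𝕜 := ℝ) (hd.1 t 0) hcont hbd).congr' ?_
    obtain ⟨N, hN⟩ := exists_nat_ge d
    filter_upwards [eventually_ge_atTop N] with n hn
    exact (treeValue_eq_integral hp hp' hm.2 hm.1 hq hq' (hN.trans (by exact_mod_cast hn)) t).symm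
  -- The Gaussian limit is established along sequences of degrees, which suffices.
  · refine tendsto_of_seq_tendsto fun u hu => ?_
    rw [gaussGain_eq_integral (evo_nonneg hp hp' hlam.le hq hq' t)]
    refine tendsto_integral_of_tendsto (𝕜 := ℝ) (κ := gaussLaw (evo p lam q t) 0) ?_ hcont hbd
    exact tendsto_gaussLaw hp hp' hlam hq hq' (d := u) (ε := fun k => ε (u k))
      (κ := fun k => κ (u k)) (hε0.comp hu)
      ((hu.eventually (eventually_gt_atTop 0)).mono fun k hk => ⟨hk, hε _ hk⟩)
      ((hu.eventually hκ).mono fun k hk => hk.2) t 0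

theorem connectivity_eq_blockMatrix (hp : 0 < p) (hp' : p < 1) {a b c : ℝ}
    (h1 : p * a + (1 - p) * b = 1) (h2 : p * b + (1 - p) * c = 1) (d : ℝ) (n : ℕ) :
    connectivity a b c d n = blockMatrix p (1 - b) d n := by
  have h3 := (sub_pos.2 hp').ne'
  have ha : a = 1 + (1 - p) / p * (1 - b) := by
    field_simp
    linarith
  have hc : c = 1 + p / (1 - p) * (1 - b) := by
    field_simp
    linarith
  have hb : b = 1 - (1 - b) := by ring
  rw [blockMatrix, ← ha, ← hc, ← hb]

theorem eventually_entries_nonneg (hp : 0 < p) (hp' : p < 1) {a b c : ℝ → ℝ}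
    (h1 : ∀ d : ℝ, 0 < d → p * a d + (1 - p) * b d = 1)
    (h2 : ∀ d : ℝ, 0 < d → p * b d + (1 - p) * c d = 1)
    (hε : ∀ d : ℝ, 0 < d → d * (1 - b d) ^ 2 = lam) :
    ∀ᶠ d in atTop, 0 < d ∧ 0 ≤ a d ∧ 0 ≤ b d ∧ 0 ≤ c d := by
  have h0 : Tendsto (fun d => |1 - b d| * discBound p) atTop (𝓝 0) := by
    simpa using (tendsto_signal hε).abs.mul_const (discBound p)
  filter_upwards [eventually_gt_atTop 0, h0.eventually_le_const (by norm_num : (0:ℝ) < 1 / 2)]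
    with d hd hm
  obtain ⟨ha, hb, hc⟩ := entries_nonneg hp hp' hm
  have h3 := (sub_pos.2 hp').ne'
  have e1 : a d = 1 + (1 - p) / p * (1 - b d) := by
    field_simp
    linarith [h1 d hd]
  have e2 : c d = 1 + p / (1 - p) * (1 - b d) := by
    field_simp
    linarith [h2 d hd]
  rw [e1, e2]
  exact ⟨hd, ha, by linarith, hc⟩

end DenseLimit

end SBM
end
-- Conclusion: lower bound by belief propagation, upper bound for the optimal test.
theorem proposition2 (p lam : ℝ) (hp : 0 < p) (hp' : p ≤ 1 / 2) (hlam : 1 < lam) :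
    ∃ α : ℝ, IsLeast {μ : ℝ | 0 < μ ∧ SBM.gaussMap p lam μ = μ} α ∧
      ∀ a b c : ℝ → ℝ,
        (∀ d : ℝ, 0 < d → p * a d + (1 - p) * b d = 1) →
        (∀ d : ℝ, 0 < d → p * b d + (1 - p) * c d = 1) →
        (∀ d : ℝ, 0 < d → d * (1 - b d) ^ 2 = lam) →
        (∀ q : ℝ, 0 < q → q ≤ 1 →
          ∃ (t : ℕ) (T : ℝ → ∀ n : ℕ, SBM.Test n) (ℓ : ℝ → ℝ) (L : ℝ),
            (∀ (d : ℝ) (n : ℕ), SBM.IsLocal t (T d n)) ∧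
            (∀ᶠ d in atTop, Tendsto
              (fun n : ℕ => SBM.successProb (n := n) (SBM.connectivity (a d) (b d) (c d) d n) p q (T d n))
              atTop (𝓝 (ℓ d))) ∧
            Tendsto ℓ atTop (𝓝 L) ∧
            SBM.gaussSuccess α ≤ L) ∧
        ((∀ μ : ℝ, 0 < μ → SBM.gaussMap p lam μ = μ → μ = α) →
          limsup (fun d : ℝ => limsup (fun n : ℕ =>
            ((SBM.successProb (n := n) (SBM.connectivity (a d) (b d) (c d) d n) p 0
              (SBM.optTest (SBM.connectivity (a d) (b d) (c d) d n) p) : ℝ) : EReal)) atTop) atTop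
            ≤ ((SBM.gaussSuccess α : ℝ) : EReal)) := by
  have hp1 : p < 1 := by linarith
  have hlam0 : 0 < lam := by linarith
  obtain ⟨α, hα, hdiag⟩ := SBM.exists_isLeast_fixedPoint hp hp1 hlam
  refine ⟨α, hα, fun a b c h1 h2 hε => ⟨fun q hq hq' => ?_, fun huniq => ?_⟩⟩
  · obtain ⟨t, ht⟩ := SBM.exists_le_evo hp hp1 hlam0 hq hq' hdiag
    obtain ⟨ℓ, hℓ, hL⟩ := SBM.exists_tendsto_treeValue hp hp1 hlam0 (q := fun _ => q)
      (fun _ => hq.le) (fun _ => hq') (ε := fun d => 1 - b d) hε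
    refine ⟨t, fun d n => SBM.bpTest n (SBM.connectivity (a d) (b d) (c d) d n) (d / n) p q t, ℓ t, _,
      fun d n => SBM.isLocal_bpTest _ t, ?_, hL t, ?_⟩
    · filter_upwards [hℓ, SBM.eventually_entries_nonneg hp hp1 h1 h2 hε] with d hd hpos
      obtain ⟨hd0, ha, hb, hc⟩ := hpos
      have hdiff := SBM.tendsto_successProb_bpTest ha hb hc hd0 hp hp1 (h1 d hd0) (h2 d hd0) hq.le
        hq' t
      have htree := hd t
      simp_rw [← SBM.connectivity_eq_blockMatrix hp hp1 (h1 d hd0) (h2 d hd0)] at htree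
      simpa using hdiff.add htree
    · rw [SBM.gaussSuccess_eq hα.1.1]
      exact SBM.gaussGain_mono hα.1.1.le ht
  · obtain ⟨L, hL0, hfix, hconv⟩ := SBM.exists_tendsto_evo hp hp1 hlam0
    -- The limit L is 0 or a positive fixed point, and α is the only one of the latter.
    have hLα : L ≤ α := by
      rcases hL0.eq_or_lt with h | h
      · exact h ▸ hα.1.1.le
      · exact (huniq L h hfix).le
    have hgain : Tendsto (fun t => SBM.gaussGain
        (SBM.evo p lam (fun s => if s = 0 then 1 else 0) (t + 1))) atTop (𝓝 (SBM.gaussGain L)) :=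
      (SBM.continuous_gaussGain.tendsto L).comp hconv
    obtain ⟨ℓ, hℓ, hlim⟩ := SBM.exists_tendsto_treeValue hp hp1 hlam0
      (q := fun s => if s = 0 then 1 else 0) (fun s => by split_ifs <;> norm_num)
      (fun s => by split_ifs <;> norm_num) (ε := fun d => 1 - b d) hε
    rw [← EReal.le_of_forall_lt_iff_le]
    intro z hz
    rw [EReal.coe_lt_coe_iff, SBM.gaussSuccess_eq hα.1.1] at hz
    have hLz : SBM.gaussGain L < z := (SBM.gaussGain_mono hL0 hLα).trans_lt hz
    -- The depth is fixed before d and n: it only has to bring the tree value below z, which lies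
    -- strictly above the value at L. The remaining gap is then split between the two approximations
    -- in n.
    obtain ⟨t, ht⟩ := (hgain.eventually_lt_const hLz).exists
    refine limsup_le_of_le (by isBoundedDefault) ?_
    filter_upwards [hℓ, SBM.eventually_entries_nonneg hp hp1 h1 h2 hε,
      (hlim (t + 1)).eventually_lt_const ht] with d hd hpos hlt
    obtain ⟨hd0, ha, hb, hc⟩ := hpos
    refine limsup_le_of_le (by isBoundedDefault) ?_
    have htree := hd (t + 1)
    simp_rw [← SBM.connectivity_eq_blockMatrix hp hp1 (h1 d hd0) (h2 d hd0)] at htree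
    have hgap : 0 < (z - ℓ (t + 1) d) / 2 := by linarith
    filter_upwards [SBM.eventually_successProb_optTest_le ha hb hc hd0 hp hp1 (h1 d hd0) (h2 d hd0) t
      hgap, htree.eventually_lt_const (by linarith : ℓ (t + 1) d < (z + ℓ (t + 1) d) / 2)]
      with n hn hn'
    rw [EReal.coe_le_coe_iff]
    linarith
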